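/- Let $A$ be a unital C$^*$-algebra and $B$ a C$^*$-algebra. An $A$-$B$ C$^*$-correspondence is a (right) Hilbert $B$-module $X$ together with a (not necessarily unital) $*$-homomorphism $\pi_X$ from $A$ into the adjointable operators on $X$. For $\xi\in X$ put $\Omega_\xi(a)=\langle\xi,\pi_X(a)\xi\rangle$ ($a\in A$), and let $\mathcal F_X$ be the convex hull of $\{\Omega_\xi:\xi\in X\}$ in the set of completely positive maps $A\to B$. For a $*$-representation $(H,\pi_H)$ of $B$ let $X\otimes_B H$ be the Hilbert space obtained from $X\odot H$ by separation and completion with respect to $\langle\xi\otimes h,\xi'\otimes h'\rangle=\langle h,\pi_H(\langle\xi,\xi'\rangle)h'\rangle$, and let $\theta_X^H: A\otimes_{\max}\pi_H(B)'\to\mathbb B(X\otimes_B H)$ be the $*$-representation with $\theta_X^H(a\otimes x)=\pi_X(a)\otimes x$. For $A$-$B$ C$^*$-correspondences $X,Y$ write $X\prec_H Y$ if $\ker\theta_Y^H\subseteq\ker\theta_X^H$. For a von Neumann algebra $M$ and $A$-$M$ C$^*$-correspondences $X, Y$ write $X\prec Y$ if $X\prec_K Y$ for every faithful normal (nondegenerate)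 representation $K$ of $M$. Let $X,Y$ be $A$-$B$ C$^*$-correspondences, let $(H,\pi_H)$ be a nondegenerate $*$-representation of $B$, and set $M=\pi_H(B)''$. Then the following are equivalent: 1. $X\prec_H Y$. 2. For every $\xi\in X$ there is a net $(\psi_i)_i$ in $\mathcal F_Y$ such that $\pi_H(\psi_i(a))\to\pi_H(\Omega_\xi(a))$ $\sigma$-weakly for every $a\in A$. 3. For every $\xi\in X$ there is a net $(\psi_i)_i$ in $\mathcal F_Y$ such that $\psi_i(1_A)\le\Omega_\xi(1_A)$ for all $i$ and $\pi_H(\psi_i(a))\to\pi_H(\Omega_\xi(a))$ $\sigma$-weakly for every $a\in A$. 4. $X\otimes_B M\prec Y\otimes_B M$, where $X\otimes_B M$ is the $A$-$M$ C$^*$-correspondence obtained from $X\odot M$ by separation and completion with respect to $\langle\xi\otimes m,\xi'\otimes m'\rangle=m^*\pi_H(\langle\xi,\xi'\rangle)m'$, with left action $\pi_X\otimes 1$. 5. $X\otimes_B M\prec_K Y\otimes_B M$ for some faithful normal (nondegenerate) representation $K$ of $M$. Moreover, if $(H_u,\pi_u)$ denotes the universal representation of $B$ (the direct sum of the GNS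 representations of all states of $B$), then the following are equivalent: 1. $X\prec_{H_u}Y$. 2. For every $\xi\in X$ the map $\Omega_\xi$ belongs to the point-norm closure of $\mathcal F_Y$. 3. For every $\xi\in X$ there is a net $(\psi_i)_i$ in $\mathcal F_Y$ such that $\psi_i(1_A)\le\Omega_\xi(1_A)$ for all $i$ and $\lim_i\|\Omega_\xi(a)-\psi_i(a)\|=0$ for every $a\in A$. -/

import Mathlib

universe u v w x y

noncomputable section

namespace CStarCorr

open scoped TensorProduct ComplexOrder InnerProductSpace


section Aux

variable {D : Type*} [NonUnitalCStarAlgebra D] [PartialOrder D] [StarOrderedRing D]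

lemma exists_neg_witness (a : D) (ha : IsSelfAdjoint a) :
    ∃ n e : D, star n * a * n = -(star e * e) ∧ (e = 0 → 0 ≤ a) := by
  have h0 : 0 ≤ a⁻ * a⁻ * a⁻ := by
    have := star_left_conjugate_nonneg (CFC.negPart_nonneg a) (a⁻)
    rwa [(IsSelfAdjoint.of_nonneg (CFC.negPart_nonneg a)).star_eq] at this
  obtain ⟨e, he⟩ := CStarAlgebra.nonneg_iff_eq_star_mul_self.mp h0
  refine ⟨a⁻, e, ?_, fun h => ?_⟩
  · rw [← he, (IsSelfAdjoint.of_nonneg (CFC.negPart_nonneg a)).star_eq]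
    nth_rewrite 2 [← CFC.posPart_sub_negPart a ha]
    rw [mul_sub, CFC.negPart_mul_posPart, zero_sub, neg_mul]
  · have h3 : a⁻ * a⁻ * a⁻ = 0 := by rw [he, h]; simp
    have hs := (IsSelfAdjoint.of_nonneg (CFC.negPart_nonneg a)).star_eq
    have h2 : a⁻ * a⁻ = 0 := by
      have : star (a⁻ * a⁻) * (a⁻ * a⁻) = 0 := by
        rw [star_mul, hs, ← mul_assoc, h3, zero_mul]
      exact CStarRing.star_mul_self_eq_zero_iff _ |>.mp this
    have h1 : a⁻ = 0 := by
      have : star (a⁻) * a⁻ = 0 := by rw [hs, h2]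
      exact CStarRing.star_mul_self_eq_zero_iff _ |>.mp this
    exact (CFC.negPart_eq_zero_iff a ha).mp h1

lemma exists_eq_star_mul_self {a : D} (ha : 0 ≤ a) : ∃ d : D, a = star d * d :=
  CStarAlgebra.nonneg_iff_eq_star_mul_self.mp ha

end Aux

section HilbertModule

variable {B : Type v} {X : Type w} [NonUnitalCStarAlgebra B] [PartialOrder B] [StarOrderedRing B]
  [NormedAddCommGroup X] [NormedSpace ℂ X] [SMul Bᵐᵒᵖ X] [CStarModule Bᵐᵒᵖ X]

variable (B) in
/-- The `B`-valued inner product of a right Hilbert `B`-module. Mathlib's `CStarModule` is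
written for left actions, so a right Hilbert `B`-module is a `CStarModule` over `Bᵐᵒᵖ`, the
right action `ξ b` being `MulOpposite.op b • ξ`. -/
def rinner (ξ η : X) : B := (inner Bᵐᵒᵖ ξ η).unop

lemma rinner_add_right (ξ η ζ : X) : rinner B ξ (η + ζ) = rinner B ξ η + rinner B ξ ζ := by
  simp [rinner]

lemma rinner_add_left (ξ η ζ : X) : rinner B (ξ + η) ζ = rinner B ξ ζ + rinner B η ζ := by
  simp [rinner]

lemma rinner_smul_right (c : ℂ) (ξ η : X) : rinner B ξ (c • η) = c • rinner B ξ η := by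
  simp [rinner]

lemma rinner_smul_left (c : ℂ) (ξ η : X) : rinner B (c • ξ) η = star c • rinner B ξ η := by
  simp [rinner]

lemma rinner_star (ξ η : X) : star (rinner B ξ η) = rinner B η ξ := by
  simp only [rinner, ← MulOpposite.unop_star, CStarModule.star_inner]

lemma rinner_op_smul_right (b : B) (ξ η : X) :
    rinner B ξ (MulOpposite.op b • η) = rinner B ξ η * b := by
  simp [rinner]

lemma rinner_op_smul_left (b : B) (ξ η : X) :
    rinner B (MulOpposite.op b • ξ) η = star b * rinner B ξ η := by
  rw [← rinner_star, rinner_op_smul_right, star_mul, rinner_star]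

lemma rinner_self_nonneg (ξ : X) : 0 ≤ rinner B ξ ξ :=
  MulOpposite.unop_nonneg.2 CStarModule.inner_self_nonneg

lemma rinner_sum_right {ι : Type*} (s : Finset ι) (ξ : X) (η : ι → X) :
    rinner B ξ (∑ i ∈ s, η i) = ∑ i ∈ s, rinner B ξ (η i) := by
  simp [rinner]

lemma rinner_sum_left {ι : Type*} (s : Finset ι) (ξ : ι → X) (η : X) :
    rinner B (∑ i ∈ s, ξ i) η = ∑ i ∈ s, rinner B (ξ i) η := by
  simp [rinner]

/-- A Gram matrix of a Hilbert module is positive, hence of the form `d* d`. -/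
lemma exists_gram {ι : Type*} [Fintype ι] (ξ : ι → X) :
    ∃ d : ι → ι → B, ∀ i j, rinner B (ξ i) (ξ j) = ∑ k, star (d k i) * d k j := by
  classical
  let a : CStarMatrix ι ι B := CStarMatrix.ofMatrix (Matrix.of fun i j => rinner B (ξ i) (ξ j))
  have ha : IsSelfAdjoint a := by
    ext i j
    simp [a, CStarMatrix.star_apply, rinner_star]
  have hdiag : ∀ (c : CStarMatrix ι ι B) (i : ι), 0 ≤ (star c * a * c) i i := by
    intro c i
    have : (star c * a * c) i i = rinner B (∑ k, MulOpposite.op (c k i) • ξ k)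
        (∑ k, MulOpposite.op (c k i) • ξ k) := by
      simp only [rinner_sum_right, rinner_sum_left, rinner_op_smul_right, rinner_op_smul_left,
        CStarMatrix.mul_apply, CStarMatrix.star_apply, a, Finset.sum_mul]
      rfl
    rw [this]
    exact rinner_self_nonneg _
  have hsq : ∀ (c : CStarMatrix ι ι B) (i : ι),
      (star c * c) i i = ∑ k, star (c k i) * c k i := by
    intro c i
    simp [CStarMatrix.mul_apply, CStarMatrix.star_apply]
  have hpos : 0 ≤ a := by
    obtain ⟨n, e, hne, he⟩ := exists_neg_witness a ha
    refine he ?_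
    have hz : ∀ i k, e k i = 0 := by
      intro i k
      have h1 := hdiag n i
      rw [hne] at h1
      have h2 : (star e * e) i i ≤ 0 := by
        have : (-(star e * e)) i i = -((star e * e) i i) := rfl
        rw [this] at h1
        exact neg_nonneg.mp h1
      rw [hsq] at h2
      have h3 := (Finset.sum_eq_zero_iff_of_nonneg
        (fun k _ => star_mul_self_nonneg (e k i))).mp
        (le_antisymm h2 (Finset.sum_nonneg fun k _ => star_mul_self_nonneg (e k i)))
      exact CStarRing.star_mul_self_eq_zero_iff _ |>.mp (h3 k (Finset.mem_univ k))
    ext i j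
    exact hz j i
  obtain ⟨d, hd⟩ := exists_eq_star_mul_self hpos
  refine ⟨fun i j => d i j, fun i j => ?_⟩
  have := congr_fun (congr_fun hd i) j
  simpa [a, CStarMatrix.mul_apply, CStarMatrix.star_apply] using this

end HilbertModule

section Form

variable {B : Type v} {X : Type w} [NonUnitalCStarAlgebra B] [PartialOrder B] [StarOrderedRing B]
  [NormedAddCommGroup X] [NormedSpace ℂ X] [SMul Bᵐᵒᵖ X] [CStarModule Bᵐᵒᵖ X]
  {C : Type*} [NonUnitalCStarAlgebra C] [PartialOrder C] [StarOrderedRing C]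
  {Y : Type*} [AddCommGroup Y] [Module ℂ Y]

/-- The sesquilinear form `⟨ξ ⊗ y, ξ' ⊗ y'⟩ = ⟨y, ρ(⟨ξ, ξ'⟩) y'⟩` on the algebraic tensor product
`X ⊙ Y`, for a `C`-valued form `g` on `Y` and an action `ρ` of `B` on `Y`. -/
def intForm (g : Y →ₗ⋆[ℂ] Y →ₗ[ℂ] C) (ρ : B →ₙₐ[ℂ] Module.End ℂ Y) :
    X ⊗[ℂ] Y →ₗ⋆[ℂ] X ⊗[ℂ] Y →ₗ[ℂ] C :=
  TensorProduct.lift <| LinearMap.mk₂'ₛₗ (starRingEnd ℂ) (starRingEnd ℂ)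
    (fun (ξ : X) (y : Y) => TensorProduct.lift <| LinearMap.mk₂ ℂ
      (fun (ξ' : X) (y' : Y) => g y (ρ (rinner B ξ ξ') y'))
      (fun m₁ m₂ n => by simp [rinner_add_right])
      (fun c m n => by simp [rinner_smul_right])
      (fun m n₁ n₂ => by simp)
      (fun c m n => by simp))
    (fun m₁ m₂ n => by ext; simp [rinner_add_left])
    (fun c m n => by ext; simp [rinner_smul_left])
    (fun m n₁ n₂ => by ext; simp)
    (fun c m n => by ext; simp)

variable {g : Y →ₗ⋆[ℂ] Y →ₗ[ℂ] C} {ρ : B →ₙₐ[ℂ] Module.End ℂ Y}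

lemma intForm_tmul (ξ ξ' : X) (y y' : Y) :
    intForm g ρ (ξ ⊗ₜ[ℂ] y) (ξ' ⊗ₜ[ℂ] y') = g y (ρ (rinner B ξ ξ') y') := rfl

lemma intForm_star (hs : ∀ y z, star (g y z) = g z y)
    (hρ : ∀ b y z, g y (ρ b z) = g (ρ (star b) y) z) (s t : X ⊗[ℂ] Y) :
    star (intForm g ρ s t) = intForm g ρ t s := by
  induction s with
  | zero => simp
  | add s₁ s₂ h₁ h₂ => simp [h₁, h₂]
  | tmul ξ y =>
    induction t with
    | zero => simp
    | add t₁ t₂ h₁ h₂ => simp [h₁, h₂]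
    | tmul ξ' y' => rw [intForm_tmul, intForm_tmul, hs, hρ (rinner B ξ' ξ), rinner_star]

/-- Adjoints for the form. -/
lemma intForm_adj {S S' : Module.End ℂ X} {T T' : Module.End ℂ Y}
    (hS : ∀ ξ η, rinner B ξ (S η) = rinner B (S' ξ) η)
    (hT : ∀ y z, g y (T z) = g (T' y) z)
    (hc : ∀ b y, T (ρ b y) = ρ b (T y)) (s t : X ⊗[ℂ] Y) :
    intForm g ρ s (TensorProduct.map S T t) = intForm g ρ (TensorProduct.map S' T' s) t := by
  induction s with
  | zero => simp
  | add s₁ s₂ h₁ h₂ => simp [h₁, h₂]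
  | tmul ξ y =>
    induction t with
    | zero => simp
    | add t₁ t₂ h₁ h₂ => simp [h₁, h₂]
    | tmul ξ' y' =>
      rw [TensorProduct.map_tmul, TensorProduct.map_tmul, intForm_tmul, intForm_tmul, hS, ← hc, hT]

/-- The form is a finite sum of squares, uniformly over operators commuting with `ρ`. -/
lemma intForm_sq (hρ : ∀ b y z, g y (ρ b z) = g (ρ (star b) y) z) (s : X ⊗[ℂ] Y) :
    ∃ (F : Finset (X × Y)) (z : F → Y), ∀ T : Module.End ℂ Y,
      (∀ b y, T (ρ b y) = ρ b (T y)) →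
      intForm g ρ (TensorProduct.map LinearMap.id T s) (TensorProduct.map LinearMap.id T s)
        = ∑ k, g (T (z k)) (T (z k)) := by
  obtain ⟨F, rfl⟩ := TensorProduct.exists_finset s
  obtain ⟨d, hd⟩ := exists_gram (B := B) (fun i : F => i.1.1)
  refine ⟨F, fun k => ∑ i : F, ρ (d k i) i.1.2, fun T hT => ?_⟩
  have h0 : TensorProduct.map LinearMap.id T (∑ i ∈ F, i.1 ⊗ₜ[ℂ] i.2)
      = ∑ i : F, i.1.1 ⊗ₜ[ℂ] T i.1.2 := by
    rw [map_sum, ← Finset.sum_coe_sort F]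
    simp
  rw [h0]
  simp only [map_sum, LinearMap.sum_apply, intForm_tmul, hd, hT]
  have h1 : ∀ i j k : F, g (T i.1.2) (ρ (star (d k i) * d k j) (T j.1.2)) =
      g (ρ (d k i) (T i.1.2)) (ρ (d k j) (T j.1.2)) := by
    intro i j k
    rw [map_mul, Module.End.mul_apply, hρ, star_star]
  simp only [h1]
  conv_rhs => rw [Finset.sum_comm]
  exact Finset.sum_congr rfl fun j _ => Finset.sum_comm

lemma intForm_nonneg (hg : ∀ y, 0 ≤ g y y)
    (hρ : ∀ b y z, g y (ρ b z) = g (ρ (star b) y) z) (s : X ⊗[ℂ] Y) :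
    0 ≤ intForm g ρ s s := by
  obtain ⟨F, z, h⟩ := intForm_sq hρ s
  have := h LinearMap.id (fun _ _ => rfl)
  simp only [TensorProduct.map_id, LinearMap.id_apply] at this
  rw [this]
  exact Finset.sum_nonneg fun k _ => hg _

/-- A left action by a unital C⋆-algebra is contractive for the form. -/
lemma intForm_act_le {A : Type*} [CStarAlgebra A] {φ : A →ₙₐ[ℂ] Module.End ℂ X}
    (hφ : ∀ a ξ η, rinner B ξ (φ a η) = rinner B (φ (star a) ξ) η)
    (hg : ∀ y, 0 ≤ g y y)
    (hρ : ∀ b y z, g y (ρ b z) = g (ρ (star b) y) z) (a : A) (s : X ⊗[ℂ] Y) :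
    intForm g ρ (TensorProduct.map (φ a) LinearMap.id s) (TensorProduct.map (φ a) LinearMap.id s)
      ≤ ((‖a‖ ^ 2 : ℝ) : ℂ) • intForm g ρ s s := by
  let L : A →ₗ[ℂ] Module.End ℂ (X ⊗[ℂ] Y) :=
    { toFun := fun a => TensorProduct.map (φ a) LinearMap.id
      map_add' := fun a b => by rw [map_add, TensorProduct.map_add_left]
      map_smul' := fun c a => by rw [map_smul, TensorProduct.map_smul_left]; rfl }
  have hmul : ∀ a b s, L a (L b s) = L (a * b) s := by
    intro a b s
    simp only [L, LinearMap.coe_mk, AddHom.coe_mk, map_mul]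
    rw [← LinearMap.comp_apply, ← TensorProduct.map_comp]
    rfl
  have hadj : ∀ a s t, intForm g ρ s (L a t) = intForm g ρ (L (star a) s) t := fun a s t =>
    intForm_adj (hφ a) (fun _ _ => rfl) (fun _ _ => rfl) s t
  have hsq : ∀ a s, intForm g ρ (L a s) (L a s) = intForm g ρ s (L (star a * a) s) := by
    intro a s
    rw [← hmul, hadj (star a), star_star]
  have hnn := intForm_nonneg (X := X) hg hρ
  obtain ⟨c, hc⟩ : ∃ c : A, star a * a + star c * c = ((‖a‖ ^ 2 : ℝ) : ℂ) • (1 : A) := by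
    let _ : PartialOrder A := CStarAlgebra.spectralOrder A
    have _ : StarOrderedRing A := CStarAlgebra.spectralOrderedRing A
    have h : star a * a ≤ algebraMap ℝ A (‖a‖ ^ 2) := CStarAlgebra.star_mul_le_algebraMap_norm_sq
    obtain ⟨c, hc⟩ := exists_eq_star_mul_self (sub_nonneg.mpr h)
    refine ⟨c, ?_⟩
    rw [← hc, Algebra.algebraMap_eq_smul_one, Complex.coe_smul]
    abel
  have h1 : intForm g ρ (L a s) (L a s) + intForm g ρ (L c s) (L c s)
      = ((‖a‖ ^ 2 : ℝ) : ℂ) • intForm g ρ (L 1 s) (L 1 s) := by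
    rw [hsq, hsq, hsq, ← map_add, ← LinearMap.add_apply, ← map_add, hc]
    simp
  have h2 : intForm g ρ s s = intForm g ρ (L 1 s) (L 1 s)
      + intForm g ρ (s - L 1 s) (s - L 1 s) := by
    have e1 : intForm g ρ (L 1 s) (L 1 s) = intForm g ρ s (L 1 s) := by rw [hsq]; simp
    have e2 : intForm g ρ (L 1 s) s = intForm g ρ s (L 1 s) := by rw [hadj]; simp
    simp only [map_sub, LinearMap.sub_apply, e1, e2]
    abel
  calc intForm g ρ (L a s) (L a s)
      ≤ intForm g ρ (L a s) (L a s) + intForm g ρ (L c s) (L c s) :=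
        le_add_of_nonneg_right (hnn _)
    _ = ((‖a‖ ^ 2 : ℝ) : ℂ) • intForm g ρ (L 1 s) (L 1 s) := h1
    _ ≤ ((‖a‖ ^ 2 : ℝ) : ℂ) • intForm g ρ s s := by
        rw [Complex.coe_smul, Complex.coe_smul]
        refine smul_le_smul_of_nonneg_left ?_ (by positivity)
        rw [h2]
        exact le_add_of_nonneg_right (hnn _)

end Form

/-- An `A`-`B` C⋆-correspondence, for a unital C⋆-algebra `A`: a right Hilbert `B`-module
`carrier` (complete for the norm `‖⟨ξ, ξ⟩‖^(1/2)`) together with a (not necessarily unital)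
⋆-homomorphism from `A` to the adjointable operators. That `act` takes values in the adjointable
operators and preserves the involution is the single condition `rinner_act`. -/
structure Corr (A : Type u) (B : Type v) [CStarAlgebra A] [NonUnitalCStarAlgebra B]
    [PartialOrder B] [StarOrderedRing B] where
  carrier : Type w
  [normedAddCommGroup : NormedAddCommGroup carrier]
  [normedSpace : NormedSpace ℂ carrier]
  [completeSpace : CompleteSpace carrier]
  [smul : SMul Bᵐᵒᵖ carrier]
  [cstarModule : CStarModule Bᵐᵒᵖ carrier]
  act : A →ₙₐ[ℂ] Module.End ℂ carrier
  rinner_act : ∀ (a : A) (ξ η : carrier), rinner B ξ (act a η) = rinner B (act (star a) ξ) η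

attribute [instance] Corr.normedAddCommGroup Corr.normedSpace Corr.completeSpace Corr.smul
  Corr.cstarModule

section Representations

variable {B : Type v} [NonUnitalCStarAlgebra B]
  {H : Type x} [NormedAddCommGroup H] [InnerProductSpace ℂ H] [CompleteSpace H]

/-- A ⋆-representation on `H` is nondegenerate if the span of `π(B)H` is dense. -/
def Nondegenerate (π : B →⋆ₙₐ[ℂ] (H →L[ℂ] H)) : Prop :=
  Dense (Submodule.span ℂ {h : H | ∃ (b : B) (k : H), π b k = h} : Set H)

/-- The commutant `π(B)'`. -/
def commutant (π : B →⋆ₙₐ[ℂ] (H →L[ℂ] H)) : StarSubalgebra ℂ (H →L[ℂ] H) :=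
  StarSubalgebra.centralizer ℂ (Set.range π)

lemma mem_commutant {π : B →⋆ₙₐ[ℂ] (H →L[ℂ] H)} {T : H →L[ℂ] H} :
    T ∈ commutant π ↔ ∀ b, π b * T = T * π b := by
  rw [commutant, StarSubalgebra.mem_centralizer_iff]
  constructor
  · intro h b
    exact (h _ ⟨b, rfl⟩).1
  · rintro h _ ⟨b, rfl⟩
    refine ⟨h b, ?_⟩
    rw [← map_star]
    exact h _

instance (π : B →⋆ₙₐ[ℂ] (H →L[ℂ] H)) : IsClosed (commutant π : Set (H →L[ℂ] H)) := by
  have : (commutant π : Set (H →L[ℂ] H)) = ⋂ b, {T | π b * T = T * π b} := by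
    ext T
    simp [mem_commutant]
  rw [this]
  exact isClosed_iInter fun b => isClosed_eq (by fun_prop) (by fun_prop)

/-- `π` as an action by linear maps. -/
def repEnd (π : B →⋆ₙₐ[ℂ] (H →L[ℂ] H)) : B →ₙₐ[ℂ] Module.End ℂ H where
  toFun b := (π b : H →ₗ[ℂ] H)
  map_smul' c b := by ext; simp
  map_zero' := by ext; simp
  map_add' b c := by ext; simp
  map_mul' b c := by ext; simp

lemma repEnd_apply (π : B →⋆ₙₐ[ℂ] (H →L[ℂ] H)) (b : B) (h : H) : repEnd π b h = π b h := rfl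

lemma repEnd_adj (π : B →⋆ₙₐ[ℂ] (H →L[ℂ] H)) (b : B) (y z : H) :
    innerₛₗ ℂ y (repEnd π b z) = innerₛₗ ℂ (repEnd π (star b) y) z := by
  simp only [repEnd_apply, innerₛₗ_apply_apply, map_star, ContinuousLinearMap.star_eq_adjoint,
    ContinuousLinearMap.adjoint_inner_left]

end Representations

section IntTensor

lemma map_map_apply {E F : Type*} [AddCommGroup E] [Module ℂ E] [AddCommGroup F] [Module ℂ F]
    (S : Module.End ℂ E) (T : Module.End ℂ F) (S' : Module.End ℂ E) (T' : Module.End ℂ F)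
    (s : E ⊗[ℂ] F) :
    TensorProduct.map S T (TensorProduct.map S' T' s)
      = TensorProduct.map (S ∘ₗ S') (T ∘ₗ T') s := by
  rw [TensorProduct.map_comp]
  rfl

variable {A : Type u} {B : Type v} [CStarAlgebra A] [NonUnitalCStarAlgebra B]
  [PartialOrder B] [StarOrderedRing B]
  {H : Type x} [NormedAddCommGroup H] [InnerProductSpace ℂ H] [CompleteSpace H]

/-- The algebraic tensor product `X ⊙ H`, carrying the semi-inner product of `X ⊗_B H`. -/
def PreIntTensor (X : Corr.{u, v, w} A B) (_π : B →⋆ₙₐ[ℂ] (H →L[ℂ] H)) : Type (max w x) :=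
  X.carrier ⊗[ℂ] H

variable (X : Corr.{u, v, w} A B) (π : B →⋆ₙₐ[ℂ] (H →L[ℂ] H))

instance : AddCommGroup (PreIntTensor X π) := inferInstanceAs (AddCommGroup (X.carrier ⊗[ℂ] H))
instance : Module ℂ (PreIntTensor X π) := inferInstanceAs (Module ℂ (X.carrier ⊗[ℂ] H))

/-- The semi-inner product `⟨ξ ⊗ h, ξ' ⊗ h'⟩ = ⟨h, π(⟨ξ, ξ'⟩) h'⟩`. -/
abbrev intCore : PreInnerProductSpace.Core ℂ (PreIntTensor X π) where
  inner s t := intForm (X := X.carrier) (innerₛₗ ℂ) (repEnd π) s t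
  conj_inner_symm s t := intForm_star (X := X.carrier)
    (fun y z => by simp) (repEnd_adj π) t s
  re_inner_nonneg s := (Complex.nonneg_iff.mp
    (intForm_nonneg (X := X.carrier) (g := innerₛₗ ℂ) (fun y => by simp) (repEnd_adj π) s)).1
  add_left s t r := by
    exact LinearMap.map_add₂ (intForm (X := X.carrier) (innerₛₗ ℂ) (repEnd π)) s t r
  smul_left s t c := by
    exact LinearMap.map_smulₛₗ₂ (intForm (X := X.carrier) (innerₛₗ ℂ) (repEnd π)) c s t

instance : SeminormedAddCommGroup (PreIntTensor X π) :=
  InnerProductSpace.Core.toSeminormedAddCommGroup (c := intCore X π)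

instance : InnerProductSpace ℂ (PreIntTensor X π) := InnerProductSpace.ofCore (intCore X π)

/-- The Hilbert space `X ⊗_B H`: separation and completion of `X ⊙ H`. -/
abbrev IntTensor : Type (max w x) := UniformSpace.Completion (PreIntTensor X π)

lemma preInt_inner (s t : PreIntTensor X π) :
    inner ℂ s t = intForm (X := X.carrier) (innerₛₗ ℂ) (repEnd π) s t := rfl

lemma preInt_norm_sq (s : PreIntTensor X π) :
    intForm (X := X.carrier) (innerₛₗ ℂ) (repEnd π) s s = ((‖s‖ ^ 2 : ℝ) : ℂ) := by
  rw [← preInt_inner, inner_self_eq_norm_sq_to_K]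
  simp

lemma preInt_bound (a : A) (T : commutant π) (s : PreIntTensor X π) :
    ‖(show PreIntTensor X π from TensorProduct.map (X.act a) (T.1 : H →ₗ[ℂ] H) s)‖
      ≤ ‖a‖ * ‖T‖ * ‖s‖ := by
  have hT : ∀ b (y : H), (T.1 : H →ₗ[ℂ] H) (repEnd π b y) = repEnd π b ((T.1 : H →ₗ[ℂ] H) y) :=
    fun b y => (congr($(mem_commutant.mp T.2 b) y)).symm
  let t : PreIntTensor X π := TensorProduct.map LinearMap.id (T.1 : H →ₗ[ℂ] H) s
  have h1 : ‖t‖ ≤ ‖T‖ * ‖s‖ := by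
    obtain ⟨F, z, hz⟩ := intForm_sq (X := X.carrier) (repEnd_adj π) s
    have e1 := hz _ hT
    have e2 := hz LinearMap.id (fun _ _ => rfl)
    simp only [TensorProduct.map_id, LinearMap.id_apply] at e2
    have e1' : ‖t‖ ^ 2 = ∑ k, ‖T.1 (z k)‖ ^ 2 := by
      have := preInt_norm_sq X π t
      rw [show t = TensorProduct.map LinearMap.id (T.1 : H →ₗ[ℂ] H) s from rfl, e1] at this
      simp only [innerₛₗ_apply_apply, ContinuousLinearMap.coe_coe,
        inner_self_eq_norm_sq_to_K] at this
      have h : ((∑ k, ‖T.1 (z k)‖ ^ 2 : ℝ) : ℂ) = ((‖t‖ ^ 2 : ℝ) : ℂ) := by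
        rw [← this]; push_cast; rfl
      exact (Complex.ofReal_injective h).symm
    have e2' : ‖s‖ ^ 2 = ∑ k, ‖z k‖ ^ 2 := by
      have this : (∑ k, innerₛₗ ℂ (z k) (z k)) = _ := e2.symm.trans (preInt_norm_sq X π s)
      simp only [innerₛₗ_apply_apply, inner_self_eq_norm_sq_to_K] at this
      have h : ((∑ k, ‖z k‖ ^ 2 : ℝ) : ℂ) = ((‖s‖ ^ 2 : ℝ) : ℂ) := by
        rw [← this]; push_cast; rfl
      exact (Complex.ofReal_injective h).symm
    refine le_of_sq_le_sq ?_ (by positivity)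
    rw [mul_pow, e1', e2', Finset.mul_sum]
    refine Finset.sum_le_sum fun k _ => ?_
    rw [← mul_pow]
    exact pow_le_pow_left₀ (norm_nonneg _) (T.1.le_opNorm _) 2
  have h2 : ‖(show PreIntTensor X π from TensorProduct.map (X.act a) LinearMap.id t)‖
      ≤ ‖a‖ * ‖t‖ := by
    refine le_of_sq_le_sq ?_ (by positivity)
    have := intForm_act_le (X := X.carrier) (g := innerₛₗ ℂ) X.rinner_act (fun y => by simp)
      (repEnd_adj π) a t
    rw [preInt_norm_sq X π t] at this
    have h3 := preInt_norm_sq X π (TensorProduct.map (X.act a) LinearMap.id t)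
    rw [h3, smul_eq_mul, ← Complex.ofReal_mul, Complex.real_le_real] at this
    rw [mul_pow]
    exact this
  have h3 : TensorProduct.map (X.act a) (T.1 : H →ₗ[ℂ] H) s
      = TensorProduct.map (X.act a) LinearMap.id t :=
    (map_map_apply (X.act a) LinearMap.id LinearMap.id (T.1 : H →ₗ[ℂ] H) s).symm
  rw [h3, mul_assoc]
  exact h2.trans (by gcongr)

/-- The operator `π_X(a) ⊗ T` on `X ⊙ H`, for `T` in the commutant. -/
def preOp (a : A) (T : commutant π) : PreIntTensor X π →L[ℂ] PreIntTensor X π :=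
  LinearMap.mkContinuous (E := PreIntTensor X π) (F := PreIntTensor X π)
    (TensorProduct.map (X.act a) (T.1 : H →ₗ[ℂ] H)) (‖a‖ * ‖T‖) (preInt_bound X π a T)

lemma preOp_apply (a : A) (T : commutant π) (s : PreIntTensor X π) :
    preOp X π a T s = TensorProduct.map (X.act a) (T.1 : H →ₗ[ℂ] H) s := rfl

/-- The operator `π_X(a) ⊗ T` on `X ⊗_B H`, for `T` in the commutant. -/
def tensorOp (a : A) (T : commutant π) : IntTensor X π →L[ℂ] IntTensor X π :=
  (preOp X π a T).completion

variable {X π}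

lemma tensorOp_coe (a : A) (T : commutant π) (s : PreIntTensor X π) :
    tensorOp X π a T s = (preOp X π a T s : IntTensor X π) := by
  simp [tensorOp]

lemma intTensor_ext {f g : IntTensor X π →L[ℂ] IntTensor X π}
    (h : ∀ s : PreIntTensor X π, f s = g s) : f = g := by
  ext z
  induction z using UniformSpace.Completion.induction_on with
  | hp => exact isClosed_eq f.continuous g.continuous
  | ih s => exact h s

lemma norm_tensorOp_le (a : A) (T : commutant π) : ‖tensorOp X π a T‖ ≤ ‖a‖ * ‖T‖ := by
  refine ContinuousLinearMap.opNorm_le_bound _ (by positivity) fun z => ?_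
  induction z using UniformSpace.Completion.induction_on with
  | hp => exact isClosed_le (by fun_prop) (by fun_prop)
  | ih s =>
    rw [tensorOp_coe, UniformSpace.Completion.norm_coe, UniformSpace.Completion.norm_coe]
    exact preInt_bound X π a T s

lemma tensorOp_mul (a b : A) (S T : commutant π) :
    tensorOp X π (a * b) (S * T) = tensorOp X π a S * tensorOp X π b T := by
  refine intTensor_ext fun s => ?_
  rw [mul_apply_eq_comp, tensorOp_coe, tensorOp_coe, tensorOp_coe]
  congr 1
  have h := map_map_apply (X.act a) (S.1 : H →ₗ[ℂ] H) (X.act b) (T.1 : H →ₗ[ℂ] H) s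
  refine Eq.trans ?_ h.symm
  rw [preOp_apply, map_mul]
  rfl

lemma tensorOp_star (a : A) (T : commutant π) :
    tensorOp X π (star a) (star T) = star (tensorOp X π a T) := by
  rw [ContinuousLinearMap.star_eq_adjoint, ContinuousLinearMap.eq_adjoint_iff]
  intro x y
  induction x, y using UniformSpace.Completion.induction_on₂ with
  | hp => exact isClosed_eq (by fun_prop) (by fun_prop)
  | ih s t =>
    rw [tensorOp_coe, tensorOp_coe, UniformSpace.Completion.inner_coe,
      UniformSpace.Completion.inner_coe]
    refine (intForm_adj (X := X.carrier) (g := innerₛₗ ℂ) (ρ := repEnd π) (X.rinner_act a)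
      (T := (T.1 : H →ₗ[ℂ] H)) (T' := ((star T).1 : H →ₗ[ℂ] H)) (fun y z => ?_)
      (fun b y => (congr($(mem_commutant.mp T.2 b) y)).symm) s t).symm
    simp [ContinuousLinearMap.star_eq_adjoint, ContinuousLinearMap.adjoint_inner_left]

variable (X π)

/-- The ⋆-representation `θ_X^H` on the algebraic tensor product `A ⊙ π(B)'`, given by
`θ(a ⊗ T) = π_X(a) ⊗ T`. -/
def thetaAlg : A ⊗[ℂ] commutant π →ₗ[ℂ] (IntTensor X π →L[ℂ] IntTensor X π) :=
  TensorProduct.lift <| LinearMap.mk₂ ℂ (fun a T => tensorOp X π a T)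
    (fun a b T => intTensor_ext fun s => by
      rw [add_apply, tensorOp_coe, tensorOp_coe, tensorOp_coe,
        ← UniformSpace.Completion.coe_add]
      congr 1
      simp only [preOp_apply, map_add, TensorProduct.map_add_left]
      rfl)
    (fun c a T => intTensor_ext fun s => by
      rw [smul_apply, tensorOp_coe, tensorOp_coe,
        ← UniformSpace.Completion.coe_smul]
      congr 1
      simp only [preOp_apply, map_smul, TensorProduct.map_smul_left]
      rfl)
    (fun a S T => intTensor_ext fun s => by
      rw [add_apply, tensorOp_coe, tensorOp_coe, tensorOp_coe,
        ← UniformSpace.Completion.coe_add]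
      congr 1
      have : (((S + T : commutant π).1 : H →L[ℂ] H) : H →ₗ[ℂ] H) = S.1 + T.1 := rfl
      simp only [preOp_apply, this, TensorProduct.map_add_right]
      rfl)
    (fun c a T => intTensor_ext fun s => by
      rw [smul_apply, tensorOp_coe, tensorOp_coe,
        ← UniformSpace.Completion.coe_smul]
      congr 1
      have : (((c • T : commutant π).1 : H →L[ℂ] H) : H →ₗ[ℂ] H) = c • T.1 := rfl
      simp only [preOp_apply, this, TensorProduct.map_smul_right]
      rfl)

variable {X π}

lemma thetaAlg_tmul (a : A) (T : commutant π) : thetaAlg X π (a ⊗ₜ[ℂ] T) = tensorOp X π a T := rfl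

lemma thetaAlg_mul (z z' : A ⊗[ℂ] commutant π) :
    thetaAlg X π (z * z') = thetaAlg X π z * thetaAlg X π z' := by
  induction z with
  | zero => simp
  | add z₁ z₂ h₁ h₂ => rw [add_mul, map_add, h₁, h₂, map_add, add_mul]
  | tmul a S =>
    induction z' with
    | zero => simp
    | add z₁ z₂ h₁ h₂ => rw [mul_add, map_add, h₁, h₂, map_add, mul_add]
    | tmul b T =>
      rw [Algebra.TensorProduct.tmul_mul_tmul, thetaAlg_tmul, thetaAlg_tmul, thetaAlg_tmul,
        tensorOp_mul]

lemma thetaAlg_star (z : A ⊗[ℂ] commutant π) :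
    thetaAlg X π (star z) = star (thetaAlg X π z) := by
  induction z with
  | zero => simp
  | add z₁ z₂ h₁ h₂ => rw [star_add, map_add, h₁, h₂, map_add, star_add]
  | tmul a S => rw [TensorProduct.star_tmul, thetaAlg_tmul, thetaAlg_tmul, tensorOp_star]

end IntTensor

section MaxTensor

/-- A C⋆-seminorm on a complex ⋆-algebra. -/
def IsCStarSeminorm {R : Type*} [Ring R] [StarRing R] [Module ℂ R] (p : Seminorm ℂ R) : Prop :=
  (∀ y z : R, p (y * z) ≤ p y * p z) ∧ ∀ z : R, p (star z * z) = p z ^ 2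

/-- C⋆-seminorms on a unital C⋆-algebra are dominated by the norm. -/
lemma IsCStarSeminorm.le_norm {R : Type*} [CStarAlgebra R] {p : Seminorm ℂ R}
    (hp : IsCStarSeminorm p) (a : R) : p a ≤ ‖a‖ := by
  let _ : PartialOrder R := CStarAlgebra.spectralOrder R
  have _ : StarOrderedRing R := CStarAlgebra.spectralOrderedRing R
  have h1 : p 1 ≤ 1 := by
    have h := hp.2 1
    rw [star_one, one_mul] at h
    nlinarith [sq_nonneg (p 1 - 1), apply_nonneg p (1 : R)]
  have hu : ∀ u : unitary R, p u ≤ 1 := by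
    intro u
    have h := hp.2 u
    rw [Unitary.star_mul_self_of_mem u.2] at h
    nlinarith [apply_nonneg p (u : R)]
  have hs : ∀ h : selfAdjoint R, ‖h‖ ≤ 1 → p (h : R) ≤ 1 := by
    intro h hh
    have e : (h : R) = ((2 : ℂ)⁻¹) • (selfAdjoint.unitarySelfAddISMul h hh : R)
        + ((2 : ℂ)⁻¹) • (star (selfAdjoint.unitarySelfAddISMul h hh) : unitary R) := by
      have := congrArg (fun x : selfAdjoint R => (x : R))
        (selfAdjoint.realPart_unitarySelfAddISMul h hh)
      simp only [realPart_apply_coe] at this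
      nth_rewrite 1 [← this]
      rw [smul_add, Unitary.coe_star]
      simp only [← Complex.coe_smul]
      norm_num
    rw [e]
    refine (map_add_le_add p _ _).trans ?_
    rw [map_smul_eq_mul, map_smul_eq_mul]
    have := hu (selfAdjoint.unitarySelfAddISMul h hh)
    have := hu (star (selfAdjoint.unitarySelfAddISMul h hh))
    rw [show ‖(2 : ℂ)⁻¹‖ = 1 / 2 by norm_num]
    linarith
  have hs' : ∀ h : R, IsSelfAdjoint h → p h ≤ ‖h‖ := by
    intro h hh
    rcases eq_or_ne h 0 with rfl | h0
    · simp
    have hn : 0 < ‖h‖ := norm_pos_iff.mpr h0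
    have := hs ⟨((‖h‖⁻¹ : ℝ) : ℂ) • h, by
      rw [selfAdjoint.mem_iff, star_smul, hh.star_eq]; simp⟩ (by
        change ‖((‖h‖⁻¹ : ℝ) : ℂ) • h‖ ≤ 1
        rw [norm_smul]; simp [hn.ne'])
    rw [map_smul_eq_mul] at this
    simp only [Complex.norm_real, norm_inv, norm_norm] at this
    rwa [inv_mul_le_iff₀ hn, mul_one] at this
  refine le_of_sq_le_sq ?_ (norm_nonneg _)
  rw [← hp.2 a, sq ‖a‖, ← CStarRing.norm_star_mul_self]
  exact hs' _ (IsSelfAdjoint.star_mul_self a)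

variable (A : Type u) (N : Type v) [CStarAlgebra A] [CStarAlgebra N]

variable {A N} in
lemma IsCStarSeminorm.tmul_le {p : Seminorm ℂ (A ⊗[ℂ] N)} (hp : IsCStarSeminorm p)
    (a : A) (x : N) : p (a ⊗ₜ[ℂ] x) ≤ ‖a‖ * ‖x‖ := by
  have h1 : IsCStarSeminorm (p.comp ((TensorProduct.mk ℂ A N).flip 1)) := by
    refine ⟨fun y z => ?_, fun z => ?_⟩
    · simpa using hp.1 (y ⊗ₜ[ℂ] 1) (z ⊗ₜ[ℂ] 1)
    · simpa using hp.2 (z ⊗ₜ[ℂ] 1)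
  have h2 : IsCStarSeminorm (p.comp (TensorProduct.mk ℂ A N 1)) := by
    refine ⟨fun y z => ?_, fun z => ?_⟩
    · simpa using hp.1 (1 ⊗ₜ[ℂ] y) (1 ⊗ₜ[ℂ] z)
    · simpa using hp.2 (1 ⊗ₜ[ℂ] z)
  calc p (a ⊗ₜ[ℂ] x) = p ((a ⊗ₜ[ℂ] 1) * (1 ⊗ₜ[ℂ] x)) := by simp
    _ ≤ p (a ⊗ₜ[ℂ] 1) * p (1 ⊗ₜ[ℂ] x) := hp.1 _ _
    _ ≤ ‖a‖ * ‖x‖ := mul_le_mul (h1.le_norm a) (h2.le_norm x) (apply_nonneg _ _) (norm_nonneg _)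

lemma bddAbove_cstarSeminorm :
    BddAbove {p : Seminorm ℂ (A ⊗[ℂ] N) | IsCStarSeminorm p} := by
  rw [Seminorm.bddAbove_iff]
  have h : ∀ z : A ⊗[ℂ] N, ∃ c : ℝ, ∀ p : Seminorm ℂ (A ⊗[ℂ] N), IsCStarSeminorm p → p z ≤ c := by
    intro z
    induction z with
    | zero => exact ⟨0, fun p _ => by simp⟩
    | tmul a x => exact ⟨‖a‖ * ‖x‖, fun p hp => hp.tmul_le a x⟩
    | add z₁ z₂ h₁ h₂ =>
      obtain ⟨c₁, h₁⟩ := h₁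
      obtain ⟨c₂, h₂⟩ := h₂
      exact ⟨c₁ + c₂, fun p hp => (map_add_le_add p _ _).trans (add_le_add (h₁ p hp) (h₂ p hp))⟩
  choose c hc using h
  refine ⟨c, ?_⟩
  rintro _ ⟨p, hp, rfl⟩ z
  exact hc z p hp

/-- The maximal C⋆-norm on `A ⊙ N`: the supremum of all C⋆-seminorms. -/
def maxSeminorm : Seminorm ℂ (A ⊗[ℂ] N) := sSup {p | IsCStarSeminorm p}

variable {A N} in
lemma le_maxSeminorm {p : Seminorm ℂ (A ⊗[ℂ] N)} (hp : IsCStarSeminorm p) : p ≤ maxSeminorm A N :=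
  le_csSup (bddAbove_cstarSeminorm A N) hp

/-- The algebraic tensor product `A ⊙ N`, normed by the maximal C⋆-norm. -/
def PreMaxTensor : Type (max u v) := A ⊗[ℂ] N

instance : AddCommGroup (PreMaxTensor A N) := inferInstanceAs (AddCommGroup (A ⊗[ℂ] N))
instance : Module ℂ (PreMaxTensor A N) := inferInstanceAs (Module ℂ (A ⊗[ℂ] N))

instance : Norm (PreMaxTensor A N) := ⟨fun z => maxSeminorm A N z⟩

lemma preMaxTensor_core : SeminormedSpace.Core ℂ (PreMaxTensor A N) where
  norm_nonneg z := apply_nonneg (maxSeminorm A N) z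
  norm_smul c z := map_smul_eq_mul (maxSeminorm A N) c z
  norm_triangle y z := map_add_le_add (maxSeminorm A N) y z

instance : SeminormedAddCommGroup (PreMaxTensor A N) :=
  SeminormedAddCommGroup.ofCore (preMaxTensor_core A N)

instance : NormedSpace ℂ (PreMaxTensor A N) where
  norm_smul_le c z := (map_smul_eq_mul (maxSeminorm A N) c z).le

/-- The maximal tensor product `A ⊗_max N`, as a Banach space. -/
abbrev MaxTensor : Type (max u v) := UniformSpace.Completion (PreMaxTensor A N)

end MaxTensor

section WeakContainment

variable {A : Type u} {B : Type v} [CStarAlgebra A] [NonUnitalCStarAlgebra B]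
  [PartialOrder B] [StarOrderedRing B]
  {H : Type x} [NormedAddCommGroup H] [InnerProductSpace ℂ H] [CompleteSpace H]
  (X : Corr.{u, v, w} A B) (π : B →⋆ₙₐ[ℂ] (H →L[ℂ] H))

/-- The C⋆-seminorm `z ↦ ‖θ(z)‖`. -/
def thetaSeminorm : Seminorm ℂ (A ⊗[ℂ] commutant π) :=
  (normSeminorm ℂ (IntTensor X π →L[ℂ] IntTensor X π)).comp (thetaAlg X π)

lemma isCStarSeminorm_theta : IsCStarSeminorm (thetaSeminorm X π) := by
  refine ⟨fun y z => ?_, fun z => ?_⟩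
  · change ‖thetaAlg X π (y * z)‖ ≤ ‖thetaAlg X π y‖ * ‖thetaAlg X π z‖
    rw [thetaAlg_mul]
    exact norm_mul_le _ _
  · change ‖thetaAlg X π (star z * z)‖ = ‖thetaAlg X π z‖ ^ 2
    rw [thetaAlg_mul, thetaAlg_star, sq]
    exact CStarRing.norm_star_mul_self (x := thetaAlg X π z)

/-- `θ_X^H` on `A ⊙ π(B)'`, continuous for the maximal norm. -/
def preTheta : PreMaxTensor A (commutant π) →L[ℂ] (IntTensor X π →L[ℂ] IntTensor X π) :=
  LinearMap.mkContinuous (E := PreMaxTensor A (commutant π)) (thetaAlg X π) 1 fun z => by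
    rw [one_mul]
    exact le_maxSeminorm (isCStarSeminorm_theta X π) z

/-- The representation `θ_X^H` of `A ⊗_max π(B)'` on `X ⊗_B H`, the continuous extension of
`a ⊗ T ↦ π_X(a) ⊗ T`. -/
def theta : MaxTensor A (commutant π) →L[ℂ] (IntTensor X π →L[ℂ] IntTensor X π) :=
  (preTheta X π).extend UniformSpace.Completion.toComplL

lemma theta_coe (z : PreMaxTensor A (commutant π)) :
    theta X π (z : MaxTensor A (commutant π)) = thetaAlg X π z :=
  ContinuousLinearMap.extend_eq _ (UniformSpace.Completion.denseRange_coe)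
    (UniformSpace.Completion.isUniformInducing_coe _) z

/-- `X ≺_{(H, π)} Y`: the representation `θ_X^H` is weakly contained in `θ_Y^H`, that is,
`ker θ_Y^H ⊆ ker θ_X^H` in `A ⊗_max π(B)'`. -/
def WeaklyContained (π : B →⋆ₙₐ[ℂ] (H →L[ℂ] H)) (X : Corr.{u, v, w} A B)
    (Y : Corr.{u, v, y} A B) : Prop :=
  ∀ z : MaxTensor A (commutant π), theta Y π z = 0 → theta X π z = 0

end WeakContainment

section BaseChange

variable {A : Type u} {B : Type v} [CStarAlgebra A] [NonUnitalCStarAlgebra B]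
  [PartialOrder B] [StarOrderedRing B]
  {C : Type x} [NonUnitalCStarAlgebra C] [PartialOrder C] [StarOrderedRing C]

/-- The inner product `⟨c, c'⟩ = c* c'` on `C`. -/
def mulForm (C : Type x) [NonUnitalCStarAlgebra C] : C →ₗ⋆[ℂ] C →ₗ[ℂ] C :=
  LinearMap.mk₂'ₛₗ (starRingEnd ℂ) (RingHom.id ℂ) (fun c c' => star c * c')
    (fun a b c => by simp [add_mul]) (fun r a b => by simp [smul_mul_assoc])
    (fun a b c => by simp [mul_add]) (fun r a b => by simp [mul_smul_comm])

lemma mulForm_apply (c c' : C) : mulForm C c c' = star c * c' := rfl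

/-- The action of `B` on `C` by left multiplication through `φ`. -/
def mulEnd (φ : B →⋆ₙₐ[ℂ] C) : B →ₙₐ[ℂ] Module.End ℂ C where
  toFun b := LinearMap.mulLeft ℂ (φ b)
  map_smul' c b := by ext; simp [smul_mul_assoc]
  map_zero' := by ext; simp
  map_add' b c := by ext; simp [add_mul]
  map_mul' b c := by ext; simp

lemma mulEnd_apply (φ : B →⋆ₙₐ[ℂ] C) (b : B) (c : C) : mulEnd φ b c = φ b * c := rfl

lemma mulEnd_adj (φ : B →⋆ₙₐ[ℂ] C) (b : B) (y z : C) :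
    mulForm C y (mulEnd φ b z) = mulForm C (mulEnd φ (star b) y) z := by
  simp [mulForm_apply, mulEnd_apply, mul_assoc, map_star]

/-- The algebraic tensor product `X ⊙ C`, carrying the semi-inner product of `X ⊗_φ C`. -/
def PreBase (X : Corr.{u, v, w} A B) (_φ : B →⋆ₙₐ[ℂ] C) : Type (max w x) := X.carrier ⊗[ℂ] C

variable (X : Corr.{u, v, w} A B) (φ : B →⋆ₙₐ[ℂ] C)

instance : AddCommGroup (PreBase X φ) := inferInstanceAs (AddCommGroup (X.carrier ⊗[ℂ] C))
instance : Module ℂ (PreBase X φ) := inferInstanceAs (Module ℂ (X.carrier ⊗[ℂ] C))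

/-- The `C`-valued semi-inner product `⟨ξ ⊗ c, ξ' ⊗ c'⟩ = c* φ(⟨ξ, ξ'⟩) c'`. -/
def baseForm : PreBase X φ →ₗ⋆[ℂ] PreBase X φ →ₗ[ℂ] C :=
  intForm (X := X.carrier) (mulForm C) (mulEnd φ)

/-- The right action `(ξ ⊗ c') c = ξ ⊗ (c' c)`. -/
def baseMul (c : C) : PreBase X φ →ₗ[ℂ] PreBase X φ :=
  TensorProduct.map (LinearMap.id (M := X.carrier)) (LinearMap.mulRight ℂ c)

/-- The left action `π_X(a) ⊗ 1`. -/
def baseAct (a : A) : PreBase X φ →ₗ[ℂ] PreBase X φ :=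
  TensorProduct.map (X.act a) (LinearMap.id (M := C))

variable {X φ}

lemma baseForm_star (s t : PreBase X φ) : star (baseForm X φ s t) = baseForm X φ t s :=
  intForm_star (X := X.carrier) (fun y z => by simp [mulForm_apply]) (mulEnd_adj φ) s t

lemma baseForm_nonneg (s : PreBase X φ) : 0 ≤ baseForm X φ s s :=
  intForm_nonneg (X := X.carrier) (fun y => star_mul_self_nonneg y) (mulEnd_adj φ) s

lemma baseForm_mul_right (c : C) (s t : PreBase X φ) :
    baseForm X φ s (baseMul X φ c t) = baseForm X φ s t * c := by
  have key : ∀ s t : X.carrier ⊗[ℂ] C, intForm (mulForm C) (mulEnd φ) s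
      (TensorProduct.map LinearMap.id (LinearMap.mulRight ℂ c) t)
      = intForm (mulForm C) (mulEnd φ) s t * c := by
    intro s t
    induction s with
    | zero => simp
    | add s₁ s₂ h₁ h₂ => simp [h₁, h₂, add_mul]
    | tmul ξ y =>
      induction t with
      | zero => simp
      | add t₁ t₂ h₁ h₂ => simp [h₁, h₂, add_mul]
      | tmul ξ' y' =>
        simp [intForm_tmul, mulForm_apply, mulEnd_apply, mul_assoc]
  exact key s t

lemma baseForm_mul_left (c : C) (s t : PreBase X φ) :
    baseForm X φ (baseMul X φ c s) t = star c * baseForm X φ s t := by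
  rw [← baseForm_star, baseForm_mul_right, star_mul, baseForm_star]

lemma baseForm_act (a : A) (s t : PreBase X φ) :
    baseForm X φ s (baseAct X φ a t) = baseForm X φ (baseAct X φ (star a) s) t :=
  intForm_adj (X := X.carrier) (X.rinner_act a) (fun _ _ => rfl) (fun _ _ => rfl) s t

lemma baseForm_cauchy_schwarz (s t : PreBase X φ) :
    ‖baseForm X φ s t‖ ^ 2 ≤ ‖baseForm X φ s s‖ * ‖baseForm X φ t t‖ := by
  set a := baseForm X φ s s with ha
  set b := baseForm X φ t t with hb
  set z := baseForm X φ s t with hz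
  have hz' : baseForm X φ t s = star z := (baseForm_star s t).symm
  have key : ∀ r : ℝ, 0 ≤ r → (2 * r - r ^ 2 * ‖a‖) * ‖z‖ ^ 2 ≤ ‖b‖ := by
    intro r hr
    rcases le_or_gt (2 * r - r ^ 2 * ‖a‖) 0 with hneg | hpos
    · exact (mul_nonpos_of_nonpos_of_nonneg hneg (by positivity)).trans (norm_nonneg _)
    have h0 : 0 ≤ baseForm X φ (((r : ℝ) : ℂ) • baseMul X φ z s - t)
        (((r : ℝ) : ℂ) • baseMul X φ z s - t) := baseForm_nonneg _
    have e : baseForm X φ (((r : ℝ) : ℂ) • baseMul X φ z s - t)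
        (((r : ℝ) : ℂ) • baseMul X φ z s - t)
        = (r ^ 2) • (star z * a * z) - (2 * r) • (star z * z) + b := by
      rw [map_sub, LinearMap.map_sub₂, LinearMap.map_sub₂, map_smul, LinearMap.map_smulₛₗ₂,
        LinearMap.map_smulₛₗ₂, map_smul, Complex.conj_ofReal, baseForm_mul_right,
        baseForm_mul_left, baseForm_mul_left, baseForm_mul_right, hz', ← ha, ← hb, ← hz]
      simp only [Complex.coe_smul, two_mul, add_smul, sq, mul_smul]
      abel
    rw [e] at h0
    have h1 : star z * a * z ≤ ‖a‖ • (star z * z) :=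
      CStarAlgebra.star_left_conjugate_le_norm_smul
        (hb := IsSelfAdjoint.of_nonneg (baseForm_nonneg s))
    have h2 : (2 * r - r ^ 2 * ‖a‖) • (star z * z) ≤ b := by
      have h3 : (r ^ 2) • (star z * a * z) ≤ (r ^ 2) • ‖a‖ • (star z * z) :=
        smul_le_smul_of_nonneg_left h1 (by positivity)
      rw [sub_smul, mul_smul (r ^ 2)]
      have h4 : (2 * r) • (star z * z) ≤ (r ^ 2) • (star z * a * z) + b := by
        rw [← sub_nonneg]
        convert h0 using 1
        abel
      rw [sub_le_iff_le_add']
      exact h4.trans (by gcongr)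
    have h5 := CStarAlgebra.norm_le_norm_of_nonneg_of_le
      (smul_nonneg hpos.le (star_mul_self_nonneg z)) h2
    rwa [norm_smul, CStarRing.norm_star_mul_self, Real.norm_of_nonneg hpos.le, ← sq] at h5
  rcases eq_or_lt_of_le (norm_nonneg a) with h | h
  · rw [← h, zero_mul]
    rw [← h] at key
    by_contra hc
    push Not at hc
    have := key (‖b‖ / ‖z‖ ^ 2) (by positivity)
    rw [mul_zero, sub_zero, mul_assoc, div_mul_cancel₀ _ hc.ne'] at this
    have hb0 : ‖b‖ = 0 := by linarith [norm_nonneg b]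
    have := key 1 (by norm_num)
    linarith
  · have := key (‖a‖⁻¹) (by positivity)
    have e : 2 * ‖a‖⁻¹ - ‖a‖⁻¹ ^ 2 * ‖a‖ = ‖a‖⁻¹ := by field_simp; ring
    rwa [e, inv_mul_le_iff₀ h] at this

instance : Norm (PreBase X φ) := ⟨fun s => √‖baseForm X φ s s‖⟩

lemma preBase_norm_sq (s : PreBase X φ) : ‖s‖ ^ 2 = ‖baseForm X φ s s‖ :=
  Real.sq_sqrt (norm_nonneg _)

lemma norm_baseForm_le (s t : PreBase X φ) : ‖baseForm X φ s t‖ ≤ ‖s‖ * ‖t‖ := by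
  refine le_of_sq_le_sq ?_ (mul_nonneg (Real.sqrt_nonneg _) (Real.sqrt_nonneg _))
  rw [mul_pow, preBase_norm_sq, preBase_norm_sq]
  exact baseForm_cauchy_schwarz s t

variable (X φ) in
lemma preBase_core : SeminormedSpace.Core ℂ (PreBase X φ) where
  norm_nonneg z := Real.sqrt_nonneg _
  norm_smul c z := by
    change √‖baseForm X φ (c • z) (c • z)‖ = ‖c‖ * √‖baseForm X φ z z‖
    rw [map_smul, LinearMap.map_smulₛₗ₂, norm_smul, norm_smul, ← mul_assoc]
    simp [← sq]
  norm_triangle s t := by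
    refine le_of_sq_le_sq ?_ (add_nonneg (Real.sqrt_nonneg _) (Real.sqrt_nonneg _))
    rw [preBase_norm_sq]
    simp only [map_add, LinearMap.add_apply]
    have h1 := norm_baseForm_le s t
    have h2 := norm_baseForm_le t s
    have h3 := norm_baseForm_le s s
    have h4 := norm_baseForm_le t t
    have := norm_add₃_le (a := baseForm X φ s s + baseForm X φ t s) (b := baseForm X φ s t)
      (c := baseForm X φ t t)
    have := norm_add_le (baseForm X φ s s) (baseForm X φ t s)
    rw [← add_assoc]
    nlinarith

instance : SeminormedAddCommGroup (PreBase X φ) :=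
  SeminormedAddCommGroup.ofCore (preBase_core X φ)

instance : NormedSpace ℂ (PreBase X φ) where
  norm_smul_le c z := ((preBase_core X φ).norm_smul c z).le

lemma norm_baseMul_le (c : C) (s : PreBase X φ) : ‖baseMul X φ c s‖ ≤ ‖c‖ * ‖s‖ := by
  refine le_of_sq_le_sq ?_ (by positivity)
  rw [mul_pow, preBase_norm_sq, preBase_norm_sq, baseForm_mul_right, baseForm_mul_left]
  calc ‖star c * baseForm X φ s s * c‖ ≤ ‖star c‖ * ‖baseForm X φ s s‖ * ‖c‖ :=
        (norm_mul_le _ _).trans (by gcongr; exact norm_mul_le _ _)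
    _ = ‖c‖ ^ 2 * ‖baseForm X φ s s‖ := by rw [norm_star]; ring

lemma norm_baseAct_le (a : A) (s : PreBase X φ) : ‖baseAct X φ a s‖ ≤ ‖a‖ * ‖s‖ := by
  refine le_of_sq_le_sq ?_ (by positivity)
  rw [mul_pow, preBase_norm_sq, preBase_norm_sq]
  have := CStarAlgebra.norm_le_norm_of_nonneg_of_le (baseForm_nonneg _)
    (intForm_act_le (X := X.carrier) X.rinner_act (fun y => star_mul_self_nonneg y)
      (mulEnd_adj φ) a s)
  rw [norm_smul] at this
  rw [show ‖((‖a‖ ^ 2 : ℝ) : ℂ)‖ = ‖a‖ ^ 2 by simp] at this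
  exact this

instance : SMul Cᵐᵒᵖ (PreBase X φ) := ⟨fun c s => baseMul X φ c.unop s⟩

lemma preBase_smul_def (c : Cᵐᵒᵖ) (s : PreBase X φ) : c • s = baseMul X φ c.unop s := rfl

instance : UniformContinuousConstSMul Cᵐᵒᵖ (PreBase X φ) where
  uniformContinuous_const_smul c :=
    (LinearMap.mkContinuous (baseMul X φ c.unop) ‖c.unop‖
      (norm_baseMul_le c.unop)).uniformContinuous

instance : Inner Cᵐᵒᵖ (PreBase X φ) := ⟨fun s t => MulOpposite.op (baseForm X φ s t)⟩

lemma preBase_inner (s t : PreBase X φ) :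
    inner Cᵐᵒᵖ s t = MulOpposite.op (baseForm X φ s t) := rfl

/-- The opposite of the semi-inner product as a continuous sesquilinear map. -/
def baseFormL : PreBase X φ →L⋆[ℂ] PreBase X φ →L[ℂ] Cᵐᵒᵖ :=
  LinearMap.mkContinuous₂ (LinearMap.mk₂'ₛₗ (starRingEnd ℂ) (RingHom.id ℂ)
    (fun s t : PreBase X φ => MulOpposite.op (baseForm X φ s t))
    (fun a b c => by simp) (fun r a b => by simp)
    (fun a b c => by simp) (fun r a b => by simp)) 1
    (fun s t => by rw [one_mul]; exact norm_baseForm_le s t)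

lemma continuous_preBase_inner :
    Continuous (Function.uncurry (inner Cᵐᵒᵖ (E := PreBase X φ))) := by
  have : Continuous fun p : PreBase X φ × PreBase X φ => baseFormL (X := X) (φ := φ) p.1 p.2 := by
    fun_prop
  exact this

variable (X φ) in
/-- The Hilbert `C`-module `X ⊗_φ C`: separation and completion of `X ⊙ C`. -/
abbrev BaseChange : Type (max w x) := UniformSpace.Completion (PreBase X φ)

open UniformSpace

lemma baseChange_inner_coe (s t : PreBase X φ) :
    inner Cᵐᵒᵖ (s : BaseChange X φ) (t : BaseChange X φ) = MulOpposite.op (baseForm X φ s t) :=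
  (Completion.isDenseInducing_coe.prodMap Completion.isDenseInducing_coe).extend_eq
    continuous_preBase_inner (s, t)

lemma continuous_baseChange_inner :
    Continuous (Function.uncurry (inner Cᵐᵒᵖ (E := BaseChange X φ))) := by
  let inner' : PreBase X φ →+ PreBase X φ →+ Cᵐᵒᵖ :=
    { toFun := fun s => (baseFormL (X := X) (φ := φ) s).toLinearMap.toAddMonoidHom
      map_zero' := by ext; simp
      map_add' := fun s t => by ext; simp }
  have : Continuous fun p : PreBase X φ × PreBase X φ => inner' p.1 p.2 := continuous_preBase_inner
  rw [Completion.toInner, inner, Function.uncurry_curry _]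
  change Continuous (((Completion.isDenseInducing_toCompl (PreBase X φ)).prodMap
    (Completion.isDenseInducing_toCompl (PreBase X φ))).extend
      fun p : PreBase X φ × PreBase X φ => inner' p.1 p.2)
  exact (Completion.isDenseInducing_toCompl _).extend_Z_bilin
    (Completion.isDenseInducing_toCompl _) this

lemma continuous_baseChange_inner' {α : Type*} [TopologicalSpace α] {f g : α → BaseChange X φ}
    (hf : Continuous f) (hg : Continuous g) : Continuous fun z => inner Cᵐᵒᵖ (f z) (g z) :=
  continuous_baseChange_inner.comp (hf.prodMk hg)

lemma baseChange_norm (z : BaseChange X φ) : ‖z‖ = √‖inner Cᵐᵒᵖ z z‖ := by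
  induction z using Completion.induction_on with
  | hp =>
    exact isClosed_eq continuous_norm
      (continuous_baseChange_inner' continuous_id continuous_id).norm.sqrt
  | ih s => rw [Completion.norm_coe, baseChange_inner_coe]; rfl

lemma baseChange_inner_add (r s t : BaseChange X φ) :
    inner Cᵐᵒᵖ r (s + t) = inner Cᵐᵒᵖ r s + inner Cᵐᵒᵖ r t := by
  induction r, s, t using Completion.induction_on₃ with
  | hp =>
    refine isClosed_eq (continuous_baseChange_inner' continuous_fst
      ((continuous_fst.comp continuous_snd).add (continuous_snd.comp continuous_snd))) ?_
    exact (continuous_baseChange_inner' continuous_fst (continuous_fst.comp continuous_snd)).add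
      (continuous_baseChange_inner' continuous_fst (continuous_snd.comp continuous_snd))
  | ih r s t =>
    rw [← Completion.coe_add, baseChange_inner_coe, baseChange_inner_coe, baseChange_inner_coe,
      map_add, MulOpposite.op_add]

lemma baseChange_inner_nonneg (s : BaseChange X φ) : 0 ≤ inner Cᵐᵒᵖ s s := by
  induction s using Completion.induction_on with
  | hp =>
    have h : IsClosed {c : C | 0 ≤ c} := CStarAlgebra.isClosed_nonneg
    exact h.preimage (MulOpposite.continuous_unop.comp
      (continuous_baseChange_inner' continuous_id continuous_id))
  | ih s =>
    rw [baseChange_inner_coe]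
    exact MulOpposite.op_nonneg.2 (baseForm_nonneg s)

lemma baseChange_inner_mul (c : Cᵐᵒᵖ) (s t : BaseChange X φ) :
    inner Cᵐᵒᵖ s (c • t) = c * inner Cᵐᵒᵖ s t := by
  induction s, t using Completion.induction_on₂ with
  | hp =>
    refine isClosed_eq (continuous_baseChange_inner' continuous_fst
      ((uniformContinuous_const_smul c).continuous.comp continuous_snd)) ?_
    exact continuous_const.mul (continuous_baseChange_inner' continuous_fst continuous_snd)
  | ih s t =>
    rw [← Completion.coe_smul, baseChange_inner_coe, baseChange_inner_coe, preBase_smul_def,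
      baseForm_mul_right]
    rfl

lemma baseChange_inner_smul (c : ℂ) (s t : BaseChange X φ) :
    inner Cᵐᵒᵖ s (c • t) = c • inner Cᵐᵒᵖ s t := by
  induction s, t using Completion.induction_on₂ with
  | hp =>
    refine isClosed_eq (continuous_baseChange_inner' continuous_fst
      ((uniformContinuous_const_smul c).continuous.comp continuous_snd)) ?_
    exact (continuous_const_smul c).comp
      (continuous_baseChange_inner' continuous_fst continuous_snd)
  | ih s t =>
    rw [← Completion.coe_smul, baseChange_inner_coe, baseChange_inner_coe, map_smul,
      MulOpposite.op_smul]

lemma baseChange_inner_star (s t : BaseChange X φ) :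
    star (inner Cᵐᵒᵖ s t) = inner Cᵐᵒᵖ t s := by
  induction s, t using Completion.induction_on₂ with
  | hp =>
    refine isClosed_eq ?_ (continuous_baseChange_inner' continuous_snd continuous_fst)
    exact continuous_star.comp (continuous_baseChange_inner' continuous_fst continuous_snd)
  | ih s t =>
    rw [baseChange_inner_coe, baseChange_inner_coe, ← baseForm_star s t]
    rfl

instance : CStarModule Cᵐᵒᵖ (BaseChange X φ) where
  inner_add_right {r s t} := baseChange_inner_add r s t
  inner_self_nonneg {s} := baseChange_inner_nonneg s
  inner_self {s} := by
    rw [← norm_eq_zero (a := s), baseChange_norm, Real.sqrt_eq_zero (norm_nonneg _), norm_eq_zero]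
  inner_op_smul_right {c s t} := baseChange_inner_mul c s t
  inner_smul_right_complex {c s t} := baseChange_inner_smul c s t
  star_inner s t := baseChange_inner_star s t
  norm_eq_sqrt_norm_inner_self s := baseChange_norm s

variable (X φ) in
/-- `π_X(a) ⊗ 1` as a continuous operator on `X ⊙ C`. -/
def preBaseActL (a : A) : PreBase X φ →L[ℂ] PreBase X φ :=
  LinearMap.mkContinuous (baseAct X φ a) ‖a‖ (norm_baseAct_le a)

variable (X φ) in
/-- `π_X(a) ⊗ 1` on `X ⊗_φ C`. -/
def baseActL (a : A) : BaseChange X φ →L[ℂ] BaseChange X φ := (preBaseActL X φ a).completion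

lemma baseActL_coe (a : A) (s : PreBase X φ) :
    baseActL X φ a (s : BaseChange X φ) = (baseAct X φ a s : BaseChange X φ) := by
  simp [baseActL, preBaseActL]

lemma baseChange_ext {f g : BaseChange X φ →L[ℂ] BaseChange X φ}
    (h : ∀ s : PreBase X φ, f s = g s) : f = g := by
  ext z
  induction z using UniformSpace.Completion.induction_on with
  | hp => exact isClosed_eq f.continuous g.continuous
  | ih s => exact h s

lemma baseActL_add (a b : A) : baseActL X φ (a + b) = baseActL X φ a + baseActL X φ b := by
  refine baseChange_ext fun s => ?_
  rw [add_apply, baseActL_coe, baseActL_coe, baseActL_coe, ← Completion.coe_add]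
  congr 1
  simp only [baseAct, map_add, TensorProduct.map_add_left]
  rfl

lemma baseActL_smul (c : ℂ) (a : A) : baseActL X φ (c • a) = c • baseActL X φ a := by
  refine baseChange_ext fun s => ?_
  rw [smul_apply, baseActL_coe, baseActL_coe, ← Completion.coe_smul]
  congr 1
  simp only [baseAct, map_smul, TensorProduct.map_smul_left]
  rfl

lemma baseActL_mul (a b : A) : baseActL X φ (a * b) = baseActL X φ a * baseActL X φ b := by
  refine baseChange_ext fun s => ?_
  rw [mul_apply_eq_comp, baseActL_coe, baseActL_coe, baseActL_coe]
  congr 1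
  have h := map_map_apply (X.act a) LinearMap.id (X.act b) (LinearMap.id (M := C)) s
  refine Eq.trans ?_ h.symm
  rw [baseAct, map_mul]
  rfl

lemma baseActL_inner (a : A) (s t : BaseChange X φ) :
    inner Cᵐᵒᵖ s (baseActL X φ a t) = inner Cᵐᵒᵖ (baseActL X φ (star a) s) t := by
  induction s, t using Completion.induction_on₂ with
  | hp =>
    exact isClosed_eq
      (continuous_baseChange_inner' continuous_fst
        ((baseActL X φ a).continuous.comp continuous_snd))
      (continuous_baseChange_inner' ((baseActL X φ (star a)).continuous.comp continuous_fst)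
        continuous_snd)
  | ih s t =>
    rw [baseActL_coe, baseActL_coe, baseChange_inner_coe, baseChange_inner_coe, baseForm_act]

variable (X φ) in
/-- The `A`-`C` correspondence `X ⊗_φ C` (also written `X ⊗_B C`), with left action
`π_X ⊗ 1`. -/
def baseChange : Corr.{u, x, max w x} A C where
  carrier := BaseChange X φ
  act :=
    { toFun := fun a => (baseActL X φ a : BaseChange X φ →ₗ[ℂ] BaseChange X φ)
      map_smul' := fun c a => by rw [baseActL_smul]; rfl
      map_zero' := by
        have := baseActL_smul (X := X) (φ := φ) 0 0
        rw [zero_smul, zero_smul] at this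
        rw [this]
        rfl
      map_add' := fun a b => by rw [baseActL_add]; rfl
      map_mul' := fun a b => by rw [baseActL_mul]; rfl }
  rinner_act a ξ η := congrArg MulOpposite.unop (baseActL_inner a ξ η)

end BaseChange

section VonNeumann

variable {H : Type x} [NormedAddCommGroup H] [InnerProductSpace ℂ H] [CompleteSpace H]

variable (H) in
/-- The σ-weak (ultraweak) topology on `B(H)`: the coarsest topology making all functionals
`T ↦ ∑ₙ ⟨ξₙ, T ηₙ⟩` with `∑ ‖ξₙ‖² < ∞` and `∑ ‖ηₙ‖² < ∞` continuous. -/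
@[reducible] def sigmaWeak : TopologicalSpace (H →L[ℂ] H) :=
  ⨅ p : {p : (ℕ → H) × (ℕ → H) //
      Summable (fun n => ‖p.1 n‖ ^ 2) ∧ Summable (fun n => ‖p.2 n‖ ^ 2)},
    TopologicalSpace.induced
      (fun T : H →L[ℂ] H => ∑' n, inner ℂ (p.1.1 n) (T (p.1.2 n))) inferInstance

/-- The underlying C⋆-algebra of a von Neumann algebra `M ⊆ B(H)`. -/
def VN (M : VonNeumannAlgebra H) : Type x := M.toStarSubalgebra

instance (M : VonNeumannAlgebra H) : IsClosed (M.toStarSubalgebra : Set (H →L[ℂ] H)) := by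
  have : (M.toStarSubalgebra : Set (H →L[ℂ] H)) =
      Set.centralizer (Set.centralizer (M : Set (H →L[ℂ] H))) :=
    M.centralizer_centralizer.symm
  rw [this]
  exact Set.isClosed_centralizer _

instance (M : VonNeumannAlgebra H) : CStarAlgebra (VN M) :=
  inferInstanceAs (CStarAlgebra M.toStarSubalgebra)

instance (M : VonNeumannAlgebra H) : PartialOrder (VN M) := CStarAlgebra.spectralOrder (VN M)

instance (M : VonNeumannAlgebra H) : StarOrderedRing (VN M) :=
  CStarAlgebra.spectralOrderedRing (VN M)

/-- The inclusion `M ⊆ B(H)`. -/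
def VN.incl (M : VonNeumannAlgebra H) : VN M →⋆ₐ[ℂ] (H →L[ℂ] H) := M.toStarSubalgebra.subtype

/-- The σ-weak topology of `M`. -/
@[reducible] def VN.sigmaWeak (M : VonNeumannAlgebra H) : TopologicalSpace (VN M) :=
  TopologicalSpace.induced (VN.incl M) (CStarCorr.sigmaWeak H)

/-- Faithful normal (nondegenerate) representations of `M`. -/
structure IsFaithfulNormal {M : VonNeumannAlgebra H} {K : Type y} [NormedAddCommGroup K]
    [InnerProductSpace ℂ K] [CompleteSpace K] (σ : VN M →⋆ₙₐ[ℂ] (K →L[ℂ] K)) : Prop where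
  nondegenerate : Nondegenerate σ
  injective : Function.Injective σ
  normal : @Continuous _ _ (VN.sigmaWeak M) (CStarCorr.sigmaWeak K) σ

variable {A : Type u} [CStarAlgebra A] {M : VonNeumannAlgebra H}

/-- `X ≺ Y` for correspondences over a von Neumann algebra: weak containment with respect to any
faithful normal representation of `M`. -/
def VNWeaklyContained (X : Corr.{u, x, w} A (VN M)) (Y : Corr.{u, x, y} A (VN M)) : Prop :=
  ∀ (K : Type x) [NormedAddCommGroup K] [InnerProductSpace ℂ K] [CompleteSpace K]
    (σ : VN M →⋆ₙₐ[ℂ] (K →L[ℂ] K)), IsFaithfulNormal σ → WeaklyContained σ X Y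

/-- `X ≺ Y` for correspondences over a von Neumann algebra: weak containment with respect to some
faithful normal representation of `M`. -/
def VNWeaklyContainedSome (X : Corr.{u, x, w} A (VN M)) (Y : Corr.{u, x, y} A (VN M)) : Prop :=
  ∃ (K : Type x) (_ : NormedAddCommGroup K) (_ : InnerProductSpace ℂ K) (_ : CompleteSpace K)
    (σ : VN M →⋆ₙₐ[ℂ] (K →L[ℂ] K)), IsFaithfulNormal σ ∧ WeaklyContained σ X Y

variable {B : Type v} [NonUnitalCStarAlgebra B]

/-- The von Neumann algebra `M = π(B)''`. -/
def bicommutant (π : B →⋆ₙₐ[ℂ] (H →L[ℂ] H)) : VonNeumannAlgebra H where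
  toStarSubalgebra := StarSubalgebra.centralizer ℂ (commutant π : Set (H →L[ℂ] H))
  centralizer_centralizer' := by simp

lemma mem_bicommutant (π : B →⋆ₙₐ[ℂ] (H →L[ℂ] H)) (b : B) :
    π b ∈ (bicommutant π).toStarSubalgebra := by
  refine (StarSubalgebra.mem_centralizer_iff ℂ).mpr fun T hT => ⟨?_, ?_⟩
  · exact (mem_commutant.mp hT b).symm
  · exact (mem_commutant.mp (star_mem hT) b).symm

/-- `π` as a ⋆-homomorphism into `M = π(B)''`. -/
def toBicommutant (π : B →⋆ₙₐ[ℂ] (H →L[ℂ] H)) : B →⋆ₙₐ[ℂ] VN (bicommutant π) where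
  toFun b := ⟨π b, mem_bicommutant π b⟩
  map_smul' c b := Subtype.ext (map_smul π c b)
  map_zero' := Subtype.ext (map_zero π)
  map_add' b c := Subtype.ext (map_add π b c)
  map_mul' b c := Subtype.ext (map_mul π b c)
  map_star' b := Subtype.ext (map_star π b)

end VonNeumann

section Universal

variable (B : Type v) [NonUnitalCStarAlgebra B] [PartialOrder B] [StarOrderedRing B]

/-- The states of `B`: positive functionals of norm one. -/
def State : Type v :=
  {f : B →ₚ[ℂ] ℂ // IsLUB ((fun b : B => ‖f b‖) '' Metric.closedBall 0 1) 1}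

/-- The Hilbert space of the universal representation: the `ℓ²`-direct sum of the GNS spaces of
all states. -/
abbrev UnivSpace : Type v := lp (fun f : State B => f.1.GNS) 2

variable {B}

lemma norm_gns_le (f : B →ₚ[ℂ] ℂ) (b : B) : ‖f.gnsNonUnitalStarAlgHom b‖ ≤ ‖b‖ :=
  NonUnitalStarAlgHom.norm_apply_le _ _

variable (B) in
/-- The universal representation of `B`: the direct sum of the GNS representations of all
states. -/
def universalRep : B →⋆ₙₐ[ℂ] (UnivSpace B →L[ℂ] UnivSpace B) where
  toFun b := lp.mapCLM 2 (fun f : State B => f.1.gnsNonUnitalStarAlgHom b) (norm_nonneg b)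
    (fun f => norm_gns_le f.1 b)
  map_smul' c b := by
    ext z f
    exact congr($(map_smul f.1.gnsNonUnitalStarAlgHom c b) (z f))
  map_zero' := by
    ext z f
    exact congr($(map_zero f.1.gnsNonUnitalStarAlgHom) (z f))
  map_add' b c := by
    ext z f
    exact congr($(map_add f.1.gnsNonUnitalStarAlgHom b c) (z f))
  map_mul' b c := by
    ext z f
    exact congr($(map_mul f.1.gnsNonUnitalStarAlgHom b c) (z f))
  map_star' b := by
    rw [ContinuousLinearMap.star_eq_adjoint, ContinuousLinearMap.eq_adjoint_iff]
    intro s t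
    rw [lp.inner_eq_tsum, lp.inner_eq_tsum]
    refine tsum_congr fun f => ?_
    simp only [lp.mapCLM_apply_coe, map_star, ContinuousLinearMap.star_eq_adjoint,
      ContinuousLinearMap.adjoint_inner_left]

end Universal

section Coefficients

variable {A : Type u} {B : Type v} [CStarAlgebra A] [NonUnitalCStarAlgebra B]
  [PartialOrder B] [StarOrderedRing B]

/-- The coefficient `Ω_ξ(a) = ⟨ξ, π_X(a) ξ⟩`. -/
def coeff (X : Corr.{u, v, w} A B) (ξ : X.carrier) : A → B := fun a => rinner B ξ (X.act a ξ)

/-- `F_Y`, the convex hull of the coefficients `Ω_η`, `η ∈ Y`. -/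
def coeffHull (Y : Corr.{u, v, w} A B) : Set (A → B) := convexHull ℝ (Set.range (coeff Y))

end Coefficients

end CStarCorr

end

/-!
A quadratic form `∑ ⟪gₚ, π (Ω_ξ aₚ) kₚ⟫` in `ξ` is the form of a fixed matrix over
`A ⊗_max π(B)'` at the tuple of the vectors `ξ ⊗ gₚ`, `ξ ⊗ kₚ`. If it is nonnegative for all
`η ∈ Y`, then cutting that matrix down by the projection onto the cyclic subspace of `(g, k)`,
whose entries lie in `π(B)'`, makes it positive under `θ_Y`, hence under `θ_X` when
`ker θ_Y ⊆ ker θ_X`. By separation of convex cones, `π ∘ Ω_ξ` is then a point-strong limit of maps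
`π ∘ ψ` with `ψ ∈ F_Y`. Conversely, `|⟪v, θ_X(z) v⟫| ≤ ‖θ_Y(z)‖ ⟪h, π (Ω_ξ 1) h⟫` for
`v = ξ ⊗ h` passes to such limits.

To dominate `ψ 1`, conjugate `ψ` by `2 (1 + ψ 1)⁻¹ s`: the result is at most `s* s` at `1` because
`4 c (1 + c)⁻² ≤ 1`, and in the limit `ξ` is moved to `ξ · 2 (1 + Ω_ξ 1)⁻¹ s`, which for a suitable
rescaling of `ξ` and `s = (Ω_ξ 1)^{1/2}` is close to `ξ`. Dominated nets are bounded, and on bounded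
sets a faithful normal representation of `π(B)''` is a homeomorphism for the weak operator
topologies; together with the double commutant theorem this makes the relation independent of the
representation.

Every functional on `B` is a combination of vector functionals of the universal representation, so
there the dominated nets converge weakly, and Mazur's theorem makes the convergence point-norm.
-/

noncomputable section

namespace CStarCorr

open Filter Topology
open scoped TensorProduct ComplexOrder InnerProductSpace

section CompletionStar

open UniformSpace

variable {E : Type*} [SeminormedRing E] [StarRing E] [NormedStarGroup E]

instance : Star (Completion E) := ⟨Completion.map star⟩

lemma completion_coe_star (z : E) : ((star z : E) : Completion E) = star (z : Completion E) :=
  (Completion.map_coe star_isometry.uniformContinuous z).symm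

instance : ContinuousStar (Completion E) := ⟨Completion.continuous_map⟩

instance : StarRing (Completion E) where
  star_involutive z := by
    induction z using Completion.induction_on with
    | hp => exact isClosed_eq (by fun_prop) continuous_id
    | ih z => rw [← completion_coe_star, ← completion_coe_star, star_star]
  star_mul y z := by
    induction y, z using Completion.induction_on₂ with
    | hp => exact isClosed_eq (by fun_prop) (by fun_prop)
    | ih y z => simp only [← Completion.coe_mul, ← completion_coe_star, star_mul]
  star_add y z := by
    induction y, z using Completion.induction_on₂ with
    | hp => exact isClosed_eq (by fun_prop) (by fun_prop)
    | ih y z => simp only [← Completion.coe_add, ← completion_coe_star, star_add]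

lemma cstarRing_completion (h : ∀ z : E, ‖z‖ * ‖z‖ ≤ ‖star z * z‖) :
    CStarRing (Completion E) where
  norm_mul_self_le z := by
    induction z using Completion.induction_on with
    | hp => exact isClosed_le (by fun_prop) (by fun_prop)
    | ih z =>
      simpa only [← completion_coe_star, ← Completion.coe_mul, Completion.norm_coe] using h z

instance [NormedAlgebra ℂ E] : NormedAlgebra ℂ (Completion E) where
  norm_smul_le := norm_smul_le

instance [NormedAlgebra ℂ E] [StarModule ℂ E] : StarModule ℂ (Completion E) where
  star_smul c z := by
    induction z using Completion.induction_on with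
    | hp =>
      exact isClosed_eq (continuous_star.comp (continuous_const_smul c))
        ((continuous_const_smul (star c)).comp continuous_star)
    | ih z => simp only [← Completion.coe_smul, ← completion_coe_star, star_smul]

end CompletionStar

section CStarSeminorm

variable {R : Type*} [Ring R] [StarRing R] [Module ℂ R]

lemma IsCStarSeminorm.map_star {p : Seminorm ℂ R} (hp : IsCStarSeminorm p) (z : R) :
    p (star z) = p z := by
  have le_map_star : ∀ z, p z ≤ p (star z) := fun z => by
    rcases (apply_nonneg p z).eq_or_lt with h | h
    · exact h ▸ apply_nonneg p _
    · exact le_of_mul_le_mul_right (by simpa only [hp.2, sq] using hp.1 (star z) z) h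
  exact le_antisymm (by simpa only [star_star] using le_map_star (star z)) (le_map_star z)

lemma isCStarSeminorm_sSup {S : Set (Seminorm ℂ R)} (hS : BddAbove S)
    (h : ∀ p ∈ S, IsCStarSeminorm p) : IsCStarSeminorm (sSup S) := by
  have le_sSup {p} (hp : p ∈ S) (z : R) : p z ≤ sSup S z := le_csSup hS hp z
  have sSup_le {z : R} {c : ℝ} (hc : 0 ≤ c) (hz : ∀ p ∈ S, p z ≤ c) : sSup S z ≤ c := by
    rw [Seminorm.sSup_apply hS]
    exact Real.iSup_le (fun p => hz p p.2) hc
  refine ⟨fun y z => sSup_le (by positivity) fun p hp => ((h p hp).1 y z).trans ?_,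
    fun z => le_antisymm (sSup_le (by positivity) fun p hp => ?_) ?_⟩
  · gcongr <;> exact le_sSup hp _
  · rw [(h p hp).2]
    gcongr
    exact le_sSup hp z
  · rw [← Real.le_sqrt (apply_nonneg _ _) (apply_nonneg _ _)]
    refine sSup_le (Real.sqrt_nonneg _) fun p hp => Real.le_sqrt_of_sq_le ?_
    rw [← (h p hp).2]
    exact le_sSup hp _

end CStarSeminorm

section MaxTensorCStar

variable {A : Type u} {N : Type v} [CStarAlgebra A] [CStarAlgebra N]

lemma isCStarSeminorm_maxSeminorm : IsCStarSeminorm (maxSeminorm A N) :=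
  isCStarSeminorm_sSup (bddAbove_cstarSeminorm A N) fun _ => id

instance : Ring (PreMaxTensor A N) := inferInstanceAs (Ring (A ⊗[ℂ] N))

instance : StarRing (PreMaxTensor A N) := inferInstanceAs (StarRing (A ⊗[ℂ] N))

instance : StarModule ℂ (PreMaxTensor A N) := inferInstanceAs (StarModule ℂ (A ⊗[ℂ] N))

instance : SeminormedRing (PreMaxTensor A N) where
  __ := (inferInstance : SeminormedAddCommGroup (PreMaxTensor A N))
  __ := (inferInstance : Ring (PreMaxTensor A N))
  norm_mul_le := isCStarSeminorm_maxSeminorm.1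

instance : NormedStarGroup (PreMaxTensor A N) where
  norm_star_le z := (isCStarSeminorm_maxSeminorm.map_star z).le

instance : NormedAlgebra ℂ (PreMaxTensor A N) where
  __ : Algebra ℂ (PreMaxTensor A N) := inferInstanceAs (Algebra ℂ (A ⊗[ℂ] N))
  norm_smul_le := norm_smul_le

instance : CStarRing (MaxTensor A N) :=
  cstarRing_completion fun z => (sq ‖z‖ ▸ isCStarSeminorm_maxSeminorm.2 z).ge

instance : CStarAlgebra (MaxTensor A N) where

end MaxTensorCStar

section ThetaHom

open UniformSpace

variable {A : Type u} {B : Type v} [CStarAlgebra A] [NonUnitalCStarAlgebra B]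
  [PartialOrder B] [StarOrderedRing B]
  {H : Type x} [NormedAddCommGroup H] [InnerProductSpace ℂ H] [CompleteSpace H]
  {X : Corr.{u, v, w} A B} {π : B →⋆ₙₐ[ℂ] (H →L[ℂ] H)}

lemma theta_mul (y z : MaxTensor A (commutant π)) :
    theta X π (y * z) = theta X π y * theta X π z := by
  induction y, z using Completion.induction_on₂ with
  | hp => exact isClosed_eq (by fun_prop) (by fun_prop)
  | ih y z =>
    rw [← Completion.coe_mul, theta_coe, theta_coe, theta_coe]
    exact thetaAlg_mul y z

lemma theta_star (z : MaxTensor A (commutant π)) :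
    theta X π (star z) = star (theta X π z) := by
  induction z using Completion.induction_on with
  | hp => exact isClosed_eq (by fun_prop) (by fun_prop)
  | ih z =>
    rw [← completion_coe_star, theta_coe, theta_coe]
    exact thetaAlg_star z

variable (X π) in
/-- The representation `θ_X^H` as a `⋆`-homomorphism on the C⋆-algebra `A ⊗_max π(B)'`. -/
def thetaHom : MaxTensor A (commutant π) →⋆ₙₐ[ℂ] (IntTensor X π →L[ℂ] IntTensor X π) where
  toFun := theta X π
  map_smul' := map_smul (theta X π)
  map_zero' := map_zero (theta X π)
  map_add' := map_add (theta X π)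
  map_mul' := theta_mul
  map_star' := theta_star

lemma thetaHom_coe (z : A ⊗[ℂ] commutant π) :
    thetaHom X π (Completion.coe' (α := PreMaxTensor A (commutant π)) z) =
      thetaAlg X π z :=
  theta_coe X π z

end ThetaHom

section KernelContainment

open scoped CStarAlgebra in
lemma map_nonneg_of_ker_le {D E F : Type*} [NonUnitalCStarAlgebra D] [NonUnitalCStarAlgebra E]
    [PartialOrder E] [StarOrderedRing E] [NonUnitalCStarAlgebra F] [PartialOrder F]
    [StarOrderedRing F] {φ : D →⋆ₙₐ[ℂ] E} {ψ : D →⋆ₙₐ[ℂ] F} (hker : ∀ d, ψ d = 0 → φ d = 0)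
    {a : D} (ha : IsSelfAdjoint a) (hψ : 0 ≤ ψ a) : 0 ≤ φ a := by
  have map_negPart_φ : φ a⁻ = (φ a)⁻ := φ.map_cfcₙ (·⁻ : ℝ → ℝ) a (hφ := map_continuous φ)
    (hφa := ha.map φ)
  have map_negPart_ψ : ψ a⁻ = (ψ a)⁻ := ψ.map_cfcₙ (·⁻ : ℝ → ℝ) a (hφ := map_continuous ψ)
    (hφa := ha.map ψ)
  rw [← CFC.negPart_eq_zero_iff _ (ha.map φ), ← map_negPart_φ]
  apply hker
  rw [map_negPart_ψ, CFC.negPart_eq_zero_iff _ (ha.map ψ)]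
  exact hψ

end KernelContainment

section MatrixRepresentation

variable {ι : Type*} [Fintype ι] {K : Type*} [NormedAddCommGroup K] [InnerProductSpace ℂ K]
  [CompleteSpace K]

section Algebra

variable {D : Type*} [NonUnitalSemiring D] [Module ℂ D] [StarRing D]

/-- The representation on `Kⁿ` of the matrices over an algebra represented on `K`. -/
def matRep (ρ : D →⋆ₙₐ[ℂ] (K →L[ℂ] K)) :
    CStarMatrix ι ι D →⋆ₙₐ[ℂ]
      (PiLp 2 (fun _ : ι => K) →L[ℂ] PiLp 2 (fun _ : ι => K)) where
  toFun W := (PiLp.continuousLinearEquiv 2 ℂ fun _ : ι => K).symm.toContinuousLinearMap ∘L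
    ContinuousLinearMap.pi fun i => ∑ j, ρ (W i j) ∘L PiLp.proj 2 (fun _ : ι => K) j
  map_smul' c W := by ext v i; simp [Finset.smul_sum]
  map_zero' := by ext v i; simp
  map_add' V W := by ext v i; simp [Finset.sum_add_distrib]
  map_mul' V W := by
    ext v i
    simp only [CStarMatrix.mul_apply, map_sum, map_mul, ContinuousLinearMap.comp_apply,
      ContinuousLinearMap.coe_pi', sum_apply, PiLp.proj_apply, mul_apply_eq_comp,
      ContinuousLinearEquiv.coe_coe, PiLp.continuousLinearEquiv_symm_apply]
    exact Finset.sum_comm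
  map_star' W := by
    rw [ContinuousLinearMap.star_eq_adjoint, ContinuousLinearMap.eq_adjoint_iff]
    intro v w
    simp only [PiLp.inner_apply, ContinuousLinearMap.comp_apply, ContinuousLinearMap.coe_pi',
      sum_apply, PiLp.proj_apply, ContinuousLinearEquiv.coe_coe,
      PiLp.continuousLinearEquiv_symm_apply, sum_inner, inner_sum, CStarMatrix.star_apply,
      map_star, ContinuousLinearMap.star_eq_adjoint, ContinuousLinearMap.adjoint_inner_left]
    exact Finset.sum_comm

variable {ρ : D →⋆ₙₐ[ℂ] (K →L[ℂ] K)}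

lemma matRep_apply (W : CStarMatrix ι ι D) (v : PiLp 2 fun _ : ι => K) (i : ι) :
    matRep ρ W v i = ∑ j, ρ (W i j) (v j) := by
  simp [matRep]

lemma matRep_single [DecidableEq ι] (W : CStarMatrix ι ι D) (j : ι) (k : K) (i : ι) :
    matRep ρ W (PiLp.single 2 j k) i = ρ (W i j) k := by
  rw [matRep_apply, Finset.sum_eq_single j (fun l _ hl => by simp [hl]) (by simp)]
  simp

lemma matRep_eq_zero_iff {W : CStarMatrix ι ι D} : matRep ρ W = 0 ↔ ∀ i j, ρ (W i j) = 0 := by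
  classical
  refine ⟨fun h i j => ?_, fun h => by ext v i; simp [matRep_apply, h]⟩
  ext k
  rw [← matRep_single, h]
  rfl

end Algebra

lemma matRep_nonneg_of_ker_le {D L : Type*} [NonUnitalCStarAlgebra D] [NormedAddCommGroup L]
    [InnerProductSpace ℂ L] [CompleteSpace L] {ρ : D →⋆ₙₐ[ℂ] (K →L[ℂ] K)}
    {σ : D →⋆ₙₐ[ℂ] (L →L[ℂ] L)} (hker : ∀ d, σ d = 0 → ρ d = 0) {Z : CStarMatrix ι ι D}
    (hZ : IsSelfAdjoint Z) (hσ : 0 ≤ matRep σ Z) : 0 ≤ matRep ρ Z := by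
  let _ : PartialOrder D := CStarAlgebra.spectralOrder D
  have _ : StarOrderedRing D := CStarAlgebra.spectralOrderedRing D
  refine map_nonneg_of_ker_le (fun W hW => ?_) hZ hσ
  rw [matRep_eq_zero_iff] at hW ⊢
  exact fun i j => hker _ (hW i j)

end MatrixRepresentation

section CyclicSubspace

variable {B : Type*} [NonUnitalSemiring B] [Module ℂ B] [StarRing B]
  {K : Type*} [NormedAddCommGroup K] [InnerProductSpace ℂ K] [CompleteSpace K]

/-- The cyclic subspace `closure (σ(B) k)` generated by a vector `k` under a representation
`σ`. -/
def cyclicSubspace (σ : B →⋆ₙₐ[ℂ] (K →L[ℂ] K)) (k : K) : Submodule ℂ K :=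
  (LinearMap.range ((ContinuousLinearMap.apply ℂ K k).toLinearMap ∘ₗ
    (σ : B →ₗ[ℂ] K →L[ℂ] K))).topologicalClosure

variable (σ : B →⋆ₙₐ[ℂ] (K →L[ℂ] K)) (k : K)

instance : CompleteSpace (cyclicSubspace σ k) :=
  (Submodule.isClosed_topologicalClosure _).completeSpace_coe

lemma apply_mem_cyclicSubspace (b : B) : σ b k ∈ cyclicSubspace σ k :=
  Submodule.le_topologicalClosure _ ⟨b, rfl⟩

lemma map_mem_cyclicSubspace (b : B) {z : K} (hz : z ∈ cyclicSubspace σ k) :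
    σ b z ∈ cyclicSubspace σ k := by
  refine map_mem_closure (σ b).continuous hz ?_
  rintro _ ⟨c, rfl⟩
  exact ⟨b * c, by simp⟩

lemma commute_starProjection_cyclicSubspace (b : B) :
    Commute (cyclicSubspace σ k).starProjection (σ b) := by
  rw [ContinuousLinearMap.IsIdempotentElem.commute_iff
    (cyclicSubspace σ k).isIdempotentElem_starProjection, Submodule.range_starProjection,
    Submodule.ker_starProjection]
  refine ⟨fun z hz => map_mem_cyclicSubspace σ k b hz,
    ContinuousLinearMap.orthogonal_mem_invtSubmodule fun z hz => ?_⟩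
  rw [← ContinuousLinearMap.star_eq_adjoint, ← map_star]
  exact map_mem_cyclicSubspace σ k (star b) hz

variable {σ k}

lemma self_mem_cyclicSubspace (hσ : ∀ g, (∀ b, σ b g = 0) → g = 0) :
    k ∈ cyclicSubspace σ k := by
  rw [← Submodule.starProjection_eq_self_iff, eq_comm, ← sub_eq_zero]
  refine hσ _ fun b => ?_
  have commutes := congr($((commute_starProjection_cyclicSubspace σ k b).eq) k)
  have fixes := Submodule.starProjection_eq_self_iff.mpr (apply_mem_cyclicSubspace σ k b)
  simp only [mul_apply_eq_comp] at commutes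
  rw [map_sub, ← commutes, fixes, sub_self]

end CyclicSubspace

section MatrixCommutant

variable {B : Type v} [NonUnitalCStarAlgebra B]
  {H : Type x} [NormedAddCommGroup H] [InnerProductSpace ℂ H] [CompleteSpace H]
  {ι : Type*} [Fintype ι]

lemma Nondegenerate.eq_zero_of_forall {π : B →⋆ₙₐ[ℂ] (H →L[ℂ] H)} (hπ : Nondegenerate π)
    {g : H} (hg : ∀ b, π b g = 0) : g = 0 := by
  refine hπ.eq_zero_of_inner_left ℂ fun {z} hz => ?_
  suffices h : Submodule.span ℂ {h : H | ∃ b k, π b k = h} ≤ (ℂ ∙ g)ᗮ from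
    Submodule.mem_orthogonal_singleton_iff_inner_right.mp (h hz)
  rw [Submodule.span_le]
  rintro _ ⟨b, k, rfl⟩
  rw [SetLike.mem_coe, Submodule.mem_orthogonal_singleton_iff_inner_right,
    ← ContinuousLinearMap.adjoint_inner_left, ← ContinuousLinearMap.star_eq_adjoint, ← map_star,
    hg, inner_zero_left]

variable (ι) in
/-- The diagonal amplification `π ⊕ ⋯ ⊕ π` of a representation to `Hⁿ`. -/
def diagRep (π : B →⋆ₙₐ[ℂ] (H →L[ℂ] H)) :
    B →⋆ₙₐ[ℂ] (PiLp 2 (fun _ : ι => H) →L[ℂ] PiLp 2 (fun _ : ι => H)) where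
  toFun b := (PiLp.continuousLinearEquiv 2 ℂ fun _ : ι => H).symm.toContinuousLinearMap ∘L
    ContinuousLinearMap.pi fun i => π b ∘L PiLp.proj 2 (fun _ : ι => H) i
  map_smul' c b := by ext v i; simp
  map_zero' := by ext v i; simp
  map_add' b c := by ext v i; simp
  map_mul' b c := by ext v i; simp
  map_star' b := by
    rw [ContinuousLinearMap.star_eq_adjoint, ContinuousLinearMap.eq_adjoint_iff]
    intro v w
    refine Finset.sum_congr rfl fun i _ => ?_
    rw [map_star, ContinuousLinearMap.star_eq_adjoint]
    exact ContinuousLinearMap.adjoint_inner_left _ _ _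

@[simp]
lemma diagRep_apply (π : B →⋆ₙₐ[ℂ] (H →L[ℂ] H)) (b : B) (v : PiLp 2 fun _ : ι => H) (i : ι) :
    diagRep ι π b v i = π b (v i) := rfl

lemma diagRep_single [DecidableEq ι] (π : B →⋆ₙₐ[ℂ] (H →L[ℂ] H)) (b : B) (j : ι) (k : H) :
    diagRep ι π b (PiLp.single 2 j k) = PiLp.single 2 j (π b k) := by
  ext i
  rcases eq_or_ne i j with rfl | hij
  · simp
  · simp [hij]

/-- The identity representation of the commutant `π(B)'`. -/
def commutantRep (π : B →⋆ₙₐ[ℂ] (H →L[ℂ] H)) : commutant π →⋆ₙₐ[ℂ] (H →L[ℂ] H) :=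
  (commutant π).subtype

@[simp]
lemma commutantRep_apply {π : B →⋆ₙₐ[ℂ] (H →L[ℂ] H)} (T : commutant π) :
    commutantRep π T = T := rfl

lemma exists_matRep_commutantRep_eq {π : B →⋆ₙₐ[ℂ] (H →L[ℂ] H)}
    {T : PiLp 2 (fun _ : ι => H) →L[ℂ] PiLp 2 (fun _ : ι => H)}
    (hT : ∀ b, Commute T (diagRep ι π b)) :
    ∃ E : CStarMatrix ι ι (commutant π), matRep (commutantRep π) E = T := by
  classical
  let entry (i j : ι) : H →L[ℂ] H := PiLp.proj 2 (fun _ : ι => H) i ∘L T ∘L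
    (PiLp.continuousLinearEquiv 2 ℂ fun _ : ι => H).symm.toContinuousLinearMap ∘L
    ContinuousLinearMap.single ℂ (fun _ : ι => H) j
  have entry_apply (i j k) : entry i j k = T (PiLp.single 2 j k) i := rfl
  have entry_mem (i j) : entry i j ∈ commutant π := by
    refine mem_commutant.mpr fun b => ?_
    ext k
    rw [mul_apply_eq_comp, mul_apply_eq_comp, entry_apply, entry_apply, ← diagRep_single,
      ← diagRep_apply, ← mul_apply_eq_comp, ← (hT b).eq, mul_apply_eq_comp]
  refine ⟨CStarMatrix.ofMatrix fun i j => ⟨entry i j, entry_mem i j⟩, ?_⟩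
  ext v i
  have decomp : v = ∑ j, PiLp.single 2 j (v j) := by
    ext i
    simp [Finset.sum_apply, Pi.single_apply]
  conv_rhs => rw [decomp, map_sum]
  simp only [matRep_apply, WithLp.ofLp_sum, Finset.sum_apply]
  rfl

variable {π : B →⋆ₙₐ[ℂ] (H →L[ℂ] H)}

lemma Nondegenerate.mem_cyclicSubspace_diagRep (hπ : Nondegenerate π) (h : PiLp 2 fun _ : ι => H) :
    h ∈ cyclicSubspace (diagRep ι π) h := by
  refine self_mem_cyclicSubspace fun g hg => ?_
  ext i
  exact hπ.eq_zero_of_forall fun b => congr($(hg b) i)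

variable (π) in
lemma exists_matRep_commutantRep_eq_starProjection (h : PiLp 2 fun _ : ι => H) :
    ∃ E : CStarMatrix ι ι (commutant π),
      matRep (commutantRep π) E = (cyclicSubspace (diagRep ι π) h).starProjection :=
  exists_matRep_commutantRep_eq fun b => commute_starProjection_cyclicSubspace _ h b

lemma Nondegenerate.mem_cyclicSubspace_of_mem_bicommutant (hπ : Nondegenerate π)
    (m : VN (bicommutant π)) (h : PiLp 2 fun _ : ι => H) :
    WithLp.toLp 2 (fun i => VN.incl (bicommutant π) m (h i)) ∈ cyclicSubspace (diagRep ι π) h := by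
  obtain ⟨E, hE⟩ := exists_matRep_commutantRep_eq_starProjection π h
  have hm (T : commutant π) (k : H) :
      VN.incl (bicommutant π) m (T.1 k) = T.1 (VN.incl (bicommutant π) m k) :=
    congr($(((StarSubalgebra.mem_centralizer_iff ℂ).mp m.2 T.1 T.2).1) k).symm
  have fixes (i) : ∑ j, (E i j).1 (h j) = h i := by
    have := Submodule.starProjection_eq_self_iff.mpr (hπ.mem_cyclicSubspace_diagRep h)
    rw [← hE] at this
    simpa [matRep_apply] using congr($this i)
  rw [← Submodule.starProjection_eq_self_iff, ← hE]
  ext i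
  simp only [matRep_apply, commutantRep_apply, ← hm, ← map_sum, fixes]

end MatrixCommutant

section HilbertModule

variable {B : Type*} [NonUnitalCStarAlgebra B] [PartialOrder B]
  {X : Type*} [NormedAddCommGroup X] [NormedSpace ℂ X] [SMul Bᵐᵒᵖ X] [CStarModule Bᵐᵒᵖ X]

lemma norm_rinner_self (ξ : X) : ‖rinner B ξ ξ‖ = ‖ξ‖ ^ 2 :=
  (CStarModule.norm_sq_eq Bᵐᵒᵖ).symm

lemma rinner_sub_right (ξ η ζ : X) : rinner B ξ (η - ζ) = rinner B ξ η - rinner B ξ ζ := by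
  simp [rinner]

lemma ext_rinner_left {η ζ : X} (h : ∀ ξ, rinner B ξ η = rinner B ξ ζ) : η = ζ := by
  have : rinner B (η - ζ) (η - ζ) = 0 := by rw [rinner_sub_right, h, sub_self]
  exact sub_eq_zero.mp ((CStarModule.inner_self (A := Bᵐᵒᵖ)).mp (MulOpposite.unop_injective this))

lemma eq_of_rinner_eq {η ζ : X} (hη : rinner B η η = rinner B η ζ)
    (hζ : rinner B ζ η = rinner B ζ ζ) : η = ζ := by
  have : rinner B (η - ζ) (η - ζ) = 0 := by
    simp only [rinner, CStarModule.inner_sub_left, CStarModule.inner_sub_right,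
      MulOpposite.unop_sub] at hη hζ ⊢
    rw [hη, hζ, sub_self]
  exact sub_eq_zero.mp ((CStarModule.inner_self (A := Bᵐᵒᵖ)).mp (MulOpposite.unop_injective this))

end HilbertModule

section Coefficients

variable {A : Type u} {B : Type v} [CStarAlgebra A] [NonUnitalCStarAlgebra B]
  [PartialOrder B] [StarOrderedRing B] {X : Corr.{u, v, w} A B}

lemma act_one_act (a : A) (ξ : X.carrier) : X.act 1 (X.act a ξ) = X.act a ξ := by
  rw [← Module.End.mul_apply, ← map_mul, one_mul]

lemma act_act_one (a : A) (ξ : X.carrier) : X.act a (X.act 1 ξ) = X.act a ξ := by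
  rw [← Module.End.mul_apply, ← map_mul, mul_one]

lemma act_op_smul (a : A) (b : B) (ξ : X.carrier) :
    X.act a (MulOpposite.op b • ξ) = MulOpposite.op b • X.act a ξ :=
  ext_rinner_left fun ζ => by
    rw [X.rinner_act, rinner_op_smul_right, rinner_op_smul_right, X.rinner_act]

lemma coeff_act_one (ξ : X.carrier) : coeff X (X.act 1 ξ) = coeff X ξ := by
  ext a
  rw [coeff, act_act_one, ← star_one, ← X.rinner_act, act_one_act, coeff]

lemma coeff_one (ξ : X.carrier) : coeff X ξ 1 = rinner B (X.act 1 ξ) (X.act 1 ξ) := by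
  rw [← coeff_act_one, coeff, act_one_act]

lemma coeff_zero : coeff X 0 = 0 := by
  ext a
  simp [coeff, rinner]

lemma coeff_smul (c : ℂ) (ξ : X.carrier) : coeff X (c • ξ) = (‖c‖ ^ 2 : ℝ) • coeff X ξ := by
  ext a
  simp only [coeff, map_smul, rinner_smul_left, rinner_smul_right, Pi.smul_apply, smul_smul]
  rw [← Complex.coe_smul, Complex.star_def, mul_comm, Complex.conj_mul', Complex.ofReal_pow]

lemma coeff_op_smul (b : B) (ξ : X.carrier) (a : A) :
    coeff X (MulOpposite.op b • ξ) a = star b * coeff X ξ a * b := by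
  rw [coeff, act_op_smul, rinner_op_smul_right, rinner_op_smul_left, coeff]

variable (X) in
/-- The convex cone generated by the coefficients of `X`. -/
def coeffCone : PointedCone ℝ (A → B) := PointedCone.hull ℝ (Set.range (coeff X))

lemma coeff_mem_coeffCone (ξ : X.carrier) : coeff X ξ ∈ coeffCone X :=
  PointedCone.subset_hull ⟨ξ, rfl⟩

lemma coeffHull_subset_coeffCone : coeffHull X ⊆ coeffCone X :=
  convexHull_min PointedCone.subset_hull (coeffCone X).convex

open scoped Pointwise in
lemma smul_mem_coeffHull {ψ : A → B} (hψ : ψ ∈ coeffHull X) {t : ℝ} (ht : 0 ≤ t) :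
    t • ψ ∈ coeffHull X := by
  have smul_subset : t • Set.range (coeff X) ⊆ Set.range (coeff X) := by
    rintro _ ⟨_, ⟨ξ, rfl⟩, rfl⟩
    refine ⟨((√t : ℝ) : ℂ) • ξ, ?_⟩
    rw [coeff_smul, Complex.norm_real, Real.norm_of_nonneg (Real.sqrt_nonneg t), Real.sq_sqrt ht]
  refine convexHull_mono smul_subset ?_
  rw [convexHull_smul]
  exact Set.smul_mem_smul_set hψ

lemma coe_coeffCone : (coeffCone X : Set (A → B)) = coeffHull X := by
  refine Set.Subset.antisymm (fun ψ hψ => ?_) coeffHull_subset_coeffCone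
  induction hψ using Submodule.span_induction with
  | mem ψ hψ => exact subset_convexHull ℝ _ hψ
  | zero => exact subset_convexHull ℝ _ ⟨0, coeff_zero⟩
  | add ψ χ _ _ hψ hχ =>
    have h2 : (0 : ℝ) ≤ 2 := zero_le_two
    have := convex_convexHull ℝ _ (smul_mem_coeffHull hψ h2) (smul_mem_coeffHull hχ h2)
      (a := 1 / 2) (b := 1 / 2) (by norm_num) (by norm_num) (by norm_num)
    simpa [smul_smul, coeffHull] using this
  | smul t ψ _ hψ => exact smul_mem_coeffHull hψ t.2

lemma mem_coeffCone_iff {ψ : A → B} : ψ ∈ coeffCone X ↔ ψ ∈ coeffHull X := by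
  rw [← coe_coeffCone, SetLike.mem_coe]

lemma conj_mem_coeffCone {ψ : A → B} (hψ : ψ ∈ coeffCone X) (b : B) :
    (fun a => star b * ψ a * b) ∈ coeffCone X := by
  let L : (A → B) →ₗ[ℝ] (A → B) :=
    (LinearMap.mulRight ℝ b ∘ₗ LinearMap.mulLeft ℝ (star b)).compLeft A
  suffices coeffCone X ≤ (coeffCone X).comap L from this hψ
  refine Submodule.span_le.mpr ?_
  rintro _ ⟨ξ, rfl⟩
  change L (coeff X ξ) ∈ coeffCone X
  rw [← show coeff X (MulOpposite.op b • ξ) = L (coeff X ξ) from funext (coeff_op_smul b ξ)]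
  exact coeff_mem_coeffCone _

end Coefficients

section ElementaryTensors

open UniformSpace

variable {A : Type u} {B : Type v} [CStarAlgebra A] [NonUnitalCStarAlgebra B]
  [PartialOrder B] [StarOrderedRing B]
  {H : Type x} [NormedAddCommGroup H] [InnerProductSpace ℂ H] [CompleteSpace H]
  {X : Corr.{u, v, w} A B} {π : B →⋆ₙₐ[ℂ] (H →L[ℂ] H)}

variable (X π) in
/-- The elementary tensor `ξ ⊗ h` in `X ⊗_B H`. -/
def vec : X.carrier →ₗ[ℂ] H →ₗ[ℂ] IntTensor X π :=
  (TensorProduct.mk ℂ X.carrier H).compr₂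
    ((Completion.toComplL : PreIntTensor X π →L[ℂ] IntTensor X π) :
      PreIntTensor X π →ₗ[ℂ] IntTensor X π)

lemma inner_vec (ξ η : X.carrier) (h k : H) :
    ⟪vec X π ξ h, vec X π η k⟫_ℂ = ⟪h, π (rinner B ξ η) k⟫_ℂ :=
  Completion.inner_coe (E := PreIntTensor X π) (ξ ⊗ₜ[ℂ] h) (η ⊗ₜ[ℂ] k)

lemma norm_vec_le (ξ : X.carrier) (h : H) : ‖vec X π ξ h‖ ≤ ‖ξ‖ * ‖h‖ := by
  refine le_of_sq_le_sq ?_ (by positivity)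
  rw [← inner_self_eq_norm_sq (𝕜 := ℂ), inner_vec]
  calc RCLike.re ⟪h, π (rinner B ξ ξ) h⟫_ℂ ≤ ‖h‖ * ‖π (rinner B ξ ξ) h‖ :=
        re_inner_le_norm _ _
    _ ≤ ‖h‖ * (‖rinner B ξ ξ‖ * ‖h‖) := by
        gcongr
        exact (π (rinner B ξ ξ)).le_of_opNorm_le (NonUnitalStarAlgHom.norm_apply_le π _) h
    _ = (‖ξ‖ * ‖h‖) ^ 2 := by rw [norm_rinner_self]; ring

lemma continuous_vec_right (ξ : X.carrier) : Continuous (vec X π ξ) :=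
  (LinearMap.mkContinuous (vec X π ξ) ‖ξ‖ (norm_vec_le ξ)).continuous

lemma continuous_vec_left (h : H) : Continuous fun ξ => vec X π ξ h :=
  (LinearMap.mkContinuous ((vec X π).flip h) ‖h‖ fun ξ =>
    (norm_vec_le ξ h).trans_eq (mul_comm _ _)).continuous

lemma vec_op_smul (ξ : X.carrier) (b : B) (h : H) :
    vec X π (MulOpposite.op b • ξ) h = vec X π ξ (π b h) := by
  rw [← sub_eq_zero, ← inner_self_eq_zero (𝕜 := ℂ)]
  simp only [inner_sub_left, inner_sub_right, inner_vec, rinner_op_smul_left,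
    rinner_op_smul_right, map_mul, map_star, mul_apply_eq_comp,
    ContinuousLinearMap.star_eq_adjoint, ContinuousLinearMap.adjoint_inner_right]
  ring

lemma thetaHom_tmul (a : A) (T : commutant π) :
    thetaHom X π (Completion.coe' (α := PreMaxTensor A (commutant π)) (a ⊗ₜ[ℂ] T)) =
      tensorOp X π a T :=
  thetaHom_coe _

lemma tensorOp_vec (a : A) (T : commutant π) (ξ : X.carrier) (h : H) :
    tensorOp X π a T (vec X π ξ h) = vec X π (X.act a ξ) (T.1 h) :=
  tensorOp_coe (X := X) a T (ξ ⊗ₜ[ℂ] h)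

lemma inner_tensorOp_vec (a : A) (T : commutant π) (ξ : X.carrier) (h k : H) :
    ⟪vec X π ξ h, tensorOp X π a T (vec X π ξ k)⟫_ℂ = ⟪h, π (coeff X ξ a) (T.1 k)⟫_ℂ := by
  rw [tensorOp_vec, inner_vec, coeff]

lemma mem_of_forall_vec_mem {S : Submodule ℂ (IntTensor X π)}
    (hS : IsClosed (S : Set (IntTensor X π))) (h : ∀ ξ k, vec X π ξ k ∈ S)
    (z : IntTensor X π) : z ∈ S := by
  induction z using Completion.induction_on with
  | hp => exact hS
  | ih s =>
    refine TensorProduct.induction_on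
      (motive := fun s => Completion.coe' (α := PreIntTensor X π) s ∈ S) s S.zero_mem h
      fun s t hs ht => ?_
    have := Completion.coe_add (α := PreIntTensor X π) s t
    exact this ▸ S.add_mem hs ht

end ElementaryTensors

section TensorTuples

variable {A : Type u} {B : Type v} [CStarAlgebra A] [NonUnitalCStarAlgebra B]
  [PartialOrder B] [StarOrderedRing B]
  {H : Type x} [NormedAddCommGroup H] [InnerProductSpace ℂ H] [CompleteSpace H]
  {ι : Type*} {X : Corr.{u, v, w} A B} {π : B →⋆ₙₐ[ℂ] (H →L[ℂ] H)}

variable (X π) in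
/-- The tuple `(ξ ⊗ hᵢ)ᵢ` in `(X ⊗_B H)ⁿ`. -/
def vecs (ξ : X.carrier) (h : PiLp 2 fun _ : ι => H) : PiLp 2 fun _ : ι => IntTensor X π :=
  WithLp.toLp 2 fun i => vec X π ξ (h i)

@[simp]
lemma vecs_apply (ξ : X.carrier) (h : PiLp 2 fun _ : ι => H) (i : ι) :
    vecs X π ξ h i = vec X π ξ (h i) := rfl

variable (X π) in
/-- The linear map `ξ ↦ (ξ ⊗ hᵢ)ᵢ` from `X` to `(X ⊗_B H)ⁿ`. -/
def vecsLinear (h : PiLp 2 fun _ : ι => H) :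
    X.carrier →ₗ[ℂ] PiLp 2 fun _ : ι => IntTensor X π where
  toFun ξ := vecs X π ξ h
  map_add' ξ η := by ext i; simp
  map_smul' c ξ := by ext i; simp

lemma vecs_single [DecidableEq ι] (ξ : X.carrier) (j : ι) (k : H) :
    vecs X π ξ (PiLp.single 2 j k) = PiLp.single 2 j (vec X π ξ k) := by
  ext i
  rcases eq_or_ne i j with rfl | hij
  · simp
  · simp [hij]

lemma mem_of_forall_vecs_mem [Finite ι] {S : Submodule ℂ (PiLp 2 fun _ : ι => IntTensor X π)}
    (hS : IsClosed (S : Set (PiLp 2 fun _ : ι => IntTensor X π))) (h : ∀ ξ k, vecs X π ξ k ∈ S)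
    (w : PiLp 2 fun _ : ι => IntTensor X π) : w ∈ S := by
  classical
  have := Fintype.ofFinite ι
  have single_mem (j : ι) (z : IntTensor X π) : PiLp.single 2 j z ∈ S := by
    let L : IntTensor X π →L[ℂ] PiLp 2 fun _ : ι => IntTensor X π :=
      (PiLp.continuousLinearEquiv 2 ℂ _).symm.toContinuousLinearMap ∘L
        ContinuousLinearMap.single ℂ (fun _ : ι => IntTensor X π) j
    refine mem_of_forall_vec_mem (S := S.comap L.toLinearMap) (hS.preimage L.continuous)
      (fun ξ k => ?_) z
    change PiLp.single 2 j (vec X π ξ k) ∈ S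
    exact vecs_single (π := π) ξ j k ▸ h ξ _
  have decomp : w = ∑ j, PiLp.single 2 j (w j) := by
    ext i
    simp [Finset.sum_apply, Pi.single_apply]
  rw [decomp]
  exact sum_mem fun j _ => single_mem j _

lemma continuous_vecs_right (ξ : X.carrier) :
    Continuous fun k : PiLp 2 fun _ : ι => H => vecs X π ξ k :=
  (PiLp.continuous_toLp 2 _).comp <| continuous_pi fun i =>
    (continuous_vec_right ξ).comp (PiLp.continuous_apply 2 _ i)

variable [Fintype ι]

lemma vecs_mem_closure {h k : PiLp 2 fun _ : ι => H} (hk : k ∈ cyclicSubspace (diagRep ι π) h)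
    (ξ : X.carrier) : vecs X π ξ k ∈ closure (Set.range fun η => vecs X π η h) := by
  refine map_mem_closure (continuous_vecs_right ξ) hk ?_
  rintro _ ⟨b, rfl⟩
  refine ⟨MulOpposite.op b • ξ, ?_⟩
  ext i
  exact vec_op_smul ξ b (h i)

/-- The matrix `(a ⊗ Eᵢⱼ)ᵢⱼ` over `A ⊗_max π(B)'`. -/
def tmulMatrix (a : A) (E : CStarMatrix ι ι (commutant π)) :
    CStarMatrix ι ι (MaxTensor A (commutant π)) :=
  E.map fun T => UniformSpace.Completion.coe' (α := PreMaxTensor A (commutant π)) (a ⊗ₜ[ℂ] T)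

lemma matRep_tmulMatrix_vecs (a : A) (E : CStarMatrix ι ι (commutant π)) (ξ : X.carrier)
    (k : PiLp 2 fun _ : ι => H) :
    matRep (thetaHom X π) (tmulMatrix a E) (vecs X π ξ k) =
      vecs X π (X.act a ξ) (matRep (commutantRep π) E k) := by
  ext i
  simp only [matRep_apply, vecs_apply, commutantRep_apply, map_sum]
  refine Finset.sum_congr rfl fun j _ => ?_
  rw [← tensorOp_vec, ← thetaHom_tmul]
  rfl

lemma matRep_tmulMatrix_mem_closure {h : PiLp 2 fun _ : ι => H}
    {E : CStarMatrix ι ι (commutant π)}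
    (hE : ∀ k, matRep (commutantRep π) E k ∈ cyclicSubspace (diagRep ι π) h) (a : A)
    (w : PiLp 2 fun _ : ι => IntTensor X π) :
    matRep (thetaHom X π) (tmulMatrix a E) w ∈ closure (Set.range fun η => vecs X π η h) := by
  let M := (LinearMap.range (vecsLinear X π h)).topologicalClosure
  let W := matRep (thetaHom X π) (tmulMatrix a E)
  refine mem_of_forall_vecs_mem (S := M.comap W.toLinearMap)
    ((Submodule.isClosed_topologicalClosure _).preimage W.continuous) (fun ξ k => ?_) w
  change W (vecs X π ξ k) ∈ closure (Set.range fun η => vecs X π η h)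
  rw [matRep_tmulMatrix_vecs]
  exact vecs_mem_closure (hE k) _

end TensorTuples

section Separation

variable {A : Type u} {B : Type v} [CStarAlgebra A] [NonUnitalCStarAlgebra B]
  [PartialOrder B] [StarOrderedRing B]
  {H : Type x} [NormedAddCommGroup H] [InnerProductSpace ℂ H] [CompleteSpace H]
  {X : Corr.{u, v, w} A B} {Y : Corr.{u, v, y} A B} {π : B →⋆ₙₐ[ℂ] (H →L[ℂ] H)}

lemma mem_closure_of_forall_re_inner_nonneg {E : Type*} [NormedAddCommGroup E]
    [InnerProductSpace ℂ E] [CompleteSpace E] {C : PointedCone ℝ E} {x : E}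
    (hx : ∀ g : E, (∀ z ∈ C, 0 ≤ (⟪g, z⟫_ℂ).re) → 0 ≤ (⟪g, x⟫_ℂ).re) :
    x ∈ closure (C : Set E) := by
  let _ := InnerProductSpace.rclikeToReal ℂ E
  by_contra hxC
  obtain ⟨g, hg, hgx⟩ := ProperCone.hyperplane_separation' (Submodule.closure C) hxC
  rw [real_inner_comm] at hgx
  refine hgx.not_ge (hx g fun z hz => ?_)
  have := hg z (subset_closure hz)
  rwa [real_inner_comm] at this

lemma re_inner_map_conj_add_star {D K : Type*} [NonUnitalSemiring D] [Module ℂ D] [StarRing D]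
    [NormedAddCommGroup K] [InnerProductSpace ℂ K] [CompleteSpace K]
    (ρ : D →⋆ₙₐ[ℂ] (K →L[ℂ] K)) (c d : D) (w : K) :
    (⟪w, ρ (star c * d * c + star (star c * d * c)) w⟫_ℂ).re =
      2 * (⟪ρ c w, ρ d (ρ c w)⟫_ℂ).re := by
  have conj : ⟪w, ρ (star c * d * c) w⟫_ℂ = ⟪ρ c w, ρ d (ρ c w)⟫_ℂ := by
    simp only [map_mul, map_star, mul_apply_eq_comp, ContinuousLinearMap.star_eq_adjoint,
      ContinuousLinearMap.adjoint_inner_right]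
  rw [map_add, map_star, add_apply, inner_add_right, ContinuousLinearMap.star_eq_adjoint,
    ContinuousLinearMap.adjoint_inner_right, ← inner_conj_symm (ρ _ w) w, conj, Complex.add_re,
    Complex.conj_re, two_mul]

lemma WeaklyContained.re_inner_matRep_nonneg (hXY : WeaklyContained π X Y)
    (hπ : Nondegenerate π) {ι : Type*} [Fintype ι] {h : PiLp 2 fun _ : ι => H}
    {Z : CStarMatrix ι ι (MaxTensor A (commutant π))}
    (hZ : ∀ η, 0 ≤ (⟪vecs Y π η h, matRep (thetaHom Y π) Z (vecs Y π η h)⟫_ℂ).re)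
    (ξ : X.carrier) :
    0 ≤ (⟪vecs X π (X.act 1 ξ) h, matRep (thetaHom X π) Z (vecs X π (X.act 1 ξ) h)⟫_ℂ).re := by
  -- `1 ⊗ E`, with `E` the projection onto the cyclic subspace of `h`, fixes `(1ξ ⊗ hᵢ)ᵢ` and maps
  -- `(Y ⊗_B H)ⁿ` into the closure of the tuples `(η ⊗ hᵢ)ᵢ`, where `hZ` applies.
  obtain ⟨E, hE⟩ := exists_matRep_commutantRep_eq_starProjection π h
  let F := tmulMatrix (1 : A) E
  have F_vecs : matRep (thetaHom X π) F (vecs X π ξ h) = vecs X π (X.act 1 ξ) h := by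
    rw [matRep_tmulMatrix_vecs, hE,
      Submodule.starProjection_eq_self_iff.mpr (hπ.mem_cyclicSubspace_diagRep h)]
  have nonneg_Y (w) : 0 ≤
      (⟪matRep (thetaHom Y π) F w, matRep (thetaHom Y π) Z (matRep (thetaHom Y π) F w)⟫_ℂ).re := by
    have hF := matRep_tmulMatrix_mem_closure (X := Y) (a := (1 : A)) (E := E) (h := h)
      (fun k => hE ▸ Submodule.starProjection_apply_mem _ k) w
    refine closure_minimal (t := {v | 0 ≤ (⟪v, matRep (thetaHom Y π) Z v⟫_ℂ).re}) ?_
      (isClosed_le continuous_const (by fun_prop)) hF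
    rintro _ ⟨η, rfl⟩
    exact hZ η
  let S := star F * Z * F + star (star F * Z * F)
  have hS : IsSelfAdjoint S := IsSelfAdjoint.add_star_self _
  have hSY : 0 ≤ matRep (thetaHom Y π) S := by
    rw [ContinuousLinearMap.nonneg_iff_isPositive]
    refine ⟨(hS.map (matRep (thetaHom Y π))).isSymmetric, fun w => ?_⟩
    rw [ContinuousLinearMap.reApplyInnerSelf_apply, inner_re_symm (𝕜 := ℂ), RCLike.re_to_complex,
      re_inner_map_conj_add_star]
    exact mul_nonneg zero_le_two (nonneg_Y w)
  have hSX := matRep_nonneg_of_ker_le (ρ := thetaHom X π) (σ := thetaHom Y π)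
    (fun z hz => hXY z hz) hS hSY
  have nonneg_X := ((ContinuousLinearMap.nonneg_iff_isPositive _).mp hSX).re_inner_nonneg_right
    (vecs X π ξ h)
  rw [RCLike.re_to_complex, re_inner_map_conj_add_star, F_vecs] at nonneg_X
  exact nonneg_of_mul_nonneg_right nonneg_X zero_lt_two

variable (π) in
/-- The block matrix with `diag (aₚ ⊗ 1)` in the upper right corner and zeros elsewhere; it turns
sums of inner products `⟪gₚ, π (coeff X ξ aₚ) kₚ⟫` into one quadratic form. -/
def cornerMatrix {P : Type*} [DecidableEq P] (a : P → A) :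
    CStarMatrix (P ⊕ P) (P ⊕ P) (MaxTensor A (commutant π)) :=
  CStarMatrix.ofMatrix <| Matrix.fromBlocks 0 (Matrix.diagonal fun p =>
    UniformSpace.Completion.coe' (α := PreMaxTensor A (commutant π)) (a p ⊗ₜ[ℂ] 1)) 0 0

lemma inner_matRep_cornerMatrix {P : Type*} [Fintype P] [DecidableEq P] (a : P → A)
    (g k : P → H) (ξ : X.carrier) :
    ⟪vecs X π ξ (WithLp.toLp 2 (Sum.elim g k)), matRep (thetaHom X π) (cornerMatrix π a)
      (vecs X π ξ (WithLp.toLp 2 (Sum.elim g k)))⟫_ℂ =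
      ∑ p, ⟪g p, π (coeff X ξ (a p)) (k p)⟫_ℂ := by
  rw [PiLp.inner_apply, Fintype.sum_sum_type]
  simp only [matRep_apply, Fintype.sum_sum_type, cornerMatrix, CStarMatrix.ofMatrix_apply,
    Matrix.fromBlocks_apply₁₁, Matrix.fromBlocks_apply₁₂, Matrix.fromBlocks_apply₂₁,
    Matrix.fromBlocks_apply₂₂, Matrix.zero_apply, map_zero, zero_apply, Finset.sum_const_zero,
    zero_add, inner_zero_right, add_zero]
  refine Finset.sum_congr rfl fun p _ => ?_
  rw [Finset.sum_eq_single p (fun q _ hq => by simp [Matrix.diagonal_apply_ne' _ hq]) (by simp),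
    Matrix.diagonal_apply_eq, thetaHom_tmul]
  exact inner_tensorOp_vec (a p) 1 ξ (g p) (k p)

lemma WeaklyContained.re_sum_inner_coeff_nonneg (hXY : WeaklyContained π X Y)
    (hπ : Nondegenerate π) {P : Type*} [Fintype P] (a : P → A) (g k : P → H)
    (h : ∀ η, 0 ≤ (∑ p, ⟪g p, π (coeff Y η (a p)) (k p)⟫_ℂ).re) (ξ : X.carrier) :
    0 ≤ (∑ p, ⟪g p, π (coeff X ξ (a p)) (k p)⟫_ℂ).re := by
  classical
  simp only [← inner_matRep_cornerMatrix] at h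
  have := hXY.re_inner_matRep_nonneg hπ h ξ
  rwa [inner_matRep_cornerMatrix, coeff_act_one] at this

theorem WeaklyContained.strong_approx (hXY : WeaklyContained π X Y) (hπ : Nondegenerate π)
    (ξ : X.carrier) (F : Finset A) (G : Finset H) {ε : ℝ} (hε : 0 < ε) :
    ∃ ψ ∈ coeffHull Y, ∀ a ∈ F, ∀ k ∈ G, ‖π (ψ a) k - π (coeff X ξ a) k‖ < ε := by
  let Φ : (A → B) →ₗ[ℝ] PiLp 2 fun _ : F × G => H :=
    { toFun := fun ψ => WithLp.toLp 2 fun p => π (ψ p.1) p.2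
      map_add' := fun ψ χ => by ext p; simp
      map_smul' := fun c ψ => by
        ext p
        change π (c • ψ p.1) p.2 = c • π (ψ p.1) p.2
        rw [← Complex.coe_smul, map_smul, ← Complex.coe_smul]
        rfl }
  have inner_Φ (g) (ψ : A → B) : ⟪g, Φ ψ⟫_ℂ = ∑ p : F × G, ⟪g p, π (ψ p.1) p.2⟫_ℂ :=
    PiLp.inner_apply _ _
  have hξ : Φ (coeff X ξ) ∈ closure ((coeffCone Y).map Φ : Set (PiLp 2 fun _ : F × G => H)) := by
    refine mem_closure_of_forall_re_inner_nonneg fun g hg => ?_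
    rw [inner_Φ]
    refine hXY.re_sum_inner_coeff_nonneg hπ _ _ _ (fun η => ?_) ξ
    rw [← inner_Φ]
    exact hg _ ⟨_, coeff_mem_coeffCone η, rfl⟩
  obtain ⟨_, ⟨ψ, hψ, rfl⟩, hdist⟩ := Metric.mem_closure_iff.mp hξ ε hε
  refine ⟨ψ, mem_coeffCone_iff.mp hψ, fun a ha k hk => ?_⟩
  rw [dist_comm, dist_eq_norm] at hdist
  exact (PiLp.norm_apply_le (Φ ψ - Φ (coeff X ξ)) (⟨a, ha⟩, ⟨k, hk⟩)).trans_lt hdist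

end Separation

section PointWeakTopology

variable {A : Type u} {B : Type v} [NonUnitalCStarAlgebra B]
  {H : Type x} [NormedAddCommGroup H] [InnerProductSpace ℂ H] [CompleteSpace H]
  (π : B →⋆ₙₐ[ℂ] (H →L[ℂ] H))

variable (A) in
/-- The family of all matrix coefficients `⟪s, π (φ a) t⟫` of a map `φ : A → B`. Pointwise
convergence of these families is convergence of the maps `π ∘ φ` in the point-weak operator
topology. -/
def weakCoord : (A → B) →ₗ[ℝ] (A × H × H → ℂ) where
  toFun φ p := ⟪p.2.1, π (φ p.1) p.2.2⟫_ℂ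
  map_add' φ ψ := by
    ext p
    simp only [Pi.add_apply, map_add, add_apply, inner_add_right]
  map_smul' c φ := by
    ext p
    simp only [Pi.smul_apply, ← Complex.coe_smul, map_smul, smul_apply, inner_smul_right,
      smul_eq_mul, RingHom.id_apply]

@[simp]
lemma weakCoord_apply (φ : A → B) (p : A × H × H) :
    weakCoord A π φ p = ⟪p.2.1, π (φ p.1) p.2.2⟫_ℂ := rfl

lemma continuous_weakCoord : Continuous (weakCoord A π) := by
  have : Continuous π := (NonUnitalStarAlgHom.instContinuousLinearMapClassComplex).map_continuous π
  exact continuous_pi fun p => continuous_const.inner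
    ((ContinuousLinearMap.apply ℂ H p.2.2).continuous.comp (this.comp (continuous_apply p.1)))

end PointWeakTopology

section Fell

open UniformSpace

variable {A : Type u} {B : Type v} [CStarAlgebra A] [NonUnitalCStarAlgebra B]
  [PartialOrder B] [StarOrderedRing B]
  {H : Type x} [NormedAddCommGroup H] [InnerProductSpace ℂ H] [CompleteSpace H]
  {X : Corr.{u, v, w} A B} {Y : Corr.{u, v, y} A B} {π : B →⋆ₙₐ[ℂ] (H →L[ℂ] H)}

lemma inner_thetaAlg_vec (Q : Finset (A × commutant π)) (ξ : X.carrier) (h : H) :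
    ⟪vec X π ξ h, thetaAlg X π (∑ q ∈ Q, q.1 ⊗ₜ[ℂ] q.2) (vec X π ξ h)⟫_ℂ =
      ∑ q ∈ Q, ⟪h, π (coeff X ξ q.1) (q.2.1 h)⟫_ℂ := by
  simp only [map_sum, thetaAlg_tmul, sum_apply, inner_sum, inner_tensorOp_vec]

lemma norm_sum_inner_le_of_mem_coeffCone {ψ : A → B} (hψ : ψ ∈ coeffCone Y)
    (Q : Finset (A × commutant π)) (h : H) :
    ‖∑ q ∈ Q, ⟪h, π (ψ q.1) (q.2.1 h)⟫_ℂ‖ ≤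
      ‖thetaAlg Y π (∑ q ∈ Q, q.1 ⊗ₜ[ℂ] q.2)‖ * (⟪h, π (ψ 1) h⟫_ℂ).re := by
  set T := thetaAlg Y π (∑ q ∈ Q, q.1 ⊗ₜ[ℂ] q.2)
  induction hψ using Submodule.span_induction with
  | mem ψ hψ =>
    obtain ⟨η, rfl⟩ := hψ
    let v := vec Y π (Y.act 1 η) h
    have norm_v : ‖v‖ ^ 2 = (⟪h, π (coeff Y η 1) h⟫_ℂ).re := by
      rw [coeff_one, ← inner_vec, ← RCLike.re_to_complex, inner_self_eq_norm_sq]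
    calc ‖∑ q ∈ Q, ⟪h, π (coeff Y η q.1) (q.2.1 h)⟫_ℂ‖ = ‖⟪v, T v⟫_ℂ‖ := by
          rw [inner_thetaAlg_vec, coeff_act_one]
      _ ≤ ‖v‖ * (‖T‖ * ‖v‖) := (norm_inner_le_norm _ _).trans (by gcongr; exact T.le_opNorm v)
      _ = ‖T‖ * (⟪h, π (coeff Y η 1) h⟫_ℂ).re := by rw [← norm_v]; ring
  | zero => simp
  | add ψ χ _ _ hψ hχ =>
    simp only [Pi.add_apply, map_add, add_apply, inner_add_right, Finset.sum_add_distrib,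
      Complex.add_re, mul_add]
    exact (norm_add_le _ _).trans (add_le_add hψ hχ)
  | smul t ψ _ hψ =>
    have (a : A) (k : H) : ⟪h, π ((t • ψ) a) k⟫_ℂ = (t : ℝ) * ⟪h, π (ψ a) k⟫_ℂ :=
      congr_fun ((weakCoord A π).map_smul (t : ℝ) ψ) (a, h, k)
    simp only [this, ← Finset.mul_sum, norm_mul, Complex.re_ofReal_mul, Complex.norm_real,
      Real.norm_of_nonneg t.2]
    rw [mul_left_comm]
    exact mul_le_mul_of_nonneg_left hψ t.2

lemma norm_inner_theta_vec_le {ξ : X.carrier}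
    (hξ : weakCoord A π (coeff X ξ) ∈ closure (weakCoord A π '' coeffCone Y)) (h : H)
    (z : MaxTensor A (commutant π)) :
    ‖⟪vec X π ξ h, theta X π z (vec X π ξ h)⟫_ℂ‖ ≤
      ‖theta Y π z‖ * (⟪h, π (coeff X ξ 1) h⟫_ℂ).re := by
  induction z using Completion.induction_on with
  | hp => exact isClosed_le (by fun_prop) (by fun_prop)
  | ih z =>
    obtain ⟨Q, hQ⟩ := TensorProduct.exists_finset (R := ℂ) z
    rw [theta_coe, theta_coe, hQ, inner_thetaAlg_vec]
    refine closure_minimal (t := {f : A × H × H → ℂ | ‖∑ q ∈ Q, f (q.1, h, q.2.1 h)‖ ≤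
      ‖thetaAlg Y π (∑ q ∈ Q, q.1 ⊗ₜ[ℂ] q.2)‖ * (f (1, h, h)).re}) ?_
      (isClosed_le (by fun_prop) (by fun_prop)) hξ
    rintro _ ⟨ψ, hψ, rfl⟩
    exact norm_sum_inner_le_of_mem_coeffCone hψ Q h

theorem weaklyContained_of_total {S : Set X.carrier}
    (hS : Dense (Submodule.span ℂ S : Set X.carrier))
    (h : ∀ ξ ∈ S, weakCoord A π (coeff X ξ) ∈ closure (weakCoord A π '' coeffCone Y)) :
    WeaklyContained π X Y := by
  intro z hz
  have theta_vec {ξ : X.carrier} (hξ : ξ ∈ S) (k : H) : thetaHom X π z (vec X π ξ k) = 0 := by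
    have := norm_inner_theta_vec_le (h ξ hξ) k (star z * z)
    change ‖⟪_, thetaHom X π (star z * z) _⟫_ℂ‖ ≤ ‖thetaHom Y π (star z * z)‖ * _ at this
    rw [map_mul, map_mul, show thetaHom Y π z = 0 from hz, mul_zero, norm_zero, zero_mul,
      norm_le_zero_iff, map_star, mul_apply_eq_comp, ContinuousLinearMap.star_eq_adjoint,
      ContinuousLinearMap.adjoint_inner_right] at this
    exact inner_self_eq_zero.mp this
  let N := LinearMap.ker (thetaHom X π z).toLinearMap
  have isClosed_N : IsClosed (N : Set (IntTensor X π)) := (thetaHom X π z).isClosed_ker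
  ext w
  refine mem_of_forall_vec_mem (S := N) isClosed_N (fun ξ k => ?_) w
  refine closure_minimal (t := {ξ | vec X π ξ k ∈ N}) ?_
    (isClosed_N.preimage (continuous_vec_left k)) (hS ξ)
  exact Submodule.span_le (p := N.comap ((vec X π).flip k)).mpr fun ξ hξ => theta_vec hξ k

end Fell

section Nets

lemma exists_net_of_mem_closure_image {E : Type u} {T : Type v} [TopologicalSpace T] {f : E → T}
    {S : Set E} {t : T} (ht : t ∈ closure (f '' S)) :
    ∃ (ι : Type (max v w)) (_ : Preorder ι) (_ : IsDirectedOrder ι) (_ : Nonempty ι)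
      (e : ι → E), (∀ i, e i ∈ S) ∧ Tendsto (fun i => f (e i)) atTop (𝓝 t) := by
  have approx (U : {U // U ∈ 𝓝 t}) : ∃ e ∈ S, f e ∈ U.1 := by
    obtain ⟨_, hU, e, he, rfl⟩ := mem_closure_iff_nhds.mp ht U U.2
    exact ⟨e, he, hU⟩
  choose e heS heU using approx
  let ι := ULift.{w} {U // U ∈ 𝓝 t}ᵒᵈ
  have isDirectedOrder_ι : IsDirectedOrder ι :=
    ⟨fun U V => ⟨⟨OrderDual.toDual ⟨_, Filter.inter_mem U.down.ofDual.2 V.down.ofDual.2⟩⟩,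
      Set.inter_subset_left, Set.inter_subset_right⟩⟩
  refine ⟨ι, inferInstance, isDirectedOrder_ι, ⟨⟨OrderDual.toDual ⟨_, Filter.univ_mem⟩⟩⟩,
    fun U => e U.down.ofDual, fun U => heS _, fun V hV => ?_⟩
  exact (eventually_ge_atTop (⟨OrderDual.toDual ⟨V, hV⟩⟩ : ι)).mono fun U hU => hU (heU _)

lemma mem_closure_of_forall_finset {ι E : Type*} [PseudoMetricSpace E] {S : Set (ι → E)}
    {f : ι → E} (h : ∀ (I : Finset ι) (ε : ℝ), 0 < ε → ∃ g ∈ S, ∀ i ∈ I, dist (g i) (f i) < ε) :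
    f ∈ closure S := by
  have basis := Filter.hasBasis_pi_same_index (fun i => Metric.nhds_basis_ball (x := f i))
    fun I ε hI hε => by
      obtain ⟨δ, hδ, hδε⟩ := ((hI.eventually_all.mpr fun i hi => Ioo_mem_nhdsGT (hε i hi)).and
        self_mem_nhdsWithin).exists
      exact ⟨δ, hδε, fun i hi => Metric.ball_subset_ball (hδ i hi).2.le⟩
  rw [← nhds_pi] at basis
  refine (mem_closure_iff_nhds_basis basis).mpr fun ⟨I, ε⟩ ⟨hI, hε⟩ => ?_
  obtain ⟨g, hg, hgf⟩ := h hI.toFinset ε hε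
  exact ⟨g, hg, fun i hi => hgf i (hI.mem_toFinset.mpr hi)⟩

end Nets

section QuasiResolvent

variable {B : Type*} [NonUnitalCStarAlgebra B]

/-- `r` plays the role of `c (1 + c)⁻¹`. The algebra need not have a unit, so multiplication by
`(1 + c)⁻¹` is encoded as `b ↦ b - r * b`. -/
structure IsQuasiResolvent (c r : B) : Prop where
  isSelfAdjoint : IsSelfAdjoint r
  add_mul_eq : r + c * r = c

lemma IsQuasiResolvent.sub_add_mul_sub {c r : B} (h : IsQuasiResolvent c r) (p : B) :
    (p - r * p) + c * (p - r * p) = p := by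
  have := congr_arg (· * p) h.add_mul_eq
  simp only [add_mul] at this
  rw [mul_sub, ← mul_assoc, ← this]
  abel

open scoped ContinuousMapZero

variable [PartialOrder B] [StarOrderedRing B]

-- `4 c (1 + c)⁻² ≤ 1`
lemma IsQuasiResolvent.conj_le {c r : B} (h : IsQuasiResolvent c r) (s : B) :
    star ((2 : ℝ) • s - r * ((2 : ℝ) • s)) * c * ((2 : ℝ) • s - r * ((2 : ℝ) • s)) ≤
      star s * s := by
  have c_mul : c * (s - r * s) = r * s := by
    rw [mul_sub, ← mul_assoc, eq_sub_of_add_eq' h.add_mul_eq, sub_mul, sub_sub_cancel]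
  have key : star s * s -
      star ((2 : ℝ) • s - r * ((2 : ℝ) • s)) * c * ((2 : ℝ) • s - r * ((2 : ℝ) • s)) =
        star (s - (2 : ℝ) • (r * s)) * (s - (2 : ℝ) • (r * s)) := by
    rw [mul_smul_comm, ← smul_sub, mul_assoc, mul_smul_comm, c_mul]
    simp only [star_smul, star_sub, star_mul, h.isSelfAdjoint.star_eq, star_trivial,
      smul_mul_assoc, mul_smul_comm, sub_mul, mul_sub, smul_sub, smul_smul, ← mul_assoc]
    module
  rw [← sub_nonneg, key]
  exact star_mul_self_nonneg _

lemma exists_isQuasiResolvent {c : B} (hc : 0 ≤ c) : ∃ r, IsQuasiResolvent c r := by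
  have hsa : IsSelfAdjoint c := .of_nonneg hc
  let r : C(quasispectrum ℝ c, ℝ)₀ :=
    { toFun := fun t => t / (1 + |(t : ℝ)|)
      continuous_toFun := Continuous.div (by fun_prop) (by fun_prop) fun t => by positivity
      map_zero' := by simp }
  have add_mul_eq : r + .id _ * r = .id _ := by
    ext t
    have ht : 0 ≤ (t : ℝ) := quasispectrum_nonneg_of_nonneg c hc _ t.2
    change t / (1 + |(t : ℝ)|) + t * (t / (1 + |(t : ℝ)|)) = t
    rw [abs_of_nonneg ht]
    field_simp
  refine ⟨cfcₙHom hsa r, cfcₙHom_predicate hsa r, ?_⟩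
  simpa only [map_add, map_mul, cfcₙHom_id] using congr_arg (cfcₙHom hsa) add_mul_eq

lemma abs_sqrt_sub_le {t δ : ℝ} (ht : 0 ≤ t) (hδ : 0 < δ) :
    |√t - √t * (√t / (t + δ) * (2 * √t - t ^ 2 / ((t + δ) ^ 2 + t ^ 2) * (2 * √t)))| ≤ √δ := by
  have hden : 0 < (t + δ) ^ 2 + t ^ 2 := by positivity
  have eq : √t - √t * (√t / (t + δ) * (2 * √t - t ^ 2 / ((t + δ) ^ 2 + t ^ 2) * (2 * √t))) =
      √t * δ ^ 2 / ((t + δ) ^ 2 + t ^ 2) := by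
    field_simp
    rw [show √t ^ 2 = t from Real.sq_sqrt ht]
    ring
  have amgm : √t * √δ ≤ t + δ := by
    nlinarith [sq_nonneg (√t - √δ), Real.sq_sqrt ht, Real.sq_sqrt hδ.le]
  rw [eq, abs_of_nonneg (by positivity), div_le_iff₀ hden]
  calc √t * δ ^ 2 = √t * (√δ * √δ) * δ := by rw [Real.mul_self_sqrt hδ.le]; ring
    _ = √δ * ((√t * √δ) * δ) := by ring
    _ ≤ √δ * ((t + δ) * (t + δ)) := by gcongr; linarith
    _ ≤ √δ * ((t + δ) ^ 2 + t ^ 2) := by gcongr; nlinarith [sq_nonneg t]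

/-- With `q = 2 (1 + u b u)⁻¹ s`, the element `u q` acts almost as a unit on `s = √b`. -/
lemma exists_regularization {b : B} (hb : 0 ≤ b) {δ : ℝ} (hδ : 0 < δ) :
    ∃ s u r : B, IsSelfAdjoint s ∧ IsSelfAdjoint u ∧ s * s = b ∧ IsQuasiResolvent (u * b * u) r ∧
      ‖s - s * (u * ((2 : ℝ) • s - r * ((2 : ℝ) • s)))‖ ≤ √δ := by
  have hsa : IsSelfAdjoint b := .of_nonneg hb
  have coe_nonneg (t : quasispectrum ℝ b) : 0 ≤ (t : ℝ) :=
    quasispectrum_nonneg_of_nonneg b hb _ t.2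
  let s : C(quasispectrum ℝ b, ℝ)₀ :=
    { toFun := fun t => √t
      map_zero' := by simp }
  let u : C(quasispectrum ℝ b, ℝ)₀ :=
    { toFun := fun t => √t / (|(t : ℝ)| + δ)
      continuous_toFun := Continuous.div (by fun_prop) (by fun_prop) fun t => by positivity
      map_zero' := by simp }
  let r : C(quasispectrum ℝ b, ℝ)₀ :=
    { toFun := fun t => t ^ 2 / ((|(t : ℝ)| + δ) ^ 2 + t ^ 2)
      continuous_toFun := Continuous.div (by fun_prop) (by fun_prop) fun t => by positivity
      map_zero' := by simp }
  have mul_self : s * s = .id _ := by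
    ext t
    exact Real.mul_self_sqrt (coe_nonneg t)
  have add_mul_eq : r + (u * .id _ * u) * r = u * .id _ * u := by
    ext t
    change t ^ 2 / ((|(t : ℝ)| + δ) ^ 2 + t ^ 2) + √t / (|(t : ℝ)| + δ) * t *
      (√t / (|(t : ℝ)| + δ)) * (t ^ 2 / ((|(t : ℝ)| + δ) ^ 2 + t ^ 2)) =
        √t / (|(t : ℝ)| + δ) * t * (√t / (|(t : ℝ)| + δ))
    field_simp
    rw [Real.sq_sqrt (coe_nonneg t)]
    ring
  have norm_sub_le : ‖s - s * (u * ((2 : ℝ) • s - r * ((2 : ℝ) • s)))‖ ≤ √δ := by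
    refine (ContinuousMap.norm_le _ (Real.sqrt_nonneg δ)).mpr fun t => ?_
    change |√t - √t * (√t / (|(t : ℝ)| + δ) * (2 * √t -
      t ^ 2 / ((|(t : ℝ)| + δ) ^ 2 + t ^ 2) * (2 * √t)))| ≤ √δ
    rw [abs_of_nonneg (coe_nonneg t)]
    exact abs_sqrt_sub_le (coe_nonneg t) hδ
  refine ⟨cfcₙHom hsa s, cfcₙHom hsa u, cfcₙHom hsa r, cfcₙHom_predicate hsa s,
    cfcₙHom_predicate hsa u, ?_, ⟨cfcₙHom_predicate hsa r, ?_⟩, ?_⟩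
  · rw [← map_mul, mul_self, cfcₙHom_id]
  · simpa only [map_add, map_mul, cfcₙHom_id] using congr_arg (cfcₙHom hsa) add_mul_eq
  · rw [← (isometry_cfcₙHom b hsa).norm_map_of_map_zero (map_zero _)] at norm_sub_le
    simpa only [map_sub, map_mul, map_smul] using norm_sub_le

end QuasiResolvent

section Norm

variable {B : Type*} [NonUnitalCStarAlgebra B] [PartialOrder B] [StarOrderedRing B]
  {X : Type*} [NormedAddCommGroup X] [NormedSpace ℂ X] [SMul Bᵐᵒᵖ X] [CStarModule Bᵐᵒᵖ X]

lemma norm_sub_op_smul_op_smul {ξ : X} {s : B} (hs : star s * s = rinner B ξ ξ) (u q : B) :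
    ‖ξ - MulOpposite.op q • MulOpposite.op u • ξ‖ = ‖s - s * (u * q)‖ := by
  rw [← sq_eq_sq₀ (norm_nonneg _) (norm_nonneg _), ← norm_rinner_self (B := B), sq,
    ← CStarRing.norm_star_mul_self]
  congr 1
  have rinner_sub_left (η ζ κ : X) : rinner B (η - ζ) κ = rinner B η κ - rinner B ζ κ := by
    simp [rinner]
  simp only [rinner_sub_left, rinner_sub_right, rinner_op_smul_left, rinner_op_smul_right, ← hs,
    star_sub, star_mul, sub_mul, mul_sub, mul_assoc]
  abel

end Norm

section Continuity

variable {A : Type u} {B : Type v} [CStarAlgebra A] [NonUnitalCStarAlgebra B]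
  [PartialOrder B] [StarOrderedRing B] {X : Corr.{u, v, w} A B}

lemma continuous_act (a : A) : Continuous (X.act a) := by
  have continuous_rinner (ξ : X.carrier) : Continuous (rinner B ξ) :=
    MulOpposite.continuous_unop.comp (CStarModule.continuous_inner.comp (.prodMk_right ξ))
  refine (X.act a).continuous_of_seq_closed_graph fun η ξ ζ hη hact =>
    ext_rinner_left (B := B) fun κ => ?_
  have := ((continuous_rinner κ).tendsto ζ).comp hact
  refine tendsto_nhds_unique this ?_
  rw [X.rinner_act]
  simpa only [Function.comp_def, X.rinner_act] using
    ((continuous_rinner (X.act (star a) κ)).tendsto ξ).comp hη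

lemma continuous_coeff : Continuous (coeff X) :=
  continuous_pi fun a => MulOpposite.continuous_unop.comp
    (CStarModule.continuous_inner.comp (continuous_id.prodMk (continuous_act a)))

end Continuity

section CauchySchwarz

variable {A : Type u} {B : Type v} [CStarAlgebra A] [NonUnitalCStarAlgebra B]
  [PartialOrder B] [StarOrderedRing B]
  {H : Type x} [NormedAddCommGroup H] [InnerProductSpace ℂ H] [CompleteSpace H]
  {Y : Corr.{u, v, y} A B} {π : B →⋆ₙₐ[ℂ] (H →L[ℂ] H)}

lemma re_inner_map_nonneg {b : B} (hb : 0 ≤ b) (h : H) : 0 ≤ (⟪h, π b h⟫_ℂ).re :=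
  ((ContinuousLinearMap.nonneg_iff_isPositive _).mp (map_nonneg π hb)).re_inner_nonneg_right h

lemma map_one_nonneg_of_mem_coeffCone {ψ : A → B} (hψ : ψ ∈ coeffCone Y) : 0 ≤ ψ 1 := by
  induction hψ using Submodule.span_induction with
  | mem ψ hψ =>
    obtain ⟨η, rfl⟩ := hψ
    rw [coeff_one]
    exact rinner_self_nonneg _
  | zero => exact le_rfl
  | add ψ χ _ _ hψ hχ => exact add_nonneg hψ hχ
  | smul t ψ _ hψ =>
    change 0 ≤ (t : ℝ) • ψ 1
    exact smul_nonneg t.2 hψ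

lemma sqrt_mul_sqrt_add_le {p q r s : ℝ} (hp : 0 ≤ p) (hq : 0 ≤ q) (hr : 0 ≤ r) (hs : 0 ≤ s) :
    √p * √q + √r * √s ≤ √(p + r) * √(q + s) := by
  simpa using Real.sum_sqrt_mul_sqrt_le (f := ![p, r]) (g := ![q, s]) Finset.univ
    (Fin.forall_fin_two.mpr ⟨hp, hr⟩) (Fin.forall_fin_two.mpr ⟨hq, hs⟩)

lemma norm_inner_le_of_mem_coeffCone {ψ : A → B} (hψ : ψ ∈ coeffCone Y) (a : A) (h k : H) :
    ‖⟪h, π (ψ a) k⟫_ℂ‖ ≤ ‖a‖ * (√(⟪h, π (ψ 1) h⟫_ℂ).re * √(⟪k, π (ψ 1) k⟫_ℂ).re) := by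
  induction hψ using Submodule.span_induction with
  | mem ψ hψ =>
    obtain ⟨η, rfl⟩ := hψ
    have norm_tensorOp : ‖tensorOp Y π a 1‖ ≤ ‖a‖ :=
      (norm_tensorOp_le a 1).trans (mul_le_of_le_one_right (norm_nonneg a)
        ContinuousLinearMap.norm_id_le)
    have sqrt_eq (l : H) : √(⟪l, π (coeff Y η 1) l⟫_ℂ).re = ‖vec Y π (Y.act 1 η) l‖ := by
      rw [coeff_one, ← inner_vec, ← RCLike.re_to_complex, inner_self_eq_norm_sq,
        Real.sqrt_sq (norm_nonneg _)]
    have inner_eq : ⟪h, π (coeff Y η a) k⟫_ℂ =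
        ⟪vec Y π (Y.act 1 η) h, tensorOp Y π a 1 (vec Y π (Y.act 1 η) k)⟫_ℂ := by
      rw [inner_tensorOp_vec, coeff_act_one]
      rfl
    rw [inner_eq, sqrt_eq, sqrt_eq, mul_left_comm]
    exact (norm_inner_le_norm _ _).trans (by
      gcongr
      exact ContinuousLinearMap.le_of_opNorm_le _ norm_tensorOp _)
  | zero => simp
  | add ψ χ hψ hχ ihψ ihχ =>
    have nonneg {φ : A → B} (hφ : φ ∈ coeffCone Y) (l : H) : 0 ≤ (⟪l, π (φ 1) l⟫_ℂ).re :=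
      re_inner_map_nonneg (map_one_nonneg_of_mem_coeffCone hφ) l
    simp only [Pi.add_apply, map_add, add_apply, inner_add_right, Complex.add_re]
    refine (norm_add_le_of_le ihψ ihχ).trans ?_
    rw [← mul_add]
    gcongr
    exact sqrt_mul_sqrt_add_le (nonneg hψ h) (nonneg hψ k) (nonneg hχ h) (nonneg hχ k)
  | smul t ψ _ ihψ =>
    have inner_smul (b : B) (l m : H) : ⟪l, π ((t : ℝ) • b) m⟫_ℂ = (t : ℝ) * ⟪l, π b m⟫_ℂ := by
      rw [← Complex.coe_smul, map_smul, smul_apply, inner_smul_right]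
    change ‖⟪h, π ((t : ℝ) • ψ a) k⟫_ℂ‖ ≤ ‖a‖ * (√(⟪h, π ((t : ℝ) • ψ 1) h⟫_ℂ).re *
      √(⟪k, π ((t : ℝ) • ψ 1) k⟫_ℂ).re)
    rw [inner_smul, inner_smul, inner_smul, Complex.re_ofReal_mul, Complex.re_ofReal_mul,
      Real.sqrt_mul t.2, Real.sqrt_mul t.2, norm_mul, Complex.norm_real,
      Real.norm_of_nonneg t.2, mul_mul_mul_comm, Real.mul_self_sqrt t.2, mul_left_comm]
    exact mul_le_mul_of_nonneg_left ihψ t.2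

lemma norm_inner_le_of_map_one_le {ψ : A → B} (hψ : ψ ∈ coeffCone Y) {b : B} (hb : ψ 1 ≤ b)
    (a : A) (h k : H) : ‖⟪h, π (ψ a) k⟫_ℂ‖ ≤ ‖a‖ * ‖b‖ * (‖h‖ * ‖k‖) := by
  have norm_le : ‖π (ψ 1)‖ ≤ ‖b‖ := (NonUnitalStarAlgHom.norm_apply_le π _).trans
    (CStarAlgebra.norm_le_norm_of_nonneg_of_le (map_one_nonneg_of_mem_coeffCone hψ) hb)
  have sqrt_le (l : H) : √(⟪l, π (ψ 1) l⟫_ℂ).re ≤ √‖b‖ * ‖l‖ := by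
    refine (Real.sqrt_le_sqrt ?_).trans_eq ((Real.sqrt_mul (norm_nonneg b) (‖l‖ ^ 2)).trans ?_)
    swap
    · rw [Real.sqrt_sq (norm_nonneg l)]
    refine (Complex.re_le_norm _).trans ((norm_inner_le_norm _ _).trans ?_)
    calc ‖l‖ * ‖π (ψ 1) l‖ ≤ ‖l‖ * (‖b‖ * ‖l‖) := by
          gcongr
          exact ContinuousLinearMap.le_of_opNorm_le _ norm_le l
      _ = ‖b‖ * ‖l‖ ^ 2 := by ring
  calc ‖⟪h, π (ψ a) k⟫_ℂ‖ ≤ ‖a‖ * (√(⟪h, π (ψ 1) h⟫_ℂ).re * √(⟪k, π (ψ 1) k⟫_ℂ).re) :=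
        norm_inner_le_of_mem_coeffCone hψ a h k
    _ ≤ ‖a‖ * ((√‖b‖ * ‖h‖) * (√‖b‖ * ‖k‖)) := by gcongr <;> exact sqrt_le _
    _ = ‖a‖ * (√‖b‖ * √‖b‖) * (‖h‖ * ‖k‖) := by ring
    _ = ‖a‖ * ‖b‖ * (‖h‖ * ‖k‖) := by rw [Real.mul_self_sqrt (norm_nonneg b)]

end CauchySchwarz

section EnergyEstimate

variable {H : Type*} [NormedAddCommGroup H] [InnerProductSpace ℂ H]

lemma sqrt_re_inner_le_of_add_apply_eq {C : H →L[ℂ] H} {v g : H} (h : v + C v = g) :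
    √(⟪v, C v⟫_ℂ).re ≤ ‖g‖ := by
  have re_inner : (⟪v, g⟫_ℂ).re = ‖v‖ ^ 2 + (⟪v, C v⟫_ℂ).re := by
    rw [← h, inner_add_right, Complex.add_re, ← RCLike.re_to_complex, inner_self_eq_norm_sq]
  have : (⟪v, g⟫_ℂ).re ≤ ‖v‖ * ‖g‖ := (Complex.re_le_norm _).trans (norm_inner_le_norm _ _)
  refine (Real.sqrt_le_left (norm_nonneg _)).mpr ?_
  nlinarith [sq_nonneg (‖v‖ - ‖g‖), sq_nonneg ‖v‖, sq_nonneg ‖g‖]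

variable {ι : Type*} {f : Filter ι} {C T : ι → H →L[ℂ] H} {C₀ T₀ : H →L[ℂ] H}
  {v w : ι → H} {v₀ w₀ g l : H}

lemma tendsto_sqrt_re_inner_sub (hC : ∀ k, Tendsto (fun i => C i k) f (𝓝 (C₀ k)))
    (hv : ∀ i, v i + C i (v i) = g) (hv₀ : v₀ + C₀ v₀ = g) :
    Tendsto (fun i => √(⟪v i - v₀, C i (v i - v₀)⟫_ℂ).re) f (𝓝 0) := by
  have residual i : v i - v₀ + C i (v i - v₀) = C₀ v₀ - C i v₀ := by
    rw [map_sub, sub_add_sub_comm, hv i, ← hv₀]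
    abel
  have residual_tendsto := ((hC v₀).const_sub (C₀ v₀)).norm
  rw [sub_self, norm_zero] at residual_tendsto
  exact squeeze_zero (fun i => Real.sqrt_nonneg _)
    (fun i => sqrt_re_inner_le_of_add_apply_eq (residual i)) residual_tendsto

/-- The operators `T i` need not be uniformly bounded, so convergence of `v i` and `w i` in norm
would not suffice: the errors are controlled in the seminorms `v ↦ √⟪v, C i v⟫`. -/
lemma tendsto_inner_of_add_apply_eq {c : ℝ} (hc : 0 ≤ c)
    (hCT : ∀ i h k, ‖⟪h, T i k⟫_ℂ‖ ≤ c * (√(⟪h, C i h⟫_ℂ).re * √(⟪k, C i k⟫_ℂ).re))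
    (hC : ∀ k, Tendsto (fun i => C i k) f (𝓝 (C₀ k)))
    (hT : ∀ k, Tendsto (fun i => T i k) f (𝓝 (T₀ k)))
    (hv : ∀ i, v i + C i (v i) = g) (hv₀ : v₀ + C₀ v₀ = g)
    (hw : ∀ i, w i + C i (w i) = l) (hw₀ : w₀ + C₀ w₀ = l) :
    Tendsto (fun i => ⟪v i, T i (w i)⟫_ℂ) f (𝓝 ⟪v₀, T₀ w₀⟫_ℂ) := by
  have limit_fixed : Tendsto (fun i => ⟪v₀, T i w₀⟫_ℂ) f (𝓝 ⟪v₀, T₀ w₀⟫_ℂ) :=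
    tendsto_const_nhds.inner (hT w₀)
  have energy_v₀ : Tendsto (fun i => √(⟪v₀, C i v₀⟫_ℂ).re) f (𝓝 √(⟪v₀, C₀ v₀⟫_ℂ).re) :=
    (Real.continuous_sqrt.comp Complex.continuous_re).continuousAt.tendsto.comp
      (tendsto_const_nhds.inner (hC v₀))
  have error_bound i : ‖⟪v i, T i (w i)⟫_ℂ - ⟪v₀, T i w₀⟫_ℂ‖ ≤
      c * (√(⟪v i - v₀, C i (v i - v₀)⟫_ℂ).re * ‖l‖) +
        c * (√(⟪v₀, C i v₀⟫_ℂ).re * √(⟪w i - w₀, C i (w i - w₀)⟫_ℂ).re) := by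
    have split : ⟪v i, T i (w i)⟫_ℂ - ⟪v₀, T i w₀⟫_ℂ =
        ⟪v i - v₀, T i (w i)⟫_ℂ + ⟪v₀, T i (w i - w₀)⟫_ℂ := by
      rw [inner_sub_left, map_sub, inner_sub_right, sub_add_sub_cancel]
    rw [split]
    refine norm_add_le_of_le ((hCT i _ _).trans ?_) (hCT i _ _)
    gcongr
    exact sqrt_re_inner_le_of_add_apply_eq (hw i)
  have error_tendsto := (((tendsto_sqrt_re_inner_sub hC hv hv₀).mul_const ‖l‖).const_mul c).add
    ((energy_v₀.mul (tendsto_sqrt_re_inner_sub hC hw hw₀)).const_mul c)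
  simp only [zero_mul, mul_zero, add_zero] at error_tendsto
  simpa only [sub_add_cancel, zero_add] using
    (squeeze_zero_norm error_bound error_tendsto).add limit_fixed

end EnergyEstimate

section CutDown

variable {B : Type v} [NonUnitalCStarAlgebra B]
  {H : Type x} [NormedAddCommGroup H] [InnerProductSpace ℂ H] [CompleteSpace H]
  {π : B →⋆ₙₐ[ℂ] (H →L[ℂ] H)}

lemma inner_map_conj (p c : B) (h k : H) :
    ⟪h, π (star p * c * p) k⟫_ℂ = ⟪π p h, π c (π p k)⟫_ℂ := by
  rw [mul_assoc, map_mul, map_star, mul_apply_eq_comp, ContinuousLinearMap.star_eq_adjoint,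
    ContinuousLinearMap.adjoint_inner_right, map_mul, mul_apply_eq_comp]

lemma IsQuasiResolvent.map_sub_add_map_apply {c r : B} (hr : IsQuasiResolvent c r) (p : B)
    (l : H) : π (p - r * p) l + π c (π (p - r * p) l) = π p l := by
  rw [← mul_apply_eq_comp, ← map_mul, ← add_apply, ← map_add, hr.sub_add_mul_sub]

variable {A : Type u} [CStarAlgebra A] [PartialOrder B] [StarOrderedRing B]
  {X : Corr.{u, v, w} A B} {Y : Corr.{u, v, y} A B}

lemma WeaklyContained.exists_strong_net (hXY : WeaklyContained π X Y) (hπ : Nondegenerate π)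
    (ξ : X.carrier) :
    ∃ (ι : Type (max u v x)) (f : Filter ι) (_ : f.NeBot) (ψ : ι → A → B),
      (∀ i, ψ i ∈ coeffCone Y) ∧
        ∀ a k, Tendsto (fun i => π (ψ i a) k) f (𝓝 (π (coeff X ξ a) k)) := by
  have mem_closure : (fun p : A × H => π (coeff X ξ p.1) p.2) ∈
      closure ((fun (ψ : A → B) (p : A × H) => π (ψ p.1) p.2) '' coeffCone Y) := by
    classical
    refine mem_closure_of_forall_finset fun I ε hε => ?_
    obtain ⟨ψ, hψ, hdist⟩ :=
      hXY.strong_approx hπ ξ (I.image Prod.fst) (I.image Prod.snd) hε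
    refine ⟨_, ⟨ψ, mem_coeffCone_iff.mpr hψ, rfl⟩, fun p hp => ?_⟩
    rw [dist_eq_norm]
    exact hdist _ (Finset.mem_image_of_mem _ hp) _ (Finset.mem_image_of_mem _ hp)
  obtain ⟨ι, _, _, _, ψ, hψ, ht⟩ := exists_net_of_mem_closure_image.{_, _, v} mem_closure
  exact ⟨ι, atTop, inferInstance, ψ, hψ, fun a k => tendsto_pi_nhds.mp ht (a, k)⟩

lemma WeaklyContained.weakCoord_mem_closure_dominated_of_isQuasiResolvent
    (hXY : WeaklyContained π X Y) (hπ : Nondegenerate π) {ξ : X.carrier} {r s : B}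
    (hr : IsQuasiResolvent (coeff X ξ 1) r) :
    weakCoord A π (coeff X (MulOpposite.op ((2 : ℝ) • s - r * ((2 : ℝ) • s)) • ξ)) ∈
      closure (weakCoord A π '' {ψ | ψ ∈ coeffHull Y ∧ ψ 1 ≤ star s * s}) := by
  obtain ⟨ι, f, _, ψ, hψ, ht⟩ := hXY.exists_strong_net hπ ξ
  choose r' hr' using fun i => exists_isQuasiResolvent (map_one_nonneg_of_mem_coeffCone (hψ i))
  let p : B := (2 : ℝ) • s
  refine mem_closure_of_tendsto (b := f)
    (f := fun i => weakCoord A π fun a => star (p - r' i * p) * ψ i a * (p - r' i * p))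
    (tendsto_pi_nhds.mpr fun ⟨a, h, k⟩ => ?_) (.of_forall fun i =>
      ⟨_, ⟨mem_coeffCone_iff.mp (conj_mem_coeffCone (hψ i) _), (hr' i).conj_le s⟩, rfl⟩)
  simp only [weakCoord_apply, coeff_op_smul, inner_map_conj]
  exact tendsto_inner_of_add_apply_eq (norm_nonneg a)
    (fun i => norm_inner_le_of_mem_coeffCone (hψ i) a) (ht 1) (ht a)
    (fun i => (hr' i).map_sub_add_map_apply p h) (hr.map_sub_add_map_apply p h)
    (fun i => (hr' i).map_sub_add_map_apply p k) (hr.map_sub_add_map_apply p k)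

theorem WeaklyContained.weakCoord_mem_closure_dominated (hXY : WeaklyContained π X Y)
    (hπ : Nondegenerate π) (ξ : X.carrier) :
    weakCoord A π (coeff X ξ) ∈
      closure (weakCoord A π '' {ψ | ψ ∈ coeffHull Y ∧ ψ 1 ≤ coeff X ξ 1}) := by
  let K := closure (weakCoord A π '' {ψ | ψ ∈ coeffHull Y ∧ ψ 1 ≤ coeff X ξ 1})
  have isClosed_K : IsClosed {ζ | weakCoord A π (coeff X ζ) ∈ K} :=
    isClosed_closure.preimage ((continuous_weakCoord π).comp continuous_coeff)
  suffices X.act 1 ξ ∈ closure {ζ | weakCoord A π (coeff X ζ) ∈ K} by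
    simpa only [Set.mem_ofPred_eq, coeff_act_one] using isClosed_K.closure_subset this
  refine Metric.mem_closure_iff.mpr fun ε hε => ?_
  obtain ⟨s, u, r, hs, hu, hss, hr, norm_sub_le⟩ := exists_regularization (δ := (ε / 2) ^ 2)
    (map_one_nonneg_of_mem_coeffCone (coeff_mem_coeffCone ξ)) (by positivity)
  let q : B := (2 : ℝ) • s - r * ((2 : ℝ) • s)
  refine ⟨MulOpposite.op q • MulOpposite.op u • X.act 1 ξ, ?_, ?_⟩
  · have hr' : IsQuasiResolvent (coeff X (MulOpposite.op u • ξ) 1) r := by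
      rwa [coeff_op_smul, hu.star_eq]
    have := hXY.weakCoord_mem_closure_dominated_of_isQuasiResolvent hπ hr' (s := s)
    rw [hs.star_eq, hss] at this
    rwa [Set.mem_ofPred_eq, ← act_op_smul, ← act_op_smul, coeff_act_one]
  · have star_mul_self : star s * s = rinner B (X.act 1 ξ) (X.act 1 ξ) := by
      rw [hs.star_eq, hss, coeff_one]
    rw [dist_eq_norm, norm_sub_op_smul_op_smul star_mul_self]
    rw [Real.sqrt_sq (half_pos hε).le] at norm_sub_le
    exact norm_sub_le.trans_lt (half_lt_self hε)

end CutDown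

section SigmaWeak

variable {H : Type x} [NormedAddCommGroup H] [InnerProductSpace ℂ H]
  {α : Type*} {l : Filter α} {f : α → H →L[ℂ] H} {T : H →L[ℂ] H}

lemma tendsto_sigmaWeak_iff :
    Tendsto f l (@nhds _ (sigmaWeak H) T) ↔ ∀ s t : ℕ → H, Summable (fun n => ‖s n‖ ^ 2) →
      Summable (fun n => ‖t n‖ ^ 2) →
      Tendsto (fun i => ∑' n, ⟪s n, f i (t n)⟫_ℂ) l (𝓝 (∑' n, ⟪s n, T (t n)⟫_ℂ)) := by
  simp only [nhds_iInf, tendsto_iInf, nhds_induced, tendsto_comap_iff]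
  exact ⟨fun h s t hs ht => h ⟨(s, t), hs, ht⟩, fun h ⟨⟨s, t⟩, hs, ht⟩ => h s t hs ht⟩

lemma tendsto_inner_of_tendsto_sigmaWeak (h : Tendsto f l (@nhds _ (sigmaWeak H) T)) (s t : H) :
    Tendsto (fun i => ⟪s, f i t⟫_ℂ) l (𝓝 ⟪s, T t⟫_ℂ) := by
  have summable_single (s : H) : Summable fun n => ‖(Pi.single 0 s : ℕ → H) n‖ ^ 2 :=
    summable_of_ne_finset_zero (s := {0}) fun n hn => by
      simp [Pi.single_eq_of_ne (Finset.notMem_singleton.mp hn)]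
  have tsum_single (S : H →L[ℂ] H) :
      ∑' n, ⟪(Pi.single 0 s : ℕ → H) n, S ((Pi.single 0 t : ℕ → H) n)⟫_ℂ = ⟪s, S t⟫_ℂ := by
    rw [tsum_eq_single 0 fun n hn => by simp [Pi.single_eq_of_ne hn], Pi.single_eq_same,
      Pi.single_eq_same]
  simpa only [tsum_single] using
    tendsto_sigmaWeak_iff.mp h _ _ (summable_single s) (summable_single t)

lemma tendsto_sigmaWeak_of_bounded {C : ℝ} (hC : ∀ i s t, ‖⟪s, f i t⟫_ℂ‖ ≤ C * (‖s‖ * ‖t‖))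
    (h : ∀ s t, Tendsto (fun i => ⟪s, f i t⟫_ℂ) l (𝓝 ⟪s, T t⟫_ℂ)) :
    Tendsto f l (@nhds _ (sigmaWeak H) T) := by
  refine tendsto_sigmaWeak_iff.mpr fun s t hs ht => ?_
  refine tendsto_tsum_of_dominated_convergence (bound := fun n => C * (‖s n‖ * ‖t n‖))
    (Summable.mul_left _ ?_) (fun n => h _ _) (Eventually.of_forall fun i n => hC i _ _)
  refine Summable.of_nonneg_of_le (fun n => by positivity) (fun n => ?_) (hs.add ht)
  nlinarith [sq_nonneg (‖s n‖ - ‖t n‖), sq_nonneg ‖s n‖, sq_nonneg ‖t n‖]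

end SigmaWeak

section Equivalence

variable {A : Type u} {B : Type v} [CStarAlgebra A] [NonUnitalCStarAlgebra B]
  [PartialOrder B] [StarOrderedRing B]
  {H : Type x} [NormedAddCommGroup H] [InnerProductSpace ℂ H] [CompleteSpace H]
  {X : Corr.{u, v, w} A B} {Y : Corr.{u, v, y} A B} {π : B →⋆ₙₐ[ℂ] (H →L[ℂ] H)}

theorem WeaklyContained.exists_dominated_net (hXY : WeaklyContained π X Y)
    (hπ : Nondegenerate π) (ξ : X.carrier) :
    ∃ (ι : Type (max u v x)) (_ : Preorder ι) (_ : IsDirectedOrder ι)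
      (_ : Nonempty ι) (ψ : ι → A → B),
      (∀ i, ψ i ∈ coeffHull Y ∧ ψ i 1 ≤ coeff X ξ 1) ∧
      ∀ a : A, Tendsto (fun i => π (ψ i a)) atTop (@nhds _ (sigmaWeak H) (π (coeff X ξ a))) := by
  obtain ⟨ι, hpre, hdir, hne, ψ, hψ, ht⟩ :=
    exists_net_of_mem_closure_image.{_, _, v} (hXY.weakCoord_mem_closure_dominated hπ ξ)
  refine ⟨ι, hpre, hdir, hne, ψ, hψ, fun a => ?_⟩
  exact tendsto_sigmaWeak_of_bounded
    (fun i => norm_inner_le_of_map_one_le (mem_coeffCone_iff.mpr (hψ i).1) (hψ i).2 a)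
    fun h k => tendsto_pi_nhds.mp ht (a, h, k)

theorem weaklyContained_of_forall_exists_net
    (h : ∀ ξ : X.carrier, ∃ (ι : Type (max u v x)) (_ : Preorder ι) (_ : IsDirectedOrder ι)
        (_ : Nonempty ι) (ψ : ι → A → B), (∀ i, ψ i ∈ coeffHull Y) ∧
        ∀ a : A, Tendsto (fun i => π (ψ i a)) atTop (@nhds _ (sigmaWeak H) (π (coeff X ξ a)))) :
    WeaklyContained π X Y := by
  refine weaklyContained_of_total (S := Set.univ) (by simp) fun ξ _ => ?_
  obtain ⟨ι, _, _, _, ψ, hψ, ht⟩ := h ξ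
  exact mem_closure_of_tendsto
    (tendsto_pi_nhds.mpr fun p => tendsto_inner_of_tendsto_sigmaWeak (ht p.1) p.2.1 p.2.2)
    (.of_forall fun i => ⟨ψ i, mem_coeffCone_iff.mpr (hψ i), rfl⟩)

end Equivalence

section BaseTensor

open UniformSpace

variable {A : Type u} {B : Type v} [CStarAlgebra A] [NonUnitalCStarAlgebra B]
  [PartialOrder B] [StarOrderedRing B]
  {C : Type x} [NonUnitalCStarAlgebra C] [PartialOrder C] [StarOrderedRing C]
  {X : Corr.{u, v, w} A B} {φ : B →⋆ₙₐ[ℂ] C}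

variable (X φ) in
/-- The elementary tensor `ξ ⊗ c` in `X ⊗_B C`. -/
def baseVec : X.carrier →ₗ[ℂ] C →ₗ[ℂ] (baseChange X φ).carrier :=
  (TensorProduct.mk ℂ X.carrier C).compr₂
    ((Completion.toComplL : PreBase X φ →L[ℂ] BaseChange X φ) :
      PreBase X φ →ₗ[ℂ] BaseChange X φ)

lemma rinner_baseVec (ξ η : X.carrier) (c d : C) :
    rinner C (baseVec X φ ξ c) (baseVec X φ η d) = star c * (φ (rinner B ξ η) * d) :=
  congrArg MulOpposite.unop
    (baseChange_inner_coe (X := X) (φ := φ) (ξ ⊗ₜ[ℂ] c) (η ⊗ₜ[ℂ] d))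

lemma baseVec_mul (ξ : X.carrier) (c d : C) :
    baseVec X φ ξ (c * d) = MulOpposite.op d • baseVec X φ ξ c := by
  apply eq_of_rinner_eq (B := C) <;>
    simp only [rinner_op_smul_left, rinner_op_smul_right, rinner_baseVec, star_mul, mul_assoc]

lemma baseVec_map_mul (ξ : X.carrier) (b : B) (c : C) :
    baseVec X φ ξ (φ b * c) = baseVec X φ (MulOpposite.op b • ξ) c := by
  apply eq_of_rinner_eq (B := C) <;>
    simp only [rinner_op_smul_left, rinner_op_smul_right, rinner_baseVec, star_mul, map_mul,
      map_star, mul_assoc]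

lemma act_baseVec (a : A) (ξ : X.carrier) (c : C) :
    (baseChange X φ).act a (baseVec X φ ξ c) = baseVec X φ (X.act a ξ) c :=
  baseActL_coe (X := X) (φ := φ) a (ξ ⊗ₜ[ℂ] c)

lemma coeff_baseVec (ξ : X.carrier) (c : C) (a : A) :
    coeff (baseChange X φ) (baseVec X φ ξ c) a = star c * φ (coeff X ξ a) * c := by
  rw [coeff, act_baseVec, rinner_baseVec, mul_assoc]
  rfl

lemma dense_span_range_baseVec : Dense (Submodule.span ℂ
    (Set.range fun p : X.carrier × C => baseVec X φ p.1 p.2) : Set (baseChange X φ).carrier) := by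
  refine Completion.denseRange_coe (α := PreBase X φ) |>.mono ?_
  rintro _ ⟨s, rfl⟩
  refine TensorProduct.induction_on
    (motive := fun s => Completion.coe' (α := PreBase X φ) s ∈ Submodule.span ℂ _) s
    (Submodule.zero_mem _) (fun ξ c => Submodule.subset_span ⟨(ξ, c), rfl⟩) fun s t hs ht => ?_
  have := Completion.coe_add (α := PreBase X φ) s t
  exact this ▸ Submodule.add_mem _ hs ht

lemma conj_mem_coeffCone_baseChange {ψ : A → B} (hψ : ψ ∈ coeffCone X) (c : C) :
    (fun a => star c * φ (ψ a) * c) ∈ coeffCone (baseChange X φ) := by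
  induction hψ using Submodule.span_induction with
  | mem ψ hψ =>
    obtain ⟨ξ, rfl⟩ := hψ
    convert coeff_mem_coeffCone (baseVec X φ ξ c) using 1
    ext a
    rw [coeff_baseVec]
  | zero =>
    convert (coeffCone (baseChange X φ)).zero_mem using 1
    ext a
    simp
  | add ψ χ _ _ hψ hχ =>
    convert add_mem hψ hχ using 1
    ext a
    simp only [Pi.add_apply, map_add, mul_add, add_mul]
  | smul t ψ _ hψ =>
    convert Submodule.smul_mem (coeffCone (baseChange X φ)) t hψ using 1
    ext a
    change star c * φ ((t : ℝ) • ψ a) * c = (t : ℝ) • (star c * φ (ψ a) * c)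
    rw [← Complex.coe_smul, map_smul, Complex.coe_smul, mul_smul_comm, smul_mul_assoc]

end BaseTensor

section UltrafilterLimits

variable {α : Type*} (U : Ultrafilter α)

lemma exists_ultrafilter_tendsto_of_norm_le {z : α → ℂ} {C : ℝ} (hz : ∀ i, ‖z i‖ ≤ C) :
    ∃ z₀, ‖z₀‖ ≤ C ∧ Tendsto z U (𝓝 z₀) := by
  have hball : ↑(U.map z) ≤ 𝓟 (Metric.closedBall (0 : ℂ) C) := by
    rw [Ultrafilter.coe_map, le_principal_iff]
    exact mem_map.mpr <| univ_mem' fun i => by simpa using hz i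
  obtain ⟨z₀, hz₀, hlim⟩ :=
    isCompact_iff_ultrafilter_le_nhds.mp (isCompact_closedBall (0 : ℂ) C) (U.map z) hball
  exact ⟨z₀, by simpa using hz₀, hlim⟩

variable {H : Type x} [NormedAddCommGroup H] [InnerProductSpace ℂ H] [CompleteSpace H]

/-- The limit along `U` of a bounded family of sesquilinear forms is a bounded sesquilinear form,
which the Riesz representation theorem turns into an operator. -/
lemma exists_ultrafilter_tendsto_inner {T : α → H →L[ℂ] H} {C : ℝ}
    (hC : ∀ i s t, ‖⟪s, T i t⟫_ℂ‖ ≤ C * (‖s‖ * ‖t‖)) :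
    ∃ T₀ : H →L[ℂ] H, ∀ s t, Tendsto (fun i => ⟪s, T i t⟫_ℂ) U (𝓝 ⟪s, T₀ t⟫_ℂ) := by
  choose L norm_L_le tendsto_L using fun s t : H =>
    exists_ultrafilter_tendsto_of_norm_le U fun i => hC i s t
  let form : H →ₗ⋆[ℂ] H →ₗ[ℂ] ℂ := LinearMap.mk₂'ₛₗ (starRingEnd ℂ) (RingHom.id ℂ) L
    (fun s s' t => tendsto_nhds_unique (tendsto_L (s + s') t)
      (by simpa only [inner_add_left] using (tendsto_L s t).add (tendsto_L s' t)))
    (fun c s t => tendsto_nhds_unique (tendsto_L (c • s) t)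
      (by simpa only [inner_smul_left, smul_eq_mul] using
        (tendsto_L s t).const_mul (starRingEnd ℂ c)))
    (fun s t t' => tendsto_nhds_unique (tendsto_L s (t + t'))
      (by simpa only [inner_add_right, map_add] using (tendsto_L s t).add (tendsto_L s t')))
    (fun c s t => tendsto_nhds_unique (tendsto_L s (c • t))
      (by simpa only [inner_smul_right, map_smul, RingHom.id_apply, smul_eq_mul] using
        (tendsto_L s t).const_mul c))
  let boundedForm : H →L⋆[ℂ] H →L[ℂ] ℂ := LinearMap.mkContinuous₂ form C fun s t =>
    (norm_L_le s t).trans_eq (mul_assoc _ _ _).symm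
  refine ⟨(InnerProductSpace.continuousLinearMapOfBilin boundedForm).adjoint, fun s t => ?_⟩
  rw [ContinuousLinearMap.adjoint_inner_right, InnerProductSpace.continuousLinearMapOfBilin_apply]
  exact tendsto_L s t

end UltrafilterLimits

section Normal

variable {H : Type x} [NormedAddCommGroup H] [InnerProductSpace ℂ H] [CompleteSpace H]
  {M : VonNeumannAlgebra H}

/-- The identity representation of a von Neumann algebra. -/
def VN.idRep (M : VonNeumannAlgebra H) : VN M →⋆ₙₐ[ℂ] (H →L[ℂ] H) :=
  (VN.incl M).toNonUnitalStarAlgHom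

lemma VN.isFaithfulNormal_idRep : IsFaithfulNormal (VN.idRep M) where
  nondegenerate h := subset_closure <| Submodule.subset_span ⟨1, h, by
    rw [show VN.idRep M 1 = 1 from map_one (VN.incl M), one_apply_eq_self]⟩
  injective := Subtype.val_injective
  normal := continuous_induced_dom

variable {α : Type*} {l : Filter α} {m : α → VN M} {m₀ : VN M}

lemma VN.mem_of_tendsto_inner [l.NeBot] {T : H →L[ℂ] H}
    (h : ∀ s t, Tendsto (fun i => ⟪s, VN.incl M (m i) t⟫_ℂ) l (𝓝 ⟪s, T t⟫_ℂ)) : T ∈ M := by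
  suffices T ∈ (M : Set (H →L[ℂ] H)).centralizer.centralizer by
    rwa [M.centralizer_centralizer] at this
  intro S hS
  ext t
  refine ext_inner_left ℂ fun s => ?_
  rw [mul_apply_eq_comp, mul_apply_eq_comp, ← ContinuousLinearMap.adjoint_inner_left]
  refine tendsto_nhds_unique (h (ContinuousLinearMap.adjoint S s) t) ?_
  refine (h s (S t)).congr fun i => ?_
  rw [ContinuousLinearMap.adjoint_inner_left]
  exact congrArg (inner ℂ s) congr($(hS _ (m i).2) t)

variable {K : Type*} [NormedAddCommGroup K] [InnerProductSpace ℂ K] [CompleteSpace K]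
  {σ : VN M →⋆ₙₐ[ℂ] (K →L[ℂ] K)}

lemma IsFaithfulNormal.tendsto_sigmaWeak (hσ : IsFaithfulNormal σ)
    (h : Tendsto (fun i => VN.incl M (m i)) l (@nhds _ (sigmaWeak H) (VN.incl M m₀))) :
    Tendsto (fun i => σ (m i)) l (@nhds _ (sigmaWeak K) (σ m₀)) := by
  have hm : Tendsto m l (@nhds _ (VN.sigmaWeak M) m₀) := by
    rwa [@nhds_induced _ _ (sigmaWeak H), tendsto_comap_iff]
  exact (@Continuous.tendsto _ _ (VN.sigmaWeak M) (sigmaWeak K) _ hσ.normal m₀).comp hm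

/-- Bounded families have ultrafilter limits in `M`, and these are determined by their images
under `σ`. -/
lemma IsFaithfulNormal.tendsto_inner_of_bounded (hσ : IsFaithfulNormal σ) {C : ℝ}
    (hC : ∀ i s t, ‖⟪s, VN.incl M (m i) t⟫_ℂ‖ ≤ C * (‖s‖ * ‖t‖))
    (h : ∀ s t, Tendsto (fun i => ⟪s, σ (m i) t⟫_ℂ) l (𝓝 ⟪s, σ m₀ t⟫_ℂ)) (s t : H) :
    Tendsto (fun i => ⟪s, VN.incl M (m i) t⟫_ℂ) l (𝓝 ⟪s, VN.incl M m₀ t⟫_ℂ) := by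
  refine (tendsto_iff_ultrafilter ..).mpr fun U hU => ?_
  obtain ⟨T, hT⟩ := exists_ultrafilter_tendsto_inner U hC
  obtain ⟨T, rfl⟩ : ∃ m' : VN M, VN.incl M m' = T := ⟨⟨T, VN.mem_of_tendsto_inner hT⟩, rfl⟩
  have hlim := hσ.tendsto_sigmaWeak (m₀ := T) (tendsto_sigmaWeak_of_bounded hC hT)
  obtain rfl : T = m₀ := hσ.injective <| ContinuousLinearMap.ext fun t =>
    ext_inner_left ℂ fun s => tendsto_nhds_unique (tendsto_inner_of_tendsto_sigmaWeak hlim s t)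
      ((h s t).mono_left hU)
  exact hT s t

end Normal

section BaseChangeEquivalence

variable {A : Type u} {B : Type v} [CStarAlgebra A] [NonUnitalCStarAlgebra B]
  [PartialOrder B] [StarOrderedRing B]
  {H : Type x} [NormedAddCommGroup H] [InnerProductSpace ℂ H] [CompleteSpace H]
  {X : Corr.{u, v, w} A B} {Y : Corr.{u, v, y} A B} {π : B →⋆ₙₐ[ℂ] (H →L[ℂ] H)}

theorem IsFaithfulNormal.weaklyContained_baseChange {K : Type*} [NormedAddCommGroup K]
    [InnerProductSpace ℂ K] [CompleteSpace K] {σ : VN (bicommutant π) →⋆ₙₐ[ℂ] (K →L[ℂ] K)}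
    (hσ : IsFaithfulNormal σ)
    (h : ∀ ξ : X.carrier, ∃ (ι : Type (max u v x)) (_ : Preorder ι) (_ : IsDirectedOrder ι)
        (_ : Nonempty ι) (ψ : ι → A → B), (∀ i, ψ i ∈ coeffHull Y) ∧
        ∀ a : A, Tendsto (fun i => π (ψ i a)) atTop (@nhds _ (sigmaWeak H) (π (coeff X ξ a)))) :
    WeaklyContained σ (baseChange X (toBicommutant π)) (baseChange Y (toBicommutant π)) := by
  refine weaklyContained_of_total dense_span_range_baseVec ?_
  rintro _ ⟨⟨ξ, m⟩, rfl⟩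
  obtain ⟨ι, _, _, _, ψ, hψ, hlim⟩ := h ξ
  refine mem_closure_of_tendsto (b := atTop) (tendsto_pi_nhds.mpr fun p => ?_)
    (.of_forall fun i => ⟨_, conj_mem_coeffCone_baseChange (mem_coeffCone_iff.mpr (hψ i)) m, rfl⟩)
  simp only [weakCoord_apply, coeff_baseVec, inner_map_conj]
  have hlim' : Tendsto (fun i => VN.incl _ (toBicommutant π (ψ i p.1))) atTop
      (@nhds _ (sigmaWeak H) (VN.incl _ (toBicommutant π (coeff X ξ p.1)))) := hlim p.1
  exact tendsto_inner_of_tendsto_sigmaWeak (hσ.tendsto_sigmaWeak hlim') _ _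

lemma vecs_baseVec_mem_closure (hπ : Nondegenerate π) {ι : Type*} [Finite ι]
    (h : PiLp 2 fun _ : ι => H) (η : Y.carrier) (m : VN (bicommutant π)) :
    vecs _ (VN.idRep _) (baseVec Y (toBicommutant π) η m) h ∈
      closure (Set.range fun η => vecs _ (VN.idRep _) (baseVec Y (toBicommutant π) η 1) h) := by
  have := Fintype.ofFinite ι
  have move_right : vecs _ (VN.idRep _) (baseVec Y (toBicommutant π) η m) h =
      vecs _ (VN.idRep _) (baseVec Y (toBicommutant π) η 1)
        (WithLp.toLp 2 fun i => VN.incl _ m (h i)) := by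
    ext i
    rw [vecs_apply, ← one_mul m, baseVec_mul, vec_op_smul, one_mul]
    rfl
  rw [move_right]
  refine map_mem_closure (continuous_vecs_right _)
    (hπ.mem_cyclicSubspace_of_mem_bicommutant m h) ?_
  rintro _ ⟨b, rfl⟩
  refine ⟨MulOpposite.op b • η, ?_⟩
  ext i
  change vec _ (VN.idRep _) (baseVec Y (toBicommutant π) (MulOpposite.op b • η) 1) (h i) =
    vec _ (VN.idRep _) (baseVec Y (toBicommutant π) η 1) (VN.idRep _ (toBicommutant π b) (h i))
  rw [← baseVec_map_mul, ← vec_op_smul, ← baseVec_mul, one_mul, mul_one]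

lemma vecs_baseChange_mem_closure (hπ : Nondegenerate π) {ι : Type*} [Finite ι]
    (h : PiLp 2 fun _ : ι => H) (ζ : (baseChange Y (toBicommutant π)).carrier) :
    vecs _ (VN.idRep _) ζ h ∈
      closure (Set.range fun η => vecs _ (VN.idRep _) (baseVec Y (toBicommutant π) η 1) h) := by
  have := Fintype.ofFinite ι
  let L := vecsLinear (baseChange Y (toBicommutant π)) (VN.idRep _) h
  let N := (LinearMap.range (L ∘ₗ (baseVec Y (toBicommutant π)).flip 1)).topologicalClosure
  have continuous_L : Continuous L := (PiLp.continuous_toLp 2 _).comp <|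
    continuous_pi fun i => continuous_vec_left (h i)
  refine closure_minimal (t := N.comap L) ?_
    ((Submodule.isClosed_topologicalClosure _).preimage continuous_L)
    (dense_span_range_baseVec ζ)
  refine Submodule.span_le.mpr ?_
  rintro _ ⟨⟨η, m⟩, rfl⟩
  exact vecs_baseVec_mem_closure hπ h η m

lemma weakCoord_coeff_baseChange_mem_closure (hπ : Nondegenerate π)
    (ζ : (baseChange Y (toBicommutant π)).carrier) :
    weakCoord A (VN.idRep _) (coeff (baseChange Y (toBicommutant π)) ζ) ∈
      closure (weakCoord A π '' coeffCone Y) := by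
  refine mem_closure_of_forall_finset fun I ε hε => ?_
  let h : PiLp 2 fun _ : I ⊕ I => H :=
    WithLp.toLp 2 (Sum.elim (fun p => p.1.2.1) fun p => p.1.2.2)
  let F (v : PiLp 2 fun _ : I ⊕ I =>
      IntTensor (baseChange Y (toBicommutant π)) (VN.idRep (bicommutant π))) (p : I) : ℂ :=
    ⟪v (.inl p), tensorOp _ _ p.1.1 1 (v (.inr p))⟫_ℂ
  have F_vecs (ζ) (p) : F (vecs _ _ ζ h) p =
      weakCoord A (VN.idRep _) (coeff (baseChange Y (toBicommutant π)) ζ) p :=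
    inner_tensorOp_vec _ _ _ _ _
  have continuous_F : Continuous F := by fun_prop
  obtain ⟨_, ⟨_, ⟨η, rfl⟩, rfl⟩, hdist⟩ := Metric.mem_closure_iff.mp
    (image_closure_subset_closure_image continuous_F ⟨_, vecs_baseChange_mem_closure hπ h ζ, rfl⟩)
    ε hε
  refine ⟨_, ⟨_, coeff_mem_coeffCone η, rfl⟩, fun p hp => ?_⟩
  have := (dist_le_pi_dist _ _ ⟨p, hp⟩).trans_lt hdist
  rw [dist_comm, F_vecs, F_vecs] at this
  simp only [weakCoord_apply, coeff_baseVec, star_one, one_mul, mul_one] at this ⊢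
  exact this

lemma weakCoord_image_coeffCone_baseChange_subset (hπ : Nondegenerate π) :
    weakCoord A (VN.idRep (bicommutant π)) '' coeffCone (baseChange Y (toBicommutant π)) ⊆
      closure (weakCoord A π '' coeffCone Y) := by
  let C : PointedCone ℝ (A × H × H → ℂ) :=
    (Submodule.closure ((coeffCone Y).map (weakCoord A π))).toSubmodule
  rw [Set.image_subset_iff]
  refine Submodule.span_le (p := C.comap (weakCoord A (VN.idRep _))).mpr ?_
  rintro _ ⟨ζ, rfl⟩
  exact weakCoord_coeff_baseChange_mem_closure hπ ζ

theorem weaklyContained_of_baseChange (hπ : Nondegenerate π) {K : Type x} [NormedAddCommGroup K]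
    [InnerProductSpace ℂ K] [CompleteSpace K] {σ : VN (bicommutant π) →⋆ₙₐ[ℂ] (K →L[ℂ] K)}
    (hσ : IsFaithfulNormal σ)
    (h : WeaklyContained σ (baseChange X (toBicommutant π)) (baseChange Y (toBicommutant π))) :
    WeaklyContained π X Y := by
  refine weaklyContained_of_total (S := Set.univ) (by simp) fun ξ _ => ?_
  obtain ⟨ι, _, _, _, ψ, hψ, hlim⟩ :=
    h.exists_dominated_net hσ.nondegenerate (baseVec X (toBicommutant π) ξ 1)
  refine closure_minimal (weakCoord_image_coeffCone_baseChange_subset hπ) isClosed_closure <|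
    mem_closure_of_tendsto (b := atTop) (f := fun i => weakCoord A (VN.idRep _) (ψ i))
      (tendsto_pi_nhds.mpr fun ⟨(a : A), (s : H), (t : H)⟩ => ?_)
      (.of_forall fun i => ⟨ψ i, mem_coeffCone_iff.mpr (hψ i).1, rfl⟩)
  have := hσ.tendsto_inner_of_bounded
    (fun i => norm_inner_le_of_map_one_le (π := VN.idRep (bicommutant π))
      (mem_coeffCone_iff.mpr (hψ i).1) (hψ i).2 a)
    (tendsto_inner_of_tendsto_sigmaWeak (hlim a)) s t
  rwa [coeff_baseVec, star_one, one_mul, mul_one] at this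

end BaseChangeEquivalence

section PositiveMajorant

variable {B : Type v} [NonUnitalCStarAlgebra B] [PartialOrder B]

/-- The infimum of `C * ‖x + (k + l)‖ - f k` over positive `k` and `l`. The variable `l` makes a
linear functional dominated by this sublinear functional positive, and the variable `k` makes it
dominate `f` on the positive cone. -/
def majorantGauge (f : B →ₗ[ℝ] ℝ) (C : ℝ) (x : B) : ℝ :=
  ⨅ p : {k : B // 0 ≤ k} × {l : B // 0 ≤ l}, (C * ‖x + (p.1 + p.2)‖ - f p.1)

lemma nonempty_nonneg_prod : Nonempty ({k : B // 0 ≤ k} × {l : B // 0 ≤ l}) :=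
  ⟨⟨0, le_rfl⟩, ⟨0, le_rfl⟩⟩

variable [StarOrderedRing B] {f : B →ₗ[ℝ] ℝ} {C : ℝ}

lemma neg_mul_norm_le_of_nonneg (hC : 0 ≤ C) (hf : ∀ b, f b ≤ C * ‖b‖) (x : B) {k l : B}
    (hk : 0 ≤ k) (hl : 0 ≤ l) : -(C * ‖x‖) ≤ C * ‖x + (k + l)‖ - f k := by
  have norm_k_le : ‖k‖ ≤ ‖x + (k + l)‖ + ‖x‖ :=
    calc ‖k‖ ≤ ‖k + l‖ := CStarAlgebra.norm_le_norm_of_nonneg_of_le hk (le_add_of_nonneg_right hl)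
      _ = ‖x + (k + l) - x‖ := by rw [add_sub_cancel_left]
      _ ≤ ‖x + (k + l)‖ + ‖x‖ := norm_sub_le _ _
  linarith [hf k, mul_le_mul_of_nonneg_left norm_k_le hC]

lemma majorantGauge_le (hC : 0 ≤ C) (hf : ∀ b, f b ≤ C * ‖b‖) (x : B) {k l : B}
    (hk : 0 ≤ k) (hl : 0 ≤ l) : majorantGauge f C x ≤ C * ‖x + (k + l)‖ - f k := by
  refine ciInf_le ⟨-(C * ‖x‖), ?_⟩ (⟨⟨k, hk⟩, ⟨l, hl⟩⟩ : {k : B // 0 ≤ k} × {l : B // 0 ≤ l})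
  rintro _ ⟨p, rfl⟩
  exact neg_mul_norm_le_of_nonneg hC hf x p.1.2 p.2.2

lemma majorantGauge_zero_nonneg (hC : 0 ≤ C) (hf : ∀ b, f b ≤ C * ‖b‖) :
    0 ≤ majorantGauge f C 0 := by
  have := nonempty_nonneg_prod (B := B)
  exact le_ciInf fun p => by
    simpa only [norm_zero, mul_zero, neg_zero] using
      neg_mul_norm_le_of_nonneg hC hf 0 p.1.2 p.2.2

lemma majorantGauge_smul_le (hC : 0 ≤ C) (hf : ∀ b, f b ≤ C * ‖b‖) {c : ℝ} (hc : 0 ≤ c) (x : B) :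
    majorantGauge f C (c • x) ≤ c * majorantGauge f C x := by
  have := nonempty_nonneg_prod (B := B)
  rw [majorantGauge, majorantGauge, Real.mul_iInf_of_nonneg hc]
  refine le_ciInf fun p => (majorantGauge_le hC hf (c • x) (smul_nonneg hc p.1.2)
    (smul_nonneg hc p.2.2)).trans_eq ?_
  rw [← smul_add, ← smul_add, norm_smul, map_smul, Real.norm_of_nonneg hc, smul_eq_mul]
  ring

lemma majorantGauge_smul (hC : 0 ≤ C) (hf : ∀ b, f b ≤ C * ‖b‖) {c : ℝ} (hc : 0 < c) (x : B) :
    majorantGauge f C (c • x) = c * majorantGauge f C x := by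
  refine le_antisymm (majorantGauge_smul_le hC hf hc.le x) ?_
  have := majorantGauge_smul_le hC hf (inv_nonneg.mpr hc.le) (c • x)
  rwa [inv_smul_smul₀ hc.ne', ← div_eq_inv_mul, le_div_iff₀' hc] at this

lemma majorantGauge_add_le (hC : 0 ≤ C) (hf : ∀ b, f b ≤ C * ‖b‖) (x y : B) :
    majorantGauge f C (x + y) ≤ majorantGauge f C x + majorantGauge f C y := by
  have := nonempty_nonneg_prod (B := B)
  refine le_ciInf_add_ciInf fun ⟨⟨k, hk⟩, ⟨l, hl⟩⟩ ⟨⟨k', hk'⟩, ⟨l', hl'⟩⟩ => ?_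
  calc majorantGauge f C (x + y)
      ≤ C * ‖x + y + (k + k' + (l + l'))‖ - f (k + k') :=
        majorantGauge_le hC hf _ (add_nonneg hk hk') (add_nonneg hl hl')
    _ = C * ‖(x + (k + l)) + (y + (k' + l'))‖ - (f k + f k') := by rw [map_add]; congr 3; abel
    _ ≤ C * (‖x + (k + l)‖ + ‖y + (k' + l')‖) - (f k + f k') := by gcongr; exact norm_add_le _ _
    _ = C * ‖x + (k + l)‖ - f k + (C * ‖y + (k' + l')‖ - f k') := by ring

lemma exists_nonneg_majorant (hC : 0 ≤ C) (hf : ∀ b, f b ≤ C * ‖b‖) :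
    ∃ g : B →ₗ[ℝ] ℝ, ∀ k, 0 ≤ k → 0 ≤ g k ∧ f k ≤ g k := by
  obtain ⟨g, -, hg⟩ := exists_extension_of_le_sublinear (⊥ : B →ₗ.[ℝ] ℝ) (majorantGauge f C)
    (fun _ hc => majorantGauge_smul hC hf hc) (majorantGauge_add_le hC hf) (by
      rintro ⟨x, hx⟩
      obtain rfl : x = 0 := (Submodule.mem_bot ℝ).mp hx
      exact (LinearPMap.map_zero _).trans_le (majorantGauge_zero_nonneg hC hf))
  have neg_apply_le {k l m : B} (hk : 0 ≤ k) (hl : 0 ≤ l) (h : k + l = m) : -g m ≤ -f k := by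
    have := (hg (-m)).trans (majorantGauge_le hC hf (-m) hk hl)
    rwa [map_neg, h, neg_add_cancel, norm_zero, mul_zero, zero_sub] at this
  refine ⟨g, fun k hk => ⟨?_, neg_le_neg_iff.mp (neg_apply_le hk le_rfl (add_zero k))⟩⟩
  simpa using neg_apply_le le_rfl hk (zero_add k)

lemma exists_linearMap_eq_ofReal (g : B →ₗ[ℝ] ℝ) :
    ∃ G : B →ₗ[ℂ] ℂ, ∀ b, 0 ≤ b → G b = g b := by
  refine ⟨Module.Dual.extendRCLike (g ∘ₗ (selfAdjoint.submodule ℝ B).subtype ∘ₗ realPart),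
    fun b hb => ?_⟩
  have hsa : IsSelfAdjoint b := .of_nonneg hb
  rw [Module.Dual.extendRCLike_apply]
  change (g (realPart b) : ℂ) - Complex.I * g (realPart (Complex.I • b)) = g b
  rw [realPart_I_smul, hsa.imaginaryPart, hsa.coe_realPart]
  simp

lemma mem_span_positive (f : B →L[ℂ] ℂ) :
    (f : B →ₗ[ℂ] ℂ) ∈ Submodule.span ℂ {p : B →ₗ[ℂ] ℂ | ∀ b, 0 ≤ b → 0 ≤ p b} := by
  set S := Submodule.span ℂ {p : B →ₗ[ℂ] ℂ | ∀ b, 0 ≤ b → 0 ≤ p b}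
  have ext_nonneg {F G : B →ₗ[ℂ] ℂ} (h : ∀ b, 0 ≤ b → F b = G b) : F = G :=
    LinearMap.ext_on CStarAlgebra.span_nonneg h
  have exists_real_extension (g : B →ₗ[ℝ] ℝ) (hg : ∀ b, g b ≤ ‖f‖ * ‖b‖) :
      ∃ G ∈ S, ∀ b, 0 ≤ b → G b = g b := by
    obtain ⟨p, hp⟩ := exists_nonneg_majorant (norm_nonneg f) hg
    obtain ⟨P, hP⟩ := exists_linearMap_eq_ofReal p
    obtain ⟨Q, hQ⟩ := exists_linearMap_eq_ofReal (p - g)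
    refine ⟨P - Q, S.sub_mem (Submodule.subset_span fun b hb => ?_)
      (Submodule.subset_span fun b hb => ?_), fun b hb => ?_⟩
    · rw [hP b hb]
      exact Complex.zero_le_real.mpr (hp b hb).1
    · rw [hQ b hb]
      exact Complex.zero_le_real.mpr (sub_nonneg.mpr (hp b hb).2)
    · rw [LinearMap.sub_apply, hP b hb, hQ b hb, LinearMap.sub_apply, Complex.ofReal_sub,
        sub_sub_cancel]
  obtain ⟨R, hRS, hR⟩ := exists_real_extension
    (Complex.reLm ∘ₗ (f : B →ₗ[ℂ] ℂ).restrictScalars ℝ)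
    fun b => (Complex.re_le_norm _).trans (f.le_opNorm b)
  obtain ⟨J, hJS, hJ⟩ := exists_real_extension
    (Complex.imLm ∘ₗ (f : B →ₗ[ℂ] ℂ).restrictScalars ℝ)
    fun b => (Complex.im_le_norm _).trans (f.le_opNorm b)
  have decomposition : (f : B →ₗ[ℂ] ℂ) = R + Complex.I • J := ext_nonneg fun b hb => by
    rw [LinearMap.add_apply, LinearMap.smul_apply, hR b hb, hJ b hb, smul_eq_mul, mul_comm]
    exact (Complex.re_add_im (f b)).symm
  rw [decomposition]
  exact S.add_mem hRS (S.smul_mem _ hJS)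

end PositiveMajorant

section GNS

open UniformSpace

variable {B : Type v} [NonUnitalCStarAlgebra B] [PartialOrder B] [StarOrderedRing B]
  (f : B →ₚ[ℂ] ℂ)

lemma exists_norm_apply_ofPreGNS_le : ∃ C, ∀ z : f.PreGNS, ‖f (f.ofPreGNS z)‖ ≤ C * ‖z‖ := by
  obtain ⟨C, hC⟩ := f.exists_norm_apply_le
  refine ⟨√C, fun z => ?_⟩
  have approximateUnit := CStarAlgebra.increasingApproximateUnit B
  have tendsto_norm : Tendsto (fun e => ‖f (e * f.ofPreGNS z)‖) (CStarAlgebra.approximateUnit B)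
      (𝓝 ‖f (f.ofPreGNS z)‖) :=
    (((by fun_prop : Continuous f).tendsto _).comp
      (approximateUnit.tendsto_mul_right (f.ofPreGNS z))).norm
  refine le_of_tendsto tendsto_norm (approximateUnit.eventually_norm.mono fun e he => ?_)
  have norm_toPreGNS_le : ‖f.toPreGNS (star e)‖ ≤ √C := by
    rw [PositiveLinearMap.preGNS_norm_def, PositiveLinearMap.ofPreGNS_toPreGNS]
    refine Real.sqrt_le_sqrt ((Complex.re_le_norm _).trans ((hC _).trans ?_))
    rw [CStarRing.norm_star_mul_self, norm_star]
    exact mul_le_of_le_one_right C.2 (mul_le_one₀ he (norm_nonneg _) he)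
  calc ‖f (e * f.ofPreGNS z)‖ = ‖⟪f.toPreGNS (star e), z⟫_ℂ‖ := by
        rw [PositiveLinearMap.preGNS_inner_def, PositiveLinearMap.ofPreGNS_toPreGNS, star_star]
    _ ≤ ‖f.toPreGNS (star e)‖ * ‖z‖ := norm_inner_le_norm _ _
    _ ≤ √C * ‖z‖ := by gcongr

lemma exists_gns_riesz_vector :
    ∃ Ω : f.GNS, ∀ z : f.PreGNS, ⟪Ω, (z : f.GNS)⟫_ℂ = f (f.ofPreGNS z) := by
  obtain ⟨C, hC⟩ := exists_norm_apply_ofPreGNS_le f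
  let F : f.PreGNS →L[ℂ] ℂ := LinearMap.mkContinuous
    (f.toLinearMap ∘ₗ (f.ofPreGNS : f.PreGNS →ₗ[ℂ] B)) C hC
  refine ⟨(InnerProductSpace.toDual ℂ f.GNS).symm (F.extend Completion.toComplL), fun z => ?_⟩
  rw [InnerProductSpace.toDual_symm_apply]
  exact F.extend_eq Completion.denseRange_coe (Completion.isUniformInducing_coe f.PreGNS) z

lemma exists_gns_cyclic_vector :
    ∃ Ω : f.GNS, (∀ b, f.gnsNonUnitalStarAlgHom b Ω = (f.toPreGNS b : f.GNS)) ∧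
      ∀ b, ⟪Ω, f.gnsNonUnitalStarAlgHom b Ω⟫_ℂ = f b := by
  obtain ⟨Ω, hΩ⟩ := exists_gns_riesz_vector f
  have gns_apply (b : B) : f.gnsNonUnitalStarAlgHom b Ω = (f.toPreGNS b : f.GNS) := by
    refine ext_inner_right ℂ fun z => ?_
    induction z using Completion.induction_on with
    | hp => exact isClosed_eq (by fun_prop) (by fun_prop)
    | ih z =>
      rw [← ContinuousLinearMap.adjoint_inner_right, ← ContinuousLinearMap.star_eq_adjoint,
        ← map_star, PositiveLinearMap.gnsNonUnitalStarAlgHom_apply_coe, hΩ, Completion.inner_coe,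
        PositiveLinearMap.preGNS_inner_def]
      rfl
  exact ⟨Ω, gns_apply, fun b => by rw [gns_apply, hΩ, PositiveLinearMap.ofPreGNS_toPreGNS]⟩

end GNS

section Universal

open UniformSpace

lemma isLUB_norm_image_closedBall {E F : Type*} [NormedAddCommGroup E] [NormedSpace ℂ E]
    [SeminormedAddCommGroup F] [NormedSpace ℂ F] (G : E →L[ℂ] F) :
    IsLUB ((fun b => ‖G b‖) '' Metric.closedBall 0 1) ‖G‖ := by
  rw [← G.sSup_unitClosedBall_eq_norm]
  refine isLUB_csSup ((Metric.nonempty_closedBall.mpr zero_le_one).image _) ⟨‖G‖, ?_⟩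
  rintro _ ⟨b, hb, rfl⟩
  exact G.unit_le_opNorm b (mem_closedBall_zero_iff.mp hb)

variable {B : Type v} [NonUnitalCStarAlgebra B] [PartialOrder B] [StarOrderedRing B]

lemma universalRep_apply_coe (b : B) (z : UnivSpace B) (f : State B) :
    universalRep B b z f = f.1.gnsNonUnitalStarAlgHom b (z f) := rfl

open Classical in
lemma universalRep_single (b : B) (f : State B) (z : f.1.GNS) :
    universalRep B b (lp.single 2 f z) = lp.single 2 f (f.1.gnsNonUnitalStarAlgHom b z) := by
  ext g : 2
  rw [universalRep_apply_coe]
  rcases eq_or_ne g f with rfl | hg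
  · rw [lp.single_apply_self, lp.single_apply_self]
  · rw [lp.single_apply_ne _ _ _ hg, lp.single_apply_ne _ _ _ hg, map_zero]

lemma nondegenerate_universalRep : Nondegenerate (universalRep B) := by
  classical
  intro z
  let S := (Submodule.span ℂ
    {h : UnivSpace B | ∃ (b : B) (k : UnivSpace B), universalRep B b k = h}).topologicalClosure
  have isClosed_S : IsClosed (S : Set (UnivSpace B)) := Submodule.isClosed_topologicalClosure _
  have single_mem (f : State B) (a : f.1.GNS) :
      lp.single (E := fun f : State B => f.1.GNS) 2 f a ∈ S := by
    obtain ⟨Ω, hΩ, -⟩ := exists_gns_cyclic_vector f.1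
    induction a using Completion.induction_on with
    | hp =>
      exact isClosed_S.preimage
        (lp.singleContinuousLinearMap ℂ (fun f : State B => f.1.GNS) 2 f).continuous
    | ih b =>
      refine Submodule.le_topologicalClosure _ (Submodule.subset_span
        ⟨f.1.ofPreGNS b, lp.single 2 f Ω, ?_⟩)
      rw [universalRep_single, hΩ]
      rfl
  exact isClosed_S.mem_of_tendsto (lp.hasSum_single (by simp) z)
    (.of_forall fun s => S.sum_mem fun f _ => single_mem f _)

lemma exists_state_eq_mul (f : B →ₚ[ℂ] ℂ) (hf : f ≠ 0) :
    ∃ (q : State B) (c : ℝ), 0 ≤ c ∧ ∀ b, f b = c * q.1 b := by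
  let F : B →L[ℂ] ℂ := ⟨f.toLinearMap, (by fun_prop : Continuous f)⟩
  have norm_pos : 0 < ‖F‖ := norm_pos_iff.mpr fun h =>
    hf (DFunLike.ext _ _ fun b => DFunLike.congr_fun (F := B →L[ℂ] ℂ) h b)
  let G : B →L[ℂ] ℂ := ((‖F‖⁻¹ : ℝ) : ℂ) • F
  have norm_G : ‖G‖ = 1 := by
    rw [norm_smul, Complex.norm_real, norm_inv, norm_norm, inv_mul_cancel₀ norm_pos.ne']
  let q : State B := ⟨PositiveLinearMap.mk₀ (G : B →ₗ[ℂ] ℂ) fun b hb =>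
    mul_nonneg (Complex.zero_le_real.mpr (inv_nonneg.mpr norm_pos.le)) (f.map_nonneg hb),
    norm_G ▸ isLUB_norm_image_closedBall G⟩
  refine ⟨q, ‖F‖, norm_pos.le, fun b => ?_⟩
  change f b = ‖F‖ * (((‖F‖⁻¹ : ℝ) : ℂ) * f b)
  rw [← mul_assoc, ← Complex.ofReal_mul, mul_inv_cancel₀ norm_pos.ne', Complex.ofReal_one, one_mul]

lemma exists_universalRep_vector (f : B →ₚ[ℂ] ℂ) :
    ∃ z : UnivSpace B, ∀ b, ⟪z, universalRep B b z⟫_ℂ = f b := by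
  classical
  rcases eq_or_ne f 0 with rfl | hf
  · exact ⟨0, fun b => inner_zero_left _⟩
  obtain ⟨q, c, hc, hfq⟩ := exists_state_eq_mul f hf
  obtain ⟨Ω, -, hΩ⟩ := exists_gns_cyclic_vector q.1
  refine ⟨(√c : ℂ) • lp.single 2 q Ω, fun b => ?_⟩
  rw [map_smul, inner_smul_left, inner_smul_right, universalRep_single, lp.inner_single_left,
    lp.single_apply_self, hΩ, Complex.conj_ofReal, ← mul_assoc, ← Complex.ofReal_mul,
    Real.mul_self_sqrt hc, hfq]

lemma tendsto_of_tendsto_universalRep (f : B →L[ℂ] ℂ) {α : Type*} {l : Filter α} {m : α → B}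
    {b : B} (h : ∀ s t, Tendsto (fun i => ⟪s, universalRep B (m i) t⟫_ℂ) l
      (𝓝 ⟪s, universalRep B b t⟫_ℂ)) :
    Tendsto (fun i => f (m i)) l (𝓝 (f b)) := by
  suffices ∀ g ∈ Submodule.span ℂ {p : B →ₗ[ℂ] ℂ | ∀ b, 0 ≤ b → 0 ≤ p b},
      Tendsto (fun i => g (m i)) l (𝓝 (g b)) from this _ (mem_span_positive f)
  intro g hg
  induction hg using Submodule.span_induction with
  | mem p hp =>
    obtain ⟨z, hz⟩ := exists_universalRep_vector (PositiveLinearMap.mk₀ p hp)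
    simpa only [hz] using! h z z
  | zero => exact tendsto_const_nhds
  | add g g' _ _ hg hg' => exact hg.add hg'
  | smul c g _ hg => exact hg.const_mul c

end Universal

section UniversalEquivalence

lemma mem_closure_pi_of_tendsto_dual {ι E α : Type*} [NormedAddCommGroup E] [NormedSpace ℂ E]
    {S : Set (ι → E)} (hS : Convex ℝ S) {φ : ι → E} {l : Filter α} [l.NeBot] {ψ : α → ι → E}
    (hψ : ∀ i, ψ i ∈ S)
    (h : ∀ (f : E →L[ℂ] ℂ) (a : ι), Tendsto (fun i => f (ψ i a)) l (𝓝 (f (φ a)))) :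
    φ ∈ closure S := by
  classical
  refine mem_closure_of_forall_finset fun I ε hε => ?_
  let res : (ι → E) →ₗ[ℝ] (I → E) := LinearMap.funLeft ℝ E Subtype.val
  have res_mem : res φ ∈ closure (res '' S) := by
    by_contra hnot
    obtain ⟨f, c, hfc, hcf⟩ := RCLike.geometric_hahn_banach_closed_point (𝕜 := ℂ)
      (hS.linear_image res).closure isClosed_closure hnot
    have tendsto_f : Tendsto (fun i => f (res (ψ i))) l (𝓝 (f (res φ))) := by
      simp only [← f.sum_comp_single]
      exact tendsto_finsetSum _ fun a _ => h (f ∘L .single ℂ (fun _ : I => E) a) a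
    exact hcf.not_ge <| le_of_tendsto ((Complex.continuous_re.tendsto _).comp tendsto_f)
      (.of_forall fun i => (hfc _ (subset_closure ⟨_, hψ i, rfl⟩)).le)
  obtain ⟨_, ⟨g, hg, rfl⟩, hdist⟩ := Metric.mem_closure_iff.mp res_mem ε hε
  refine ⟨g, hg, fun a ha => ?_⟩
  rw [dist_comm]
  exact (dist_le_pi_dist _ _ (⟨a, ha⟩ : I)).trans_lt hdist

lemma mem_closure_of_tendsto_norm {ι E α : Type*} [NormedAddCommGroup E] {S : Set (ι → E)}
    {φ : ι → E} {l : Filter α} [l.NeBot] {ψ : α → ι → E} (hψ : ∀ i, ψ i ∈ S)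
    (h : ∀ a, Tendsto (fun i => ‖φ a - ψ i a‖) l (𝓝 0)) : φ ∈ closure S := by
  refine mem_closure_of_tendsto (b := l) (tendsto_pi_nhds.mpr fun a => ?_) (.of_forall hψ)
  rw [tendsto_iff_norm_sub_tendsto_zero]
  simpa only [norm_sub_rev] using h a

variable {A : Type u} {B : Type v} [CStarAlgebra A] [NonUnitalCStarAlgebra B]
  [PartialOrder B] [StarOrderedRing B]
  {X : Corr.{u, v, w} A B} {Y : Corr.{u, v, y} A B}

lemma WeaklyContained.mem_closure_dominated (hXY : WeaklyContained (universalRep B) X Y)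
    (ξ : X.carrier) :
    coeff X ξ ∈ closure {ψ | ψ ∈ coeffHull Y ∧ ψ 1 ≤ coeff X ξ 1} := by
  obtain ⟨ι, _, _, _, ψ, hψ, ht⟩ := hXY.exists_dominated_net nondegenerate_universalRep ξ
  have convex_le : Convex ℝ {ψ : A → B | ψ 1 ≤ coeff X ξ 1} :=
    (convex_Iic (coeff X ξ 1)).linear_preimage (LinearMap.proj (1 : A) : (A → B) →ₗ[ℝ] B)
  exact mem_closure_pi_of_tendsto_dual ((convex_convexHull ℝ _).inter convex_le) hψ fun f a =>
    tendsto_of_tendsto_universalRep f (tendsto_inner_of_tendsto_sigmaWeak (ht a))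

theorem WeaklyContained.exists_dominated_norm_net
    (hXY : WeaklyContained (universalRep B) X Y) (ξ : X.carrier) :
    ∃ (ι : Type (max u v)) (_ : Preorder ι) (_ : IsDirectedOrder ι)
      (_ : Nonempty ι) (ψ : ι → A → B),
      (∀ i, ψ i ∈ coeffHull Y ∧ ψ i 1 ≤ coeff X ξ 1) ∧
      ∀ a : A, Tendsto (fun i => ‖coeff X ξ a - ψ i a‖) atTop (𝓝 0) := by
  have := hXY.mem_closure_dominated ξ
  rw [← Set.image_id {ψ | ψ ∈ coeffHull Y ∧ ψ 1 ≤ coeff X ξ 1}] at this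
  obtain ⟨ι, i₁, i₂, i₃, ψ, hψ, ht⟩ := exists_net_of_mem_closure_image.{_, _, max u v} this
  refine ⟨ι, i₁, i₂, i₃, ψ, hψ, fun a => ?_⟩
  simpa only [id_eq, norm_sub_rev] using
    tendsto_iff_norm_sub_tendsto_zero.mp (tendsto_pi_nhds.mp ht a)

theorem weaklyContained_of_mem_closure
    {H : Type x} [NormedAddCommGroup H] [InnerProductSpace ℂ H] [CompleteSpace H]
    {π : B →⋆ₙₐ[ℂ] (H →L[ℂ] H)} (h : ∀ ξ : X.carrier, coeff X ξ ∈ closure (coeffHull Y)) :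
    WeaklyContained π X Y := by
  refine weaklyContained_of_total (S := Set.univ) (by simp) fun ξ _ => ?_
  have := image_closure_subset_closure_image (continuous_weakCoord π) ⟨_, h ξ, rfl⟩
  exact closure_mono (Set.image_mono fun ψ hψ => mem_coeffCone_iff.mpr hψ) this

end UniversalEquivalence

end CStarCorr

end

open CStarCorr Filter in
theorem mainTheorem2 {A : Type u} {B : Type v} [CStarAlgebra A] [NonUnitalCStarAlgebra B]
    [PartialOrder B] [StarOrderedRing B] (X : Corr.{u, v, w} A B) (Y : Corr.{u, v, y} A B)
    {H : Type x} [NormedAddCommGroup H] [InnerProductSpace ℂ H] [CompleteSpace H]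
    (π : B →⋆ₙₐ[ℂ] (H →L[ℂ] H)) (hπ : Nondegenerate π) :
    List.TFAE [
      WeaklyContained π X Y,
      ∀ ξ : X.carrier, ∃ (ι : Type (max u v x)) (_ : Preorder ι) (_ : IsDirectedOrder ι)
        (_ : Nonempty ι) (ψ : ι → A → B), (∀ i, ψ i ∈ coeffHull Y) ∧
        ∀ a : A, Tendsto (fun i => π (ψ i a)) atTop (@nhds _ (sigmaWeak H) (π (coeff X ξ a))),
      ∀ ξ : X.carrier, ∃ (ι : Type (max u v x)) (_ : Preorder ι) (_ : IsDirectedOrder ι)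
        (_ : Nonempty ι) (ψ : ι → A → B),
        (∀ i, ψ i ∈ coeffHull Y ∧ ψ i 1 ≤ coeff X ξ 1) ∧
        ∀ a : A, Tendsto (fun i => π (ψ i a)) atTop (@nhds _ (sigmaWeak H) (π (coeff X ξ a))),
      VNWeaklyContained (baseChange X (toBicommutant π)) (baseChange Y (toBicommutant π)),
      VNWeaklyContainedSome (baseChange X (toBicommutant π)) (baseChange Y (toBicommutant π))] ∧
    List.TFAE [
      WeaklyContained (universalRep B) X Y,
      ∀ ξ : X.carrier, coeff X ξ ∈ closure (coeffHull Y),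
      ∀ ξ : X.carrier, ∃ (ι : Type (max u v)) (_ : Preorder ι) (_ : IsDirectedOrder ι)
        (_ : Nonempty ι) (ψ : ι → A → B),
        (∀ i, ψ i ∈ coeffHull Y ∧ ψ i 1 ≤ coeff X ξ 1) ∧
        ∀ a : A, Tendsto (fun i => ‖coeff X ξ a - ψ i a‖) atTop (nhds 0)] := by
  constructor
  · tfae_have 1 → 3 := fun h ξ => h.exists_dominated_net hπ ξ
    tfae_have 3 → 2 := fun h ξ => by
      obtain ⟨ι, i₁, i₂, i₃, ψ, hψ, ht⟩ := h ξ
      exact ⟨ι, i₁, i₂, i₃, ψ, fun i => (hψ i).1, ht⟩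
    tfae_have 2 → 1 := weaklyContained_of_forall_exists_net
    tfae_have 2 → 4 := fun h _ _ _ _ _ hσ => hσ.weaklyContained_baseChange h
    tfae_have 4 → 5 := fun h => ⟨H, inferInstance, inferInstance, inferInstance, VN.idRep _,
      VN.isFaithfulNormal_idRep, h H _ VN.isFaithfulNormal_idRep⟩
    tfae_have 5 → 1 := by
      rintro ⟨K, _, _, _, σ, hσ, h⟩
      exact weaklyContained_of_baseChange hπ hσ h
    tfae_finish
  · tfae_have 1 → 3 := fun h ξ => h.exists_dominated_norm_net ξ
    tfae_have 3 → 2 := fun h ξ => by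
      obtain ⟨ι, _, _, _, ψ, hψ, ht⟩ := h ξ
      exact mem_closure_of_tendsto_norm (fun i => (hψ i).1) ht
    tfae_have 2 → 1 := weaklyContained_of_mem_closure
    tfae_finish
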